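/- Let $n\ge 2$, $m\ge 1$, $n<p<\infty$, write $B_1^+=\{y\in\mathbb R^n:|y|<1,\ y_n>0\}$, and let $\gamma_1,\dots,\gamma_m>1$. For $1\le j\le m$ and $1\le k,\ell\le n$ let $A^j_{k\ell}:\mathbb R^{m\times n}\to\mathbb R$ be real-analytic at $0$ and $g^j:\mathbb R^m\times\mathbb R^{m\times n}\to\mathbb R$ be real-analytic at $(0,0)$, with $$A^j_{nn}(0)=0,\qquad \partial_{v^i_n}g^j(0,0)=0\quad(1\le i,j\le m),$$ where $v^i_n$ is the variable of $g^j$ in whose place $\partial_n v^i$ stands. Consider the degenerate system in $B_1^+$ $$y_n\partial_n^2v^j+\gamma_j\partial_nv^j=y_n\sum_{k,\ell}A^j_{k\ell}(\nabla\mathbf v)\,\partial_{k\ell}v^j+g^j(\mathbf v,\nabla\mathbf v),\qquad j=1,\dots,m. \tag{1}$$ Derivatives are weak derivatives, and $\|\cdot\|_\infty$ is the norm of $L^\infty(B_1^+)$. For multi-indices, $|\mu|=\mu_1+\dots+\mu_n$. Set $$\|u\|_{W^{3,p}_*(B_1^+)}=\|\nabla u\|_{W^{1,p}(B_1^+)}+\|y_nD^3u\|_{L^p(B_1^+)},$$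 $$\|u\|_{s,R,r}=\sum_{|\mu|+\mu_n\le s}\frac{R^{|\mu|}r^{\mu_n}}{|\mu|!}\Big(\|y_n\partial_n\partial^\mu u\|_\infty+(\mu_n+1)\|\partial^\mu u\|_\infty\Big),$$ and for vector-valued functions sum these norms over the components. **Proposition.** Given such $n,m,p,\gamma_j,A^j_{k\ell},g^j$ and constants $C,C_1,R_1>0$, there are constants $C_0>0$, $0<r,R<1$ and $\bar\varepsilon>0$, depending only on these data, such that the following holds for every $0<\varepsilon_0\le\bar\varepsilon$. Let $\mathbf v=(v^1,\dots,v^m)$ be a solution of (1) (almost everywhere in $B_1^+$) with $$\|v^j\|_{L^\infty(B_1^+)}\le\varepsilon_0\ (1\le j\le m),\qquad \|\mathbf v\|_{W^{3,p}_*(B_1^+)}\le C\varepsilon_0,$$ which is tangentially analytic in the sense that $$\sum_{\mu:\ \mu_n=0}\frac{R_1^{|\mu|}}{|\mu|!}\Big(\|y_n\partial_n\partial^\mu\nabla\mathbf v\|_\infty+\|\partial^\mu\nabla\mathbf v\|_\infty\Big)\le C_1\varepsilon_0 .$$ Then all weak derivatives of $\mathbf v$ exist in $L^\infty(B_1^+)$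 and $$\|\nabla\mathbf v\|_{s,R,r}\le C_0\varepsilon_0\qquad\text{for all } s\in\mathbb N .$$ Consequently, with $R_0=rR$, $$\|\partial^\mu\mathbf v\|_{L^\infty(B_1^+)}\le C_0R_0^{-k}k!\qquad\text{for every } k\in\mathbb N\text{ and every multi-index with }|\mu|=k,$$ and $\mathbf v$ is jointly analytic up to the boundary: it coincides almost everywhere in $B_1^+$ with a function on $\overline{B_1^+}$ which, around each point $a\in\overline{B_1^+}$, is given on $\overline{B_1^+}$ by a power series in $y-a$ convergent in a neighbourhood of $a$. -/

import Mathlib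

open MeasureTheory
open scoped ENNReal

noncomputable section

namespace DegenerateSystem

/-- The space `ℝⁿ`, with `n = d + 1`. The last coordinate is the normal one. -/
abbrev Space (d : ℕ) : Type := EuclideanSpace ℝ (Fin (d + 1))

/-- The normal coordinate `y_n` of a point. -/
def normalCoord {d : ℕ} (y : Space d) : ℝ := y (Fin.last d)

/-- The open unit half ball `B_1^+ = {|y| < 1, y_n > 0}`. -/
def halfBall (d : ℕ) : Set (Space d) := {y | ‖y‖ < 1 ∧ 0 < normalCoord y}

/-- Multi-indices `μ = (μ_1, …, μ_n)`. -/
abbrev MultiIndex (d : ℕ) : Type := Fin (d + 1) → ℕ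

/-- The order `|μ| = μ_1 + ⋯ + μ_n` (the normal entry included). -/
def order {d : ℕ} (μ : MultiIndex d) : ℕ := ∑ i, μ i

/-- The multi-index of the single derivative `∂_i`. -/
def unitIndex {d : ℕ} (i : Fin (d + 1)) : MultiIndex d := Pi.single i 1

/-- The classical partial derivative `∂_i ψ`. -/
def partialDeriv {d : ℕ} (i : Fin (d + 1)) (ψ : Space d → ℝ) : Space d → ℝ :=
  fun y => fderiv ℝ ψ y (EuclideanSpace.single i 1)

/-- The classical derivative `∂^μ ψ = ∂_1^{μ_1} ⋯ ∂_n^{μ_n} ψ`, used for smooth functions only. -/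
def multiDeriv {d : ℕ} (μ : MultiIndex d) (ψ : Space d → ℝ) : Space d → ℝ :=
  (List.finRange (d + 1)).foldr (fun i f => (partialDeriv i)^[μ i] f) ψ

/-- `w` is the weak derivative `∂^μ u` in the half ball `B_1^+`. -/
structure IsWeakDeriv {d : ℕ} (μ : MultiIndex d) (u w : Space d → ℝ) : Prop where
  locallyIntegrable : LocallyIntegrableOn u (halfBall d)
  locallyIntegrable_deriv : LocallyIntegrableOn w (halfBall d)
  integral_eq : ∀ ψ : Space d → ℝ, ContDiff ℝ (⊤ : ℕ∞) ψ → HasCompactSupport ψ →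
    tsupport ψ ⊆ halfBall d →
    ∫ y in halfBall d, u y * multiDeriv μ ψ y
      = (-1) ^ order μ * ∫ y in halfBall d, w y * ψ y

/-- `‖∂^μ u‖_{L^p(B_1^+)}` for the weak derivative `∂^μ u`. The weak derivative is unique almost
everywhere, so that the infimum runs over a single value; it is `∞` when `∂^μ u` does not exist. -/
def derivNorm {d : ℕ} (p : ℝ≥0∞) (μ : MultiIndex d) (u : Space d → ℝ) : ℝ≥0∞ :=
  ⨅ (w : Space d → ℝ) (_ : IsWeakDeriv μ u w), eLpNorm w p (volume.restrict (halfBall d))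

/-- `‖y_n ∂^μ u‖_{L^p(B_1^+)}` for the weak derivative `∂^μ u`; it is `∞` when `∂^μ u` does not
exist. -/
def weightedDerivNorm {d : ℕ} (p : ℝ≥0∞) (μ : MultiIndex d) (u : Space d → ℝ) : ℝ≥0∞ :=
  ⨅ (w : Space d → ℝ) (_ : IsWeakDeriv μ u w),
    eLpNorm (fun y => normalCoord y * w y) p (volume.restrict (halfBall d))

/-- The norm `‖u‖_{W^{k,p}_*} = ‖∇u‖_{W^{k-2,p}} + ‖y_n D^k u‖_{L^p}` on the half ball, for `2 ≤ k`
(it does not see constants). -/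
def wStarNorm {d : ℕ} (k : ℕ) (p : ℝ≥0∞) (u : Space d → ℝ) : ℝ≥0∞ :=
  (∑' μ : {μ : MultiIndex d // 1 ≤ order μ ∧ order μ + 1 ≤ k}, derivNorm p μ.1 u)
    + ∑' μ : {μ : MultiIndex d // order μ = k}, weightedDerivNorm p μ.1 u

/-- The norm `‖∇v‖_{s,R,r}`, summed over the components `∂_i v^j` of `∇v`, where
`‖u‖_{s,R,r} = ∑_{|μ|+μ_n ≤ s} R^{|μ|} r^{μ_n} / |μ|! (‖y_n ∂_n ∂^μ u‖_∞ + (μ_n + 1) ‖∂^μ u‖_∞)`. -/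
def gradNorm {d m : ℕ} (s : ℕ) (R r : ℝ) (v : Space d → Fin m → ℝ) : ℝ≥0∞ :=
  ∑ j : Fin m, ∑ i : Fin (d + 1),
    ∑' μ : {μ : MultiIndex d // order μ + μ (Fin.last d) ≤ s},
      ENNReal.ofReal (R ^ order μ.1 * r ^ μ.1 (Fin.last d) / ((order μ.1).factorial : ℝ)) *
        (weightedDerivNorm ∞ (μ.1 + unitIndex i + unitIndex (Fin.last d)) (fun y => v y j)
          + ((μ.1 (Fin.last d) + 1 : ℕ) : ℝ≥0∞)
            * derivNorm ∞ (μ.1 + unitIndex i) (fun y => v y j))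

/-- The tangential sum
`∑_{μ_n = 0} R^{|μ|} / |μ|! (‖y_n ∂_n ∂^μ ∇v‖_∞ + ‖∂^μ ∇v‖_∞)`, over all multi-indices with
`μ_n = 0`, again summed over the components of `∇v`. -/
def tangentialNorm {d m : ℕ} (R : ℝ) (v : Space d → Fin m → ℝ) : ℝ≥0∞ :=
  ∑ j : Fin m, ∑ i : Fin (d + 1),
    ∑' μ : {μ : MultiIndex d // μ (Fin.last d) = 0},
      ENNReal.ofReal (R ^ order μ.1 / ((order μ.1).factorial : ℝ)) *
        (weightedDerivNorm ∞ (μ.1 + unitIndex i + unitIndex (Fin.last d)) (fun y => v y j)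
          + derivNorm ∞ (μ.1 + unitIndex i) (fun y => v y j))

/-- The space of values of `∇v`; the entry `(i, l)` stands for `∂_l v^i`. -/
abbrev Grad (d m : ℕ) : Type := Fin m → Fin (d + 1) → ℝ

/-- `v` solves, almost everywhere in the half ball and with weak derivatives,
`y_n ∂_n² v^j + γ_j ∂_n v^j = y_n ∑_{k,l} A^j_{kl}(∇v) ∂_{kl} v^j + g^j(v, ∇v)`, `j = 1, …, m`. -/
def IsSolution {d m : ℕ} (γ : Fin m → ℝ)
    (A : Fin m → Fin (d + 1) → Fin (d + 1) → Grad d m → ℝ)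
    (g : Fin m → (Fin m → ℝ) × Grad d m → ℝ) (v : Space d → Fin m → ℝ) : Prop :=
  ∃ (D : Space d → Grad d m) (H : Fin m → Fin (d + 1) → Fin (d + 1) → Space d → ℝ),
    (∀ j i, IsWeakDeriv (unitIndex i) (fun y => v y j) (fun y => D y j i)) ∧
    (∀ j k l, IsWeakDeriv (unitIndex k + unitIndex l) (fun y => v y j) (H j k l)) ∧
    ∀ j, ∀ᵐ y ∂(volume.restrict (halfBall d)),
      normalCoord y * H j (Fin.last d) (Fin.last d) y + γ j * D y j (Fin.last d)
        = normalCoord y * (∑ k, ∑ l, A j k l (D y) * H j k l y) + g j (v y, D y)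

end DegenerateSystem

end

/-! Put u = ∂_n v^j. Along the normal rays the system is a Fuchsian equation y_n ∂_n u + γ_j u = F,
and applying ∂^μ turns it into (y_n ∂_n + γ_j + μ_n) ∂^μ u = ∂^μ F. The homogeneous solutions
y_n^{-(γ_j + μ_n)} blow up at y_n = 0, so a bounded ∂^μ u satisfies |∂^μ u| ≤ sup |∂^μ F| / (γ_j +
μ_n). Hence sup |y_n ∂_n ∂^μ u| + (μ_n + 1) sup |∂^μ u| ≤ 3 sup |∂^μ F| (`fuchsian_bound`,
`weightedMajorant_le_of_fuchsian`).

These bounds are collected in truncated majorants Σ_{k ≤ s} (R^k / k!) sup_{|μ| = k} r^{μ_n} (...).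
The unweighted ones are submultiplicative by the Leibniz rule (`majorant_mul_le`), so power series
in (v, ∇v) can be estimated (`exists_majorant_comp_le`). Let X be the weighted majorant of ∇v and N
the majorant of (v, ∇v). Every part of F is either of the size ε of the data or carries a small
factor: the (n,n) second derivative is multiplied by A_nn, which vanishes at 0, and contributes N X;
every other second derivative contains a tangential derivative, and the weight y_n lets a normal
derivative be traded for it, which gains r, up to purely tangential terms controlled by hypothesis
(`orderSup_weighted_tangential_le`); the linear part of g contains v, which gains R, and tangential
derivatives of v, which gain r, but not ∂_n v; g(0,0) is O(ε), as one sees by reading the equation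
at a single point (`source_zero_le`). The result is X ≤ a ε + b (r + R + N) X with N ≤ m ε + 2 X
(`gradMajorant_absorbed_le`).

Absorbing the last term requires X to be finite and N to be small. Finiteness is a qualitative
matter. Interior smoothness is bootstrapped by solving the equation for ∂_n² v, tangential
derivatives being available to all orders (`exists_smooth_solution`). Boundedness of all derivatives
up to the flat boundary goes by induction on |μ| + μ_n: modulo bounded terms, ∂^μ ∂_n v solves a
Fuchsian system with small coupling (`weightedBounded_of_solution`). Smallness comes from continuity
in R: for fixed s, X is a polynomial in R, it is O(ε) at R = 0, and by the estimate it cannot cross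
a fixed threshold (`exists_gradMajorant_le`). Nothing depends on s.

The resulting factorial bounds give Taylor series with one common radius at all points of the convex
half ball, and these fit together to an analytic function on the closure
(`exists_analyticOn_closure`). -/

namespace DegenerateSystem
open Set Filter Topology

variable {d : ℕ}

/-- The `i`-th coordinate direction. -/
noncomputable def dir (i : Fin (d + 1)) : Space d := EuclideanSpace.single i 1

theorem partialDeriv_apply (i : Fin (d + 1)) (f : Space d → ℝ) (y : Space d) :
    partialDeriv i f y = fderiv ℝ f y (dir i) := rfl

/-! ### Multi-indices -/

section Order

theorem order_zero : order (0 : MultiIndex d) = 0 := by simp [order]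

theorem order_add (μ ν : MultiIndex d) : order (μ + ν) = order μ + order ν := by
  simp [order, Finset.sum_add_distrib]

theorem order_unitIndex (i : Fin (d + 1)) : order (unitIndex i : MultiIndex d) = 1 := by
  simp [order, unitIndex]

theorem order_add_unit (μ : MultiIndex d) (i : Fin (d + 1)) :
    order (μ + unitIndex i) = order μ + 1 := by rw [order_add, order_unitIndex]

theorem exists_sub_unit {μ : MultiIndex d} {i : Fin (d + 1)} (h : μ i ≠ 0) :
    ∃ ν, μ = ν + unitIndex i := by
  refine ⟨μ - unitIndex i, ?_⟩
  ext j
  rcases eq_or_ne j i with rfl | hj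
  · simp [unitIndex]; omega
  · simp [unitIndex, hj]

theorem eq_zero_of_order {μ : MultiIndex d} (h : order μ = 0) : μ = 0 := by
  ext i
  simpa [order] using (Finset.sum_eq_zero_iff.1 h) i (Finset.mem_univ i)

theorem exists_unit_of_order_succ {μ : MultiIndex d} {k : ℕ} (h : order μ = k + 1) :
    ∃ ν i, μ = ν + unitIndex i ∧ order ν = k := by
  obtain ⟨i, hi⟩ : ∃ i, μ i ≠ 0 := by
    by_contra! hc
    have : μ = 0 := funext hc
    rw [this, order_zero] at h
    omega
  obtain ⟨ν, rfl⟩ := exists_sub_unit hi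
  exact ⟨ν, i, rfl, by rw [order_add_unit] at h; omega⟩

theorem le_order (μ : MultiIndex d) (i : Fin (d + 1)) : μ i ≤ order μ :=
  Finset.single_le_sum (f := μ) (fun _ _ => Nat.zero_le _) (Finset.mem_univ i)

/-- Induction on multi-indices, one derivative at a time. -/
theorem multiIndex_induction {P : MultiIndex d → Prop} (zero : P 0)
    (step : ∀ μ i, P μ → P (μ + unitIndex i)) (μ : MultiIndex d) : P μ := by
  induction h : order μ generalizing μ with
  | zero => rw [eq_zero_of_order h]; exact zero
  | succ k ih =>
    obtain ⟨ν, i, rfl, hν⟩ := exists_unit_of_order_succ h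
    exact step ν i (ih ν hν)

theorem unitIndex_self (i : Fin (d + 1)) : (unitIndex i : MultiIndex d) i = 1 := by
  simp [unitIndex]

theorem unitIndex_ne {i j : Fin (d + 1)} (h : j ≠ i) : (unitIndex i : MultiIndex d) j = 0 := by
  simp [unitIndex, h]

end Order

/-! ### Calculus of iterated classical derivatives -/

section Smooth

variable {U : Set (Space d)} {f g : Space d → ℝ} {i j : Fin (d + 1)}

/-- Smoothness on a set, the notion used for all classical computations. -/
abbrev SmoothOn (f : Space d → ℝ) (U : Set (Space d)) : Prop := ContDiffOn ℝ (⊤ : ℕ∞) f U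

theorem SmoothOn.differentiableAt (hf : SmoothOn f U) (hU : IsOpen U) {y : Space d} (hy : y ∈ U) :
    DifferentiableAt ℝ f y :=
  (hf.contDiffAt (hU.mem_nhds hy)).differentiableAt (by simp)

theorem SmoothOn.partialDeriv (hf : SmoothOn f U) (hU : IsOpen U) (i : Fin (d + 1)) :
    SmoothOn (partialDeriv i f) U :=
  (hf.fderiv_of_isOpen hU (m := (⊤ : ℕ∞)) (by simp)).clm_apply contDiffOn_const

theorem partialDeriv_congr (hU : IsOpen U) (h : EqOn f g U) (i : Fin (d + 1)) :
    EqOn (partialDeriv i f) (partialDeriv i g) U := fun y hy => by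
  simp only [partialDeriv_apply]
  rw [(h.eventuallyEq_of_mem (hU.mem_nhds hy)).fderiv_eq]

theorem partialDeriv_add (hU : IsOpen U) (hf : SmoothOn f U) (hg : SmoothOn g U)
    (i : Fin (d + 1)) :
    EqOn (partialDeriv i fun y => f y + g y) (fun y => partialDeriv i f y + partialDeriv i g y)
      U := fun y hy => by
  simp only [partialDeriv_apply]
  rw [fderiv_fun_add (hf.differentiableAt hU hy) (hg.differentiableAt hU hy)]; rfl

theorem partialDeriv_mul (hU : IsOpen U) (hf : SmoothOn f U) (hg : SmoothOn g U)
    (i : Fin (d + 1)) :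
    EqOn (partialDeriv i fun y => f y * g y)
      (fun y => partialDeriv i f y * g y + f y * partialDeriv i g y) U := fun y hy => by
  simp only [partialDeriv_apply]
  rw [fderiv_fun_mul (hf.differentiableAt hU hy) (hg.differentiableAt hU hy)]
  simp; ring

theorem partialDeriv_const (c : ℝ) (i : Fin (d + 1)) :
    partialDeriv i (fun _ : Space d => c) = fun _ => 0 := by
  ext y; simp [partialDeriv_apply]

theorem partialDeriv_comm (hU : IsOpen U) (hf : SmoothOn f U) (i j : Fin (d + 1)) :
    EqOn (partialDeriv i (partialDeriv j f)) (partialDeriv j (partialDeriv i f)) U :=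
  fun y hy => by
  have hf' : ContDiffAt ℝ (⊤ : ℕ∞) f y := hf.contDiffAt (hU.mem_nhds hy)
  have hd : DifferentiableAt ℝ (fderiv ℝ f) y :=
    (hf'.fderiv_right (m := (⊤ : ℕ∞)) (by simp)).differentiableAt (by simp)
  have key : ∀ a b : Fin (d + 1), DegenerateSystem.partialDeriv a (DegenerateSystem.partialDeriv b f) y
      = fderiv ℝ (fderiv ℝ f) y (dir a) (dir b) := fun a b => by
    have : DegenerateSystem.partialDeriv b f = fun z => fderiv ℝ f z (dir b) := rfl
    rw [partialDeriv_apply, this, fderiv_clm_apply hd (differentiableAt_const _)]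
    simp
  rw [key, key]
  exact (hf'.isSymmSndFDerivAt (by simpa using (WithTop.coe_le_coe.2 (le_top : (2 : ℕ∞) ≤ ⊤)))) _ _

theorem iterate_partialDeriv_smooth (hU : IsOpen U) (hf : SmoothOn f U) (i : Fin (d + 1)) (k : ℕ) :
    SmoothOn ((partialDeriv i)^[k] f) U := by
  induction k with
  | zero => exact hf
  | succ k ih => rw [Function.iterate_succ_apply']; exact SmoothOn.partialDeriv ih hU i

theorem iterate_partialDeriv_congr (hU : IsOpen U) (h : EqOn f g U) (i : Fin (d + 1)) (k : ℕ) :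
    EqOn ((partialDeriv i)^[k] f) ((partialDeriv i)^[k] g) U := by
  induction k with
  | zero => exact h
  | succ k ih =>
    rw [Function.iterate_succ_apply', Function.iterate_succ_apply']
    exact partialDeriv_congr hU ih i

theorem iterate_partialDeriv_comm (hU : IsOpen U) (hf : SmoothOn f U) (i j : Fin (d + 1)) (k : ℕ) :
    EqOn ((partialDeriv j)^[k] (partialDeriv i f)) (partialDeriv i ((partialDeriv j)^[k] f)) U := by
  induction k with
  | zero => exact fun _ _ => rfl
  | succ k ih =>
    rw [Function.iterate_succ_apply', Function.iterate_succ_apply']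
    exact (partialDeriv_congr hU ih j).trans
      (partialDeriv_comm hU (iterate_partialDeriv_smooth hU hf j k) j i)

/-- The iterated derivative along the directions in a list. -/
noncomputable def listDeriv (l : List (Fin (d + 1))) (μ : MultiIndex d) (f : Space d → ℝ) :
    Space d → ℝ :=
  l.foldr (fun i f => (partialDeriv i)^[μ i] f) f

theorem listDeriv_smooth (hU : IsOpen U) (hf : SmoothOn f U) (l : List (Fin (d + 1)))
    (μ : MultiIndex d) : SmoothOn (listDeriv l μ f) U := by
  induction l with
  | nil => exact hf
  | cons j l ih => exact iterate_partialDeriv_smooth hU ih j _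

theorem listDeriv_congr (hU : IsOpen U) (h : EqOn f g U) (l : List (Fin (d + 1)))
    (μ : MultiIndex d) : EqOn (listDeriv l μ f) (listDeriv l μ g) U := by
  induction l with
  | nil => exact h
  | cons j l ih => exact iterate_partialDeriv_congr hU ih j _

theorem listDeriv_add_of_notMem {l : List (Fin (d + 1))} (μ : MultiIndex d) (hi : i ∉ l) :
    listDeriv l (μ + unitIndex i) f = listDeriv l μ f := by
  induction l with
  | nil => rfl
  | cons j l ih =>
    simp only [List.mem_cons, not_or] at hi
    have h1 : (μ + unitIndex i) j = μ j := by simp [unitIndex_ne (Ne.symm hi.1)]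
    simp only [listDeriv, List.foldr_cons] at ih ⊢
    rw [h1, ih hi.2]

/-- The extra ∂_i appears at the place of i inside the composition, and symmetry of second
derivatives moves it to the outside. Since the list has no repetitions, it appears only once. -/
theorem listDeriv_add_of_mem (hU : IsOpen U) (hf : SmoothOn f U) {l : List (Fin (d + 1))}
    (hl : l.Nodup) (μ : MultiIndex d) (hi : i ∈ l) :
    EqOn (listDeriv l (μ + unitIndex i) f) (partialDeriv i (listDeriv l μ f)) U := by
  induction l with
  | nil => simp at hi
  | cons j l ih =>
    rw [List.nodup_cons] at hl
    have h1 : ∀ ν : MultiIndex d, listDeriv (j :: l) ν f = (partialDeriv j)^[ν j] (listDeriv l ν f) :=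
      fun _ => rfl
    rw [h1, h1]
    rcases eq_or_ne j i with rfl | hj
    · rw [listDeriv_add_of_notMem μ hl.1, Pi.add_apply, unitIndex_self,
        Function.iterate_succ_apply']
      exact fun _ _ => rfl
    · have hi' : i ∈ l := by simpa [Ne.symm hj] using hi
      rw [Pi.add_apply, unitIndex_ne hj, add_zero]
      exact (iterate_partialDeriv_congr hU (ih hl.2 hi') j _).trans
        (iterate_partialDeriv_comm hU (listDeriv_smooth hU hf l μ) i j _)

theorem listDeriv_partialDeriv (hU : IsOpen U) (hf : SmoothOn f U) (l : List (Fin (d + 1)))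
    (μ : MultiIndex d) :
    EqOn (listDeriv l μ (partialDeriv i f)) (partialDeriv i (listDeriv l μ f)) U := by
  induction l with
  | nil => exact fun _ _ => rfl
  | cons j l ih =>
    exact (iterate_partialDeriv_congr hU ih j _).trans
      (iterate_partialDeriv_comm hU (listDeriv_smooth hU hf l μ) i j _)

theorem multiDeriv_smooth (hU : IsOpen U) (hf : SmoothOn f U) (μ : MultiIndex d) :
    SmoothOn (multiDeriv μ f) U := listDeriv_smooth hU hf _ μ

theorem multiDeriv_congr (hU : IsOpen U) (h : EqOn f g U) (μ : MultiIndex d) :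
    EqOn (multiDeriv μ f) (multiDeriv μ g) U := listDeriv_congr hU h _ μ

theorem multiDeriv_zero (f : Space d → ℝ) : multiDeriv 0 f = f := by
  have : ∀ l : List (Fin (d + 1)), listDeriv l 0 f = f := fun l => by
    induction l with
    | nil => rfl
    | cons j l ih => simp only [listDeriv, List.foldr_cons] at ih ⊢; rw [ih]; rfl
  exact this _

theorem multiDeriv_add_unit (hU : IsOpen U) (hf : SmoothOn f U) (μ : MultiIndex d)
    (i : Fin (d + 1)) :
    EqOn (multiDeriv (μ + unitIndex i) f) (partialDeriv i (multiDeriv μ f)) U :=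
  listDeriv_add_of_mem hU hf (List.nodup_finRange _) μ (List.mem_finRange i)

theorem multiDeriv_partialDeriv (hU : IsOpen U) (hf : SmoothOn f U) (μ : MultiIndex d)
    (i : Fin (d + 1)) :
    EqOn (multiDeriv μ (partialDeriv i f)) (multiDeriv (μ + unitIndex i) f) U :=
  (listDeriv_partialDeriv hU hf _ μ).trans (multiDeriv_add_unit hU hf μ i).symm

theorem multiDeriv_unit (hU : IsOpen U) (hf : SmoothOn f U) (i : Fin (d + 1)) :
    EqOn (multiDeriv (unitIndex i) f) (partialDeriv i f) U := by
  have := multiDeriv_add_unit hU hf 0 i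
  rwa [zero_add, multiDeriv_zero] at this

theorem multiDeriv_multiDeriv (hU : IsOpen U) (hf : SmoothOn f U) (μ ν : MultiIndex d) :
    EqOn (multiDeriv μ (multiDeriv ν f)) (multiDeriv (μ + ν) f) U := by
  induction μ using multiIndex_induction with
  | zero => rw [zero_add, multiDeriv_zero]; exact fun _ _ => rfl
  | step μ i ih =>
    refine (multiDeriv_add_unit hU (multiDeriv_smooth hU hf ν) μ i).trans ?_
    refine (partialDeriv_congr hU ih i).trans ?_
    rw [add_right_comm]
    exact (multiDeriv_add_unit hU hf (μ + ν) i).symm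

theorem multiDeriv_add (hU : IsOpen U) (hf : SmoothOn f U) (hg : SmoothOn g U)
    (μ : MultiIndex d) :
    EqOn (multiDeriv μ fun y => f y + g y) (fun y => multiDeriv μ f y + multiDeriv μ g y) U := by
  induction μ using multiIndex_induction with
  | zero => simp only [multiDeriv_zero]; exact fun _ _ => rfl
  | step μ i ih =>
    refine (multiDeriv_add_unit hU (hf.add hg) μ i).trans ?_
    refine (partialDeriv_congr hU ih i).trans ?_
    refine (partialDeriv_add hU (multiDeriv_smooth hU hf μ) (multiDeriv_smooth hU hg μ) i).trans ?_
    intro y hy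
    simp only [multiDeriv_add_unit hU hf μ i hy, multiDeriv_add_unit hU hg μ i hy]

theorem multiDeriv_const_mul (hU : IsOpen U) (hf : SmoothOn f U) (c : ℝ)
    (μ : MultiIndex d) :
    EqOn (multiDeriv μ fun y => c * f y) (fun y => c * multiDeriv μ f y) U := by
  induction μ using multiIndex_induction with
  | zero => simp only [multiDeriv_zero]; exact fun _ _ => rfl
  | step μ i ih =>
    refine (multiDeriv_add_unit hU (contDiffOn_const.mul hf) μ i).trans ?_
    refine (partialDeriv_congr hU ih i).trans ?_
    refine (partialDeriv_mul hU contDiffOn_const (multiDeriv_smooth hU hf μ) i).trans ?_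
    intro y hy
    simp only [multiDeriv_add_unit hU hf μ i hy, partialDeriv_const, zero_mul, zero_add]

theorem multiDeriv_const {μ : MultiIndex d} (c : ℝ) (hμ : μ ≠ 0) (y : Space d) :
    multiDeriv μ (fun _ => c) y = 0 := by
  obtain ⟨k, hk⟩ : ∃ k, order μ = k + 1 :=
    Nat.exists_eq_succ_of_ne_zero fun h => hμ (eq_zero_of_order h)
  obtain ⟨ν, i, rfl, -⟩ := exists_unit_of_order_succ hk
  have h := multiDeriv_partialDeriv isOpen_univ (contDiffOn_const (c := c)) ν i (mem_univ y)
  rw [← h, partialDeriv_const]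
  have h0 : (fun _ : Space d => (0 : ℝ)) = fun y => 0 * (fun _ : Space d => (0 : ℝ)) y := by simp
  rw [h0, multiDeriv_const_mul isOpen_univ (contDiffOn_const (c := (0:ℝ))) 0 ν (mem_univ y)]
  simp

theorem multiDeriv_sum {ι : Type*} (hU : IsOpen U) (s : Finset ι) {F : ι → Space d → ℝ}
    (hF : ∀ a ∈ s, SmoothOn (F a) U) (μ : MultiIndex d) :
    EqOn (multiDeriv μ fun y => ∑ a ∈ s, F a y) (fun y => ∑ a ∈ s, multiDeriv μ (F a) y) U := by
  classical
  induction s using Finset.induction_on with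
  | empty =>
    intro y _
    simp only [Finset.sum_empty]
    by_cases hμ : μ = 0
    · simp [hμ, multiDeriv_zero]
    · exact multiDeriv_const 0 hμ y
  | insert a s ha ih =>
    simp only [Finset.sum_insert ha]
    have hs : ∀ b ∈ s, SmoothOn (F b) U := fun b hb => hF b (Finset.mem_insert_of_mem hb)
    refine (multiDeriv_add hU (hF a (Finset.mem_insert_self a s)) (ContDiffOn.sum hs) μ).trans ?_
    intro y hy
    simp only [ih hs hy]

end Smooth

/-! ### Geometry of the half ball -/

section HalfBall

theorem isOpen_halfBall (d : ℕ) : IsOpen (halfBall d) := by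
  have h1 : Continuous fun y : Space d => normalCoord y := by unfold normalCoord; fun_prop
  exact (isOpen_lt continuous_norm continuous_const).inter (isOpen_lt continuous_const h1)

theorem convex_halfBall (d : ℕ) : Convex ℝ (halfBall d) := by
  have h : halfBall d = Metric.ball 0 1 ∩ {y | 0 < normalCoord y} := by
    ext y; simp [halfBall]
  rw [h]
  refine (convex_ball _ _).inter fun x hx y hy a b ha hb hab => ?_
  simp only [normalCoord, mem_ofPred_eq, PiLp.add_apply, PiLp.smul_apply, smul_eq_mul] at *
  rcases ha.eq_or_lt with rfl | ha
  · have : b = 1 := by linarith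
    subst this; simpa using hy
  · have := mul_pos ha hx
    have := mul_nonneg hb hy.le
    linarith

theorem smoothOn_normalCoord (U : Set (Space d)) : SmoothOn (normalCoord (d := d)) U := by
  have : ContDiff ℝ (⊤ : ℕ∞) (normalCoord (d := d)) := by unfold normalCoord; fun_prop
  exact this.contDiffOn

theorem normalCoord_pos {y : Space d} (hy : y ∈ halfBall d) : 0 < normalCoord y := hy.2

theorem normalCoord_lt_one {y : Space d} (hy : y ∈ halfBall d) : normalCoord y < 1 :=
  lt_of_le_of_lt (le_trans (le_abs_self _) (PiLp.norm_apply_le y (Fin.last d))) hy.1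

theorem partialDeriv_normalCoord (i : Fin (d + 1)) (y : Space d) :
    partialDeriv i normalCoord y = if i = Fin.last d then 1 else 0 := by
  have h : (normalCoord : Space d → ℝ) = EuclideanSpace.proj (𝕜 := ℝ) (Fin.last d) := rfl
  rw [partialDeriv_apply, h, ContinuousLinearMap.fderiv]
  simp [dir, eq_comm]

/-- Lowering a positive normal coordinate does not increase the norm. The segment down to the flat
boundary is where the ordinary differential inequalities are integrated. -/
theorem halfBall_normal_segment {y : Space d} (hy : y ∈ halfBall d) {τ : ℝ} (h0 : 0 < τ)
    (h1 : τ ≤ normalCoord y) : y + (τ - normalCoord y) • dir (Fin.last d) ∈ halfBall d := by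
  have hn : normalCoord (y + (τ - normalCoord y) • dir (Fin.last d)) = τ := by
    simp [normalCoord, dir]
  refine ⟨lt_of_le_of_lt ?_ hy.1, by rw [hn]; exact h0⟩
  rw [EuclideanSpace.norm_eq, EuclideanSpace.norm_eq]
  refine Real.sqrt_le_sqrt (Finset.sum_le_sum fun j _ => ?_)
  rcases eq_or_ne j (Fin.last d) with rfl | hj
  · have : (y + (τ - normalCoord y) • dir (Fin.last d)) (Fin.last d) = τ := hn
    rw [this]
    have : y (Fin.last d) = normalCoord y := rfl
    rw [this]
    simp only [Real.norm_eq_abs, sq_abs]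
    gcongr
  · simp [dir, hj]

end HalfBall

end DegenerateSystem

/-! ### Weak derivatives: uniqueness, composition, comparison with classical ones -/

namespace DegenerateSystem
open Set Filter Topology

variable {d : ℕ}

/-- Test functions of the half ball. -/
structure IsTest (ψ : Space d → ℝ) : Prop where
  smooth : ContDiff ℝ (⊤ : ℕ∞) ψ
  compact : HasCompactSupport ψ
  subset : tsupport ψ ⊆ halfBall d

theorem IsTest.partialDeriv {ψ : Space d → ℝ} (hψ : IsTest ψ) (i : Fin (d + 1)) :
    IsTest (partialDeriv i ψ) where
  smooth := contDiffOn_univ.1 (SmoothOn.partialDeriv hψ.smooth.contDiffOn isOpen_univ i)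
  compact := hψ.compact.fderiv_apply (𝕜 := ℝ) _
  subset := (tsupport_fderiv_apply_subset (𝕜 := ℝ) (f := ψ) _).trans hψ.subset

theorem IsTest.multiDeriv {ψ : Space d → ℝ} (hψ : IsTest ψ) (μ : MultiIndex d) :
    IsTest (multiDeriv μ ψ) := by
  induction μ using multiIndex_induction with
  | zero => rw [multiDeriv_zero]; exact hψ
  | step μ i ih =>
    have : DegenerateSystem.multiDeriv (μ + unitIndex i) ψ
        = DegenerateSystem.partialDeriv i (DegenerateSystem.multiDeriv μ ψ) :=
      funext fun y => multiDeriv_add_unit isOpen_univ hψ.smooth.contDiffOn μ i (mem_univ y)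
    rw [this]
    exact ih.partialDeriv i

theorem integrable_mul_test {u ψ : Space d → ℝ} (hu : LocallyIntegrableOn u (halfBall d))
    (hψ : IsTest ψ) : Integrable fun y => u y * ψ y := by
  have h1 : IntegrableOn u (tsupport ψ) := hu.integrableOn_compact_subset hψ.subset hψ.compact
  have h2 : IntegrableOn (fun y => u y * ψ y) (tsupport ψ) :=
    h1.mul_continuousOn hψ.smooth.continuous.continuousOn hψ.compact
  refine (integrableOn_iff_integrable_of_support_subset ?_).1 h2
  intro y hy
  exact subset_tsupport ψ fun h0 => hy (by simp [h0])

theorem setIntegral_mul_test {ψ : Space d → ℝ} (u : Space d → ℝ) (hψ : IsTest ψ) :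
    ∫ y in halfBall d, u y * ψ y = ∫ y, u y * ψ y := by
  refine setIntegral_eq_integral_of_forall_compl_eq_zero fun y hy => ?_
  rw [image_eq_zero_of_notMem_tsupport fun h => hy (hψ.subset h), mul_zero]

theorem measurableSet_halfBall (d : ℕ) : MeasurableSet (halfBall d) :=
  (isOpen_halfBall d).measurableSet

theorem locallyIntegrableOn_congr {u w : Space d → ℝ} {s : Set (Space d)}
    (h : u =ᵐ[volume.restrict s] w) (hu : LocallyIntegrableOn u s) : LocallyIntegrableOn w s := by
  intro x hx
  obtain ⟨t, ht, hut⟩ := hu x hx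
  refine ⟨t ∩ s, inter_mem ht self_mem_nhdsWithin, ?_⟩
  refine (hut.mono_set inter_subset_left).congr_fun_ae ?_
  exact ae_mono (Measure.restrict_mono inter_subset_right le_rfl) h

theorem isWeakDeriv_congr {μ : MultiIndex d} {u u' w w' : Space d → ℝ}
    (hu : u =ᵐ[volume.restrict (halfBall d)] u') (hw : w =ᵐ[volume.restrict (halfBall d)] w')
    (h : IsWeakDeriv μ u w) : IsWeakDeriv μ u' w' where
  locallyIntegrable := locallyIntegrableOn_congr hu h.locallyIntegrable
  locallyIntegrable_deriv :=
    locallyIntegrableOn_congr hw h.locallyIntegrable_deriv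
  integral_eq ψ h1 h2 h3 := by
    have e1 : ∫ y in halfBall d, u' y * multiDeriv μ ψ y
        = ∫ y in halfBall d, u y * multiDeriv μ ψ y :=
      integral_congr_ae (hu.mono fun y hy => by simp only [hy])
    have e2 : ∫ y in halfBall d, w' y * ψ y = ∫ y in halfBall d, w y * ψ y :=
      integral_congr_ae (hw.mono fun y hy => by simp only [hy])
    rw [e1, e2, h.integral_eq ψ h1 h2 h3]

/-- This is the fundamental lemma of the calculus of variations. It makes the infima defining
`derivNorm` and `weightedDerivNorm` infima over a single value. -/
theorem isWeakDeriv_unique {μ : MultiIndex d} {u w w' : Space d → ℝ} (h : IsWeakDeriv μ u w)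
    (h' : IsWeakDeriv μ u w') : w =ᵐ[volume.restrict (halfBall d)] w' := by
  have key := IsOpen.ae_eq_zero_of_integral_contDiff_smul_eq_zero (μ := volume) (isOpen_halfBall d)
    (h.locallyIntegrable_deriv.sub h'.locallyIntegrable_deriv) fun ψ h1 h2 h3 => by
      have hψ : IsTest ψ := ⟨h1, h2, h3⟩
      have e := (h.integral_eq ψ h1 h2 h3).symm.trans (h'.integral_eq ψ h1 h2 h3)
      rw [setIntegral_mul_test _ hψ, setIntegral_mul_test _ hψ] at e
      have e' := mul_left_cancel₀ (pow_ne_zero _ (by norm_num)) e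
      have : ∀ y, ψ y • (w - w') y = w y * ψ y - w' y * ψ y := fun y => by
        simp; ring
      simp only [this]
      rw [integral_sub (integrable_mul_test h.locallyIntegrable_deriv hψ)
        (integrable_mul_test h'.locallyIntegrable_deriv hψ), e', sub_self]
  rw [Filter.EventuallyEq, ae_restrict_iff' (measurableSet_halfBall d)]
  exact key.mono fun y hy hyU => sub_eq_zero.1 (hy hyU)

theorem multiDeriv_unit_test {ψ : Space d → ℝ} (hψ : ContDiff ℝ (⊤ : ℕ∞) ψ) (i : Fin (d + 1)) :
    multiDeriv (unitIndex i) ψ = partialDeriv i ψ :=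
  funext fun y => multiDeriv_unit isOpen_univ hψ.contDiffOn i (mem_univ y)

/-- Test functions are stable under ∂_i, so the identity for F can be tested with ∂_i ψ and the sign
(-1)^|μ| cancels. In this way derivatives of v of all orders become first derivatives of each other.
-/
theorem IsWeakDeriv.step {μ : MultiIndex d} {i : Fin (d + 1)} {v F G : Space d → ℝ}
    (hF : IsWeakDeriv μ v F) (hG : IsWeakDeriv (μ + unitIndex i) v G) :
    IsWeakDeriv (unitIndex i) F G where
  locallyIntegrable := hF.locallyIntegrable_deriv
  locallyIntegrable_deriv := hG.locallyIntegrable_deriv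
  integral_eq ψ h1 h2 h3 := by
    have hψ : IsTest ψ := ⟨h1, h2, h3⟩
    have hψ' := hψ.partialDeriv i
    have e1 := hF.integral_eq _ hψ'.smooth hψ'.compact hψ'.subset
    have e2 := hG.integral_eq ψ h1 h2 h3
    have : multiDeriv μ (partialDeriv i ψ) = multiDeriv (μ + unitIndex i) ψ :=
      funext fun y => multiDeriv_partialDeriv isOpen_univ h1.contDiffOn μ i (mem_univ y)
    rw [this, e2, order_add_unit, pow_succ, mul_assoc] at e1
    have e3 := mul_left_cancel₀ (pow_ne_zero _ (by norm_num)) e1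
    rw [multiDeriv_unit_test h1, order_unitIndex, ← e3, pow_one]

theorem IsWeakDeriv.comp {μ ν : MultiIndex d} {v F G : Space d → ℝ}
    (hF : IsWeakDeriv μ v F) (hG : IsWeakDeriv ν F G) : IsWeakDeriv (μ + ν) v G where
  locallyIntegrable := hF.locallyIntegrable
  locallyIntegrable_deriv := hG.locallyIntegrable_deriv
  integral_eq ψ h1 h2 h3 := by
    have hψ : IsTest ψ := ⟨h1, h2, h3⟩
    have hψ' := hψ.multiDeriv ν
    have e1 := hF.integral_eq _ hψ'.smooth hψ'.compact hψ'.subset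
    have : multiDeriv μ (multiDeriv ν ψ) = multiDeriv (μ + ν) ψ :=
      funext fun y => multiDeriv_multiDeriv isOpen_univ h1.contDiffOn μ ν (mem_univ y)
    rw [this, hG.integral_eq ψ h1 h2 h3] at e1
    rw [e1, order_add, pow_add, mul_assoc]

theorem isWeakDeriv_zero {u : Space d → ℝ} (hu : LocallyIntegrableOn u (halfBall d)) :
    IsWeakDeriv 0 u u where
  locallyIntegrable := hu
  locallyIntegrable_deriv := hu
  integral_eq ψ _ _ _ := by simp [multiDeriv_zero, order_zero]

/-- A continuous classical derivative in a coordinate direction is a weak derivative. -/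
theorem isWeakDeriv_of_hasLineDerivAt {i : Fin (d + 1)} {F G : Space d → ℝ}
    (hF : ContinuousOn F (halfBall d)) (hG : ContinuousOn G (halfBall d))
    (h : ∀ y ∈ halfBall d, HasLineDerivAt ℝ F (G y) y (dir i)) :
    IsWeakDeriv (unitIndex i) F G where
  locallyIntegrable := hF.locallyIntegrableOn (measurableSet_halfBall d)
  locallyIntegrable_deriv := hG.locallyIntegrableOn (measurableSet_halfBall d)
  integral_eq ψ h1 h2 h3 := by
    have hψ : IsTest ψ := ⟨h1, h2, h3⟩
    have iF := hF.locallyIntegrableOn (μ := volume) (measurableSet_halfBall d)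
    have iG := hG.locallyIntegrableOn (μ := volume) (measurableSet_halfBall d)
    rw [multiDeriv_unit_test h1, order_unitIndex, setIntegral_mul_test _ hψ,
      setIntegral_mul_test _ (hψ.partialDeriv i), pow_one, neg_one_mul]
    exact integral_bilinear_hasLineDerivAt_right_eq_neg_left_of_integrable (μ := volume)
      (B := ContinuousLinearMap.mul ℝ ℝ) (f := F) (f' := G) (g := ψ) (g' := partialDeriv i ψ)
      (v := dir i) (integrable_mul_test iG hψ) (integrable_mul_test iF (hψ.partialDeriv i))
      (integrable_mul_test iF hψ) (fun y hy => h y (h3 hy))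
      (fun y _ => ((h1.differentiable (by simp)) y).hasFDerivAt.hasLineDerivAt _)

/-- Weak derivatives commute. -/
theorem IsWeakDeriv.swap {i j : Fin (d + 1)} {F Gi Gj H : Space d → ℝ}
    (hi : IsWeakDeriv (unitIndex i) F Gi) (hj : IsWeakDeriv (unitIndex j) F Gj)
    (h : IsWeakDeriv (unitIndex i) Gj H) : IsWeakDeriv (unitIndex j) Gi H := by
  have := hj.comp h
  rw [add_comm] at this
  exact hi.step this

theorem isWeakDeriv_multiDeriv {V : Space d → ℝ} (hV : SmoothOn V (halfBall d))
    (μ : MultiIndex d) : IsWeakDeriv μ V (multiDeriv μ V) := by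
  have hU := isOpen_halfBall d
  induction μ using multiIndex_induction with
  | zero =>
    rw [multiDeriv_zero]
    exact isWeakDeriv_zero (hV.continuousOn.locallyIntegrableOn (measurableSet_halfBall d))
  | step μ i ih =>
    refine ih.comp (isWeakDeriv_of_hasLineDerivAt (multiDeriv_smooth hU hV μ).continuousOn
      (multiDeriv_smooth hU hV _).continuousOn fun y hy => ?_)
    rw [multiDeriv_add_unit hU hV μ i hy]
    exact ((multiDeriv_smooth hU hV μ).differentiableAt hU hy).hasFDerivAt.hasLineDerivAt _

end DegenerateSystem

namespace DegenerateSystem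
open Set Filter Topology

variable {d : ℕ}

/-! ### Mollification and Lipschitz representatives -/

section Mollification

open scoped Convolution

/-- The mollification of `u` by a bump function, written as an integral against translates. -/
noncomputable def moll (φ : ContDiffBump (0 : Space d)) (u : Space d → ℝ) : Space d → ℝ :=
  (φ.normed volume) ⋆[ContinuousLinearMap.lsmul ℝ ℝ, volume] u

theorem moll_eq_mul (φ : ContDiffBump (0 : Space d)) (u : Space d → ℝ) :
    moll φ u = u ⋆[ContinuousLinearMap.mul ℝ ℝ, volume] (φ.normed volume) := by
  ext x
  rw [moll, convolution_lsmul_swap, convolution_mul]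
  simp [mul_comm]

theorem hasFDerivAt_moll (φ : ContDiffBump (0 : Space d)) {u : Space d → ℝ}
    (hu : LocallyIntegrable u) (x : Space d) (i : Fin (d + 1)) :
    DifferentiableAt ℝ (moll φ u) x ∧
      fderiv ℝ (moll φ u) x (dir i) = ∫ z, u z * partialDeriv i (φ.normed volume) (x - z) := by
  have h := HasCompactSupport.hasFDerivAt_convolution_right (ContinuousLinearMap.mul ℝ ℝ)
    (φ.hasCompactSupport_normed (μ := volume)) hu (φ.contDiff_normed (n := 1)) x
  rw [← moll_eq_mul] at h
  refine ⟨h.differentiableAt, ?_⟩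
  rw [h.fderiv, convolution_precompR_apply _ hu (φ.hasCompactSupport_normed.fderiv ℝ)
    ((φ.contDiff_normed (n := 1)).continuous_fderiv (by simp))]
  rfl

theorem tsupport_bump_subset (φ : ContDiffBump (0 : Space d)) (x : Space d) :
    tsupport (fun z => φ.normed volume (x - z)) ⊆ Metric.closedBall x φ.rOut := by
  refine closure_minimal (fun z hz => ?_) Metric.isClosed_closedBall
  have : x - z ∈ Function.support (φ.normed volume) := hz
  rw [φ.support_normed_eq] at this
  rw [Metric.mem_closedBall, dist_comm, dist_eq_norm]
  simpa using (mem_ball_zero_iff.1 this).le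

theorem isTest_bump_translate (φ : ContDiffBump (0 : Space d)) {x : Space d}
    (hx : Metric.closedBall x φ.rOut ⊆ halfBall d) :
    IsTest fun z => φ.normed volume (x - z) :=
  ⟨φ.contDiff_normed.comp (contDiff_const.sub contDiff_id),
    HasCompactSupport.of_support_subset_isCompact (isCompact_closedBall x φ.rOut)
      ((subset_tsupport _).trans (tsupport_bump_subset φ x)),
    (tsupport_bump_subset φ x).trans hx⟩

theorem partialDeriv_reflect {g : Space d → ℝ} (hg : Differentiable ℝ g) (x : Space d)
    (i : Fin (d + 1)) (z : Space d) :
    partialDeriv i (fun z => g (x - z)) z = -partialDeriv i g (x - z) := by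
  have h : HasFDerivAt (fun z => g (x - z)) _ z :=
    (hg (x - z)).hasFDerivAt.comp z ((hasFDerivAt_id z).const_sub x)
  rw [partialDeriv_apply, h.fderiv, partialDeriv_apply]
  simp

/-- Restriction of a locally integrable function to a closed ball in the half ball. -/
noncomputable def cut (a : Space d) (δ : ℝ) (u : Space d → ℝ) : Space d → ℝ :=
  (Metric.closedBall a δ).indicator u

theorem locallyIntegrable_cut {a : Space d} {δ : ℝ} {u : Space d → ℝ}
    (h : Metric.closedBall a δ ⊆ halfBall d) (hu : LocallyIntegrableOn u (halfBall d)) :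
    LocallyIntegrable (cut a δ u) := by
  have := hu.integrableOn_compact_subset h (isCompact_closedBall a δ)
  exact (this.integrable_indicator Metric.isClosed_closedBall.measurableSet).locallyIntegrable

theorem cut_mul_bump {a : Space d} {δ : ℝ} {u ψ : Space d → ℝ}
    (h : tsupport ψ ⊆ Metric.closedBall a δ) (z : Space d) : cut a δ u z * ψ z = u z * ψ z := by
  by_cases hz : z ∈ Metric.closedBall a δ
  · rw [cut, indicator_of_mem hz]
  · rw [image_eq_zero_of_notMem_tsupport fun h' => hz (h h'), mul_zero, mul_zero]

theorem tsupport_translate_subset (φ : ContDiffBump (0 : Space d)) {a x : Space d} {δ : ℝ}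
    (hφ : φ.rOut ≤ δ) (hx : x ∈ Metric.ball a δ) :
    Metric.closedBall x φ.rOut ⊆ Metric.closedBall a (3 * δ) := by
  refine Metric.closedBall_subset_closedBall' ?_
  have := (Metric.mem_ball.1 hx).le
  have : 0 ≤ dist x a := dist_nonneg
  linarith

/-- Mollification commutes with weak derivatives. -/
theorem fderiv_moll_of_weak {i : Fin (d + 1)} {F G : Space d → ℝ} {a x : Space d} {δ : ℝ}
    (h : Metric.closedBall a (3 * δ) ⊆ halfBall d) (hFG : IsWeakDeriv (unitIndex i) F G)
    (φ : ContDiffBump (0 : Space d)) (hφ : φ.rOut ≤ δ) (hx : x ∈ Metric.ball a δ) :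
    DifferentiableAt ℝ (moll φ (cut a (3 * δ) F)) x ∧
      fderiv ℝ (moll φ (cut a (3 * δ) F)) x (dir i) = moll φ (cut a (3 * δ) G) x := by
  have hb := tsupport_translate_subset φ hφ hx
  have hT := isTest_bump_translate φ (hb.trans h)
  obtain ⟨h1, h2⟩ := hasFDerivAt_moll φ (locallyIntegrable_cut h hFG.locallyIntegrable) x i
  refine ⟨h1, h2.trans ?_⟩
  have hts := (tsupport_bump_subset φ x).trans hb
  have e := hFG.integral_eq _ hT.smooth hT.compact hT.subset
  rw [multiDeriv_unit_test hT.smooth, order_unitIndex, setIntegral_mul_test _ hT,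
    setIntegral_mul_test _ (hT.partialDeriv i), pow_one, neg_one_mul] at e
  have hd : Differentiable ℝ (φ.normed (volume : Measure (Space d))) :=
    (φ.contDiff_normed (n := 1)).differentiable (by simp)
  have e1 : ∀ z, cut a (3 * δ) F z * partialDeriv i (φ.normed volume) (x - z)
      = -(F z * partialDeriv i (fun z => φ.normed volume (x - z)) z) := fun z => by
    have hts' : tsupport (partialDeriv i fun z => φ.normed volume (x - z))
        ⊆ Metric.closedBall a (3 * δ) :=
      (tsupport_fderiv_apply_subset (𝕜 := ℝ) _).trans hts
    rw [← cut_mul_bump hts', partialDeriv_reflect hd]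
    ring
  simp only [e1]
  rw [integral_neg, e, neg_neg, moll, convolution_lsmul_swap]
  refine integral_congr_ae (Eventually.of_forall fun z => ?_)
  have := cut_mul_bump (u := G) hts z
  simp only [smul_eq_mul]
  rw [mul_comm _ (cut a (3 * δ) G z)]
  exact this.symm

/-- An average cannot leave an interval around c that contains the averaged values. With c = 0 this
bounds mollified gradients; with c = G y it transfers the continuity of G at y to them, uniformly in
the mollifier. -/
theorem dist_moll_le {φ : ContDiffBump (0 : Space d)} {G : Space d → ℝ} {a x : Space d}
    {δ η c : ℝ} (h : Metric.closedBall a (3 * δ) ⊆ halfBall d)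
    (hG : LocallyIntegrableOn G (halfBall d)) (hη : 0 ≤ η)
    (hc : ∀ z ∈ Metric.closedBall a (3 * δ), |G z - c| ≤ η) (hφ : φ.rOut ≤ δ)
    (hx : x ∈ Metric.ball a δ) : |moll φ (cut a (3 * δ) G) x - c| ≤ η := by
  have := dist_convolution_le (μ := volume) (g := cut a (3 * δ) G) (x₀ := x) (z₀ := c) hη
    φ.support_normed_eq.subset φ.nonneg_normed φ.integral_normed
    (locallyIntegrable_cut h hG).aestronglyMeasurable fun z hz => by
      have hz' := tsupport_translate_subset φ hφ hx (Metric.ball_subset_closedBall hz)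
      rw [cut, indicator_of_mem hz', Real.dist_eq]
      exact hc z hz'
  rwa [Real.dist_eq] at this

/-- A sequence of bump functions shrinking to a point. -/
theorem exists_bump_seq (d : ℕ) : ∃ φ : ℕ → ContDiffBump (0 : Space d),
    Tendsto (fun k => (φ k).rOut) atTop (𝓝 0) ∧ ∀ k, (φ k).rOut ≤ 2 * (φ k).rIn := by
  refine ⟨fun k => ⟨1 / ((k : ℝ) + 1), 2 * (1 / ((k : ℝ) + 1)), by positivity, ?_⟩, ?_,
    fun k => le_rfl⟩
  · have : (0 : ℝ) < 1 / ((k : ℝ) + 1) := by positivity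
    linarith
  · simpa using (tendsto_one_div_add_atTop_nhds_zero_nat (𝕜 := ℝ)).const_mul 2

theorem tendsto_moll {φ : ℕ → ContDiffBump (0 : Space d)}
    (hφ : Tendsto (fun k => (φ k).rOut) atTop (𝓝 0)) {F : Space d → ℝ} {a x : Space d} {δ : ℝ}
    (h : Metric.closedBall a (3 * δ) ⊆ halfBall d) (hF : ContinuousOn F (halfBall d))
    (hx : x ∈ Metric.ball a δ) :
    Tendsto (fun k => moll (φ k) (cut a (3 * δ) F) x) atTop (𝓝 (F x)) := by
  have hδ : 0 < δ := dist_nonneg.trans_lt hx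
  have hx' : x ∈ Metric.ball a (3 * δ) := Metric.ball_subset_ball (by linarith) hx
  have hm : AEStronglyMeasurable (cut a (3 * δ) F) volume := (locallyIntegrable_cut h
    (hF.locallyIntegrableOn (measurableSet_halfBall d))).aestronglyMeasurable
  refine ContDiffBump.convolution_tendsto_right (g := fun _ => cut a (3 * δ) F) hφ
    (Eventually.of_forall fun _ => hm) ?_ tendsto_const_nhds
  have h1 : ContinuousAt F x := hF.continuousAt
    ((isOpen_halfBall d).mem_nhds (h (Metric.ball_subset_closedBall hx')))
  have h2 : cut a (3 * δ) F =ᶠ[𝓝 x] F := by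
    filter_upwards [Metric.isOpen_ball.mem_nhds hx'] with z hz
    rw [cut, indicator_of_mem (Metric.ball_subset_closedBall hz)]
  have h3 := (h1.congr h2.symm).tendsto.comp
    (tendsto_snd : Tendsto Prod.snd ((atTop : Filter ℕ) ×ˢ 𝓝 x) (𝓝 x))
  rw [h2.self_of_nhds] at h3
  exact h3

theorem opNorm_le_sum (A : Space d →L[ℝ] ℝ) : ‖A‖ ≤ ∑ i, |A (dir i)| := by
  refine A.opNorm_le_bound (Finset.sum_nonneg fun _ _ => abs_nonneg _) fun x => ?_
  have hx : x = ∑ i, x i • dir i := by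
    ext j
    simp [dir, Pi.single_apply]
  conv_lhs => rw [hx]
  rw [map_sum, Finset.sum_mul]
  refine (norm_sum_le _ _).trans (Finset.sum_le_sum fun i _ => ?_)
  rw [map_smul, norm_smul, mul_comm, Real.norm_eq_abs (A (dir i))]
  exact mul_le_mul_of_nonneg_left (PiLp.norm_apply_le x i) (abs_nonneg _)

/-- Functions with bounded weak gradient agree locally with a continuous function. -/
theorem exists_continuous_of_bounded_weak {F : Space d → ℝ} {G : Fin (d + 1) → Space d → ℝ}
    {a : Space d} {δ L : ℝ} (h : Metric.closedBall a (3 * δ) ⊆ halfBall d)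
    (hFG : ∀ i, IsWeakDeriv (unitIndex i) F (G i)) (hδ : 0 < δ) (hL : 0 ≤ L)
    (hG : ∀ i, ∀ z ∈ Metric.closedBall a (3 * δ), |G i z| ≤ L) :
    ∃ f : Space d → ℝ, Continuous f ∧ F =ᵐ[volume.restrict (Metric.ball a δ)] f := by
  obtain ⟨φ, hφ0, hφ⟩ := exists_bump_seq d
  have hF := locallyIntegrable_cut h (hFG 0).locallyIntegrable
  have hae := ContDiffBump.ae_convolution_tendsto_right_of_locallyIntegrable hφ0
    (Eventually.of_forall hφ) hF
  set S := {x ∈ Metric.ball a δ | Tendsto (fun k => moll (φ k) (cut a (3 * δ) F) x) atTop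
    (𝓝 (F x))} with hS
  -- The mollified functions are Lipschitz with a common constant, since their gradients are
  -- mollifications of the bounded G i. The constant survives in the limit on the set S of full
  -- measure, and F restricted to S extends continuously.
  have hlip : LipschitzOnWith (Real.toNNReal ((d + 1) * L)) F S := by
    refine LipschitzOnWith.of_dist_le_mul fun x hx y hy => ?_
    have hlim : Tendsto (fun k => dist (moll (φ k) (cut a (3 * δ) F) x)
      (moll (φ k) (cut a (3 * δ) F) y)) atTop (𝓝 (dist (F x) (F y))) := hx.2.dist hy.2
    refine le_of_tendsto hlim ?_
    filter_upwards [hφ0.eventually_le_const hδ] with k hk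
    rw [Real.coe_toNNReal _ (by positivity), Real.dist_eq, dist_eq_norm, ← Real.norm_eq_abs]
    refine Convex.norm_image_sub_le_of_norm_fderiv_le (𝕜 := ℝ) (s := Metric.ball a δ)
      (fun z hz => (fderiv_moll_of_weak h (hFG 0) (φ k) hk hz).1) (fun z hz => ?_)
      (convex_ball a δ) hy.1 hx.1
    refine (opNorm_le_sum _).trans ?_
    have : ∀ i ∈ (Finset.univ : Finset (Fin (d + 1))),
        |fderiv ℝ (moll (φ k) (cut a (3 * δ) F)) z (dir i)| ≤ L := fun i _ => by
      rw [(fderiv_moll_of_weak h (hFG i) (φ k) hk hz).2]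
      have := dist_moll_le (c := 0) h (hFG i).locallyIntegrable_deriv hL
        (fun w hw => by simpa using hG i w hw) hk hz
      simpa using this
    refine (Finset.sum_le_sum this).trans ?_
    simp
  obtain ⟨f, hf, hfS⟩ := hlip.extend_real
  refine ⟨f, hf.continuous, ?_⟩
  rw [Filter.EventuallyEq, ae_restrict_iff' Metric.isOpen_ball.measurableSet]
  filter_upwards [hae] with x hx hxa
  refine hfS ⟨hxa, ?_⟩
  have : cut a (3 * δ) F x = F x := by
    rw [cut, indicator_of_mem (Metric.ball_subset_closedBall
      (Metric.ball_subset_ball (by linarith) hxa))]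
  rwa [this] at hx

end Mollification

/-! ### Continuous representatives and classical differentiability -/

section Representatives

theorem eqOn_of_ae_eq {f g : Space d → ℝ} {U : Set (Space d)} (hU : IsOpen U)
    (hf : ContinuousOn f U) (hg : ContinuousOn g U) (h : f =ᵐ[volume.restrict U] g) :
    EqOn f g U :=
  Measure.eqOn_open_of_ae_eq h hU hf hg

theorem exists_ball_three {a : Space d} (ha : a ∈ halfBall d) :
    ∃ δ > 0, Metric.closedBall a (3 * δ) ⊆ halfBall d := by
  obtain ⟨ε, hε, h⟩ := Metric.nhds_basis_closedBall.mem_iff.1 ((isOpen_halfBall d).mem_nhds ha)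
  exact ⟨ε / 3, by positivity, by convert h using 2; ring⟩

theorem ae_of_local {P : Space d → Prop}
    (h : ∀ a ∈ halfBall d, ∃ δ > 0, ∀ᵐ y ∂(volume.restrict (Metric.ball a δ)), P y) :
    ∀ᵐ y ∂(volume.restrict (halfBall d)), P y := by
  rw [ae_restrict_iff' (measurableSet_halfBall d), ae_iff]
  refine measure_null_of_locally_null _ fun a ha => ?_
  have ha' : a ∈ halfBall d := by
    by_contra hc
    exact ha fun h => absurd h hc
  obtain ⟨δ, hδ, hP⟩ := h a ha'
  rw [ae_restrict_iff' Metric.isOpen_ball.measurableSet, ae_iff] at hP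
  refine ⟨_, inter_mem self_mem_nhdsWithin
    (mem_nhdsWithin_of_mem_nhds (Metric.ball_mem_nhds a hδ)), measure_mono_null ?_ hP⟩
  rintro y ⟨hy1, hy2⟩ hy3
  exact hy1 fun _ => hy3 hy2

/-- Two local representatives agree almost everywhere on the intersection of their balls, hence
everywhere there by continuity. So the diagonal function x ↦ f x x coincides with f a on the ball
around a. -/
theorem exists_continuous_glue {F : Space d → ℝ}
    (h : ∀ a ∈ halfBall d, ∃ δ > 0, ∃ f : Space d → ℝ, Metric.ball a δ ⊆ halfBall d ∧
      Continuous f ∧ F =ᵐ[volume.restrict (Metric.ball a δ)] f) :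
    ∃ f : Space d → ℝ, ContinuousOn f (halfBall d) ∧ F =ᵐ[volume.restrict (halfBall d)] f := by
  classical
  choose! δ hδ f hsub hf hFf using h
  have key : ∀ a ∈ halfBall d, EqOn (fun x => f x x) (f a) (Metric.ball a (δ a)) := by
    intro a ha x hx
    have hx' := hsub a ha hx
    have hop : IsOpen (Metric.ball a (δ a) ∩ Metric.ball x (δ x)) :=
      Metric.isOpen_ball.inter Metric.isOpen_ball
    refine eqOn_of_ae_eq hop (hf x hx').continuousOn (hf a ha).continuousOn ?_
      ⟨hx, Metric.mem_ball_self (hδ x hx')⟩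
    have h1 : F =ᵐ[volume.restrict (Metric.ball a (δ a) ∩ Metric.ball x (δ x))] f a :=
      ae_mono (Measure.restrict_mono inter_subset_left le_rfl) (hFf a ha)
    have h2 : F =ᵐ[volume.restrict (Metric.ball a (δ a) ∩ Metric.ball x (δ x))] f x :=
      ae_mono (Measure.restrict_mono inter_subset_right le_rfl) (hFf x hx')
    exact h2.symm.trans h1
  refine ⟨fun x => f x x, fun a ha => ?_, ae_of_local fun a ha => ⟨δ a, hδ a ha, ?_⟩⟩
  · have h1 : (fun x => f x x) =ᶠ[𝓝 a] f a :=
      (key a ha).eventuallyEq_of_mem (Metric.ball_mem_nhds a (hδ a ha))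
    exact ((hf a ha).continuousAt.congr h1.symm).continuousWithinAt
  · have h1 : ∀ᵐ y ∂(volume.restrict (Metric.ball a (δ a))), y ∈ Metric.ball a (δ a) :=
      ae_restrict_mem Metric.isOpen_ball.measurableSet
    filter_upwards [hFf a ha, h1] with y hy hy'
    rw [hy, ← key a ha hy']

/-- A function whose weak gradient is bounded by a multiple of the inverse distance to the flat
boundary has a continuous representative. -/
theorem exists_continuous_rep {F : Space d → ℝ} {G : Fin (d + 1) → Space d → ℝ} {M : ℝ}
    (hFG : ∀ i, IsWeakDeriv (unitIndex i) F (G i))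
    (hG : ∀ i, ∀ᵐ y ∂(volume.restrict (halfBall d)), |normalCoord y * G i y| ≤ M) :
    ∃ f : Space d → ℝ, ContinuousOn f (halfBall d) ∧ F =ᵐ[volume.restrict (halfBall d)] f := by
  classical
  -- Changing G on a null set makes the weighted bound hold everywhere. On a compact ball y_n has a
  -- positive minimum, which turns it into an unweighted bound.
  let G' : Fin (d + 1) → Space d → ℝ :=
    fun i y => if |normalCoord y * G i y| ≤ M then G i y else 0
  have hG' : ∀ i, G i =ᵐ[volume.restrict (halfBall d)] G' i := fun i =>
    (hG i).mono fun y hy => (if_pos hy).symm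
  have hFG' : ∀ i, IsWeakDeriv (unitIndex i) F (G' i) := fun i =>
    isWeakDeriv_congr EventuallyEq.rfl (hG' i) (hFG i)
  refine exists_continuous_glue fun a ha => ?_
  obtain ⟨δ, hδ, hb⟩ := exists_ball_three ha
  have hc : ContinuousOn (normalCoord : Space d → ℝ) (Metric.closedBall a (3 * δ)) :=
    (smoothOn_normalCoord _).continuousOn
  obtain ⟨z₀, hz₀, hmin⟩ := (isCompact_closedBall a (3 * δ)).exists_isMinOn
    (Metric.nonempty_closedBall.2 (by positivity)) hc
  have ht := normalCoord_pos (hb hz₀)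
  have hL : ∀ i, ∀ z ∈ Metric.closedBall a (3 * δ), |G' i z| ≤ |M| / normalCoord z₀ := by
    intro i z hz
    by_cases hz' : |normalCoord z * G i z| ≤ M
    · simp only [G', hz', if_true]
      rw [le_div_iff₀ ht]
      rw [abs_mul, abs_of_pos (normalCoord_pos (hb hz))] at hz'
      have : normalCoord z₀ ≤ normalCoord z := hmin hz
      calc |G i z| * normalCoord z₀ ≤ |G i z| * normalCoord z := by gcongr
        _ ≤ M := by linarith
        _ ≤ |M| := le_abs_self M
    · simp only [G', hz', if_false, abs_zero]
      positivity
  obtain ⟨f, hf, hfF⟩ := exists_continuous_of_bounded_weak hb hFG' hδ (by positivity) hL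
  exact ⟨δ, hδ, f, (Metric.ball_subset_closedBall.trans
    (Metric.closedBall_subset_closedBall (by linarith))).trans hb, hf, hfF⟩

/-- Between continuous functions, a weak derivative in a coordinate direction is classical. -/
theorem IsWeakDeriv.hasLineDerivAt {i : Fin (d + 1)} {F G : Space d → ℝ}
    (h : IsWeakDeriv (unitIndex i) F G) (hF : ContinuousOn F (halfBall d))
    (hG : ContinuousOn G (halfBall d)) {y : Space d} (hy : y ∈ halfBall d) :
    HasLineDerivAt ℝ F (G y) y (dir i) := by
  obtain ⟨φ, hφ0, -⟩ := exists_bump_seq d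
  rw [HasLineDerivAt, hasDerivAt_iff_isLittleO, Asymptotics.isLittleO_iff]
  intro η hη
  obtain ⟨ε, hε, hGε⟩ := Metric.continuousAt_iff.1
    (hG.continuousAt ((isOpen_halfBall d).mem_nhds hy)) η hη
  obtain ⟨δ₀, hδ₀, hb₀⟩ := exists_ball_three hy
  set δ := min δ₀ (ε / 4)
  have hδ : 0 < δ := by positivity
  have hb : Metric.closedBall y (3 * δ) ⊆ halfBall d :=
    (Metric.closedBall_subset_closedBall (by linarith [min_le_left δ₀ (ε / 4)])).trans hb₀
  have hc : ∀ z ∈ Metric.closedBall y (3 * δ), |G z - G y| ≤ η := fun z hz => by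
    have hz' : dist z y < ε :=
      lt_of_le_of_lt (Metric.mem_closedBall.1 hz) (by linarith [min_le_right δ₀ (ε / 4)])
    exact (hGε hz').le
  have hn : ‖(dir i : Space d)‖ = 1 := by simp [dir]
  have hmem : ∀ s ∈ Metric.ball (0 : ℝ) δ, y + s • dir i ∈ Metric.ball y δ := fun s hs => by
    rw [mem_ball_zero_iff] at hs
    rw [Metric.mem_ball, dist_eq_norm]
    simpa [norm_smul, hn] using hs
  filter_upwards [Metric.ball_mem_nhds (0 : ℝ) hδ] with s hs
  -- With the linear function s ↦ s G(y) subtracted, the mollified functions have derivative at most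
  -- η along the segment. The mean value inequality gives an error η |s| uniformly in k, and the
  -- limit inherits it.
  have hlim : Tendsto (fun k => moll (φ k) (cut y (3 * δ) F) (y + s • dir i)
      - moll (φ k) (cut y (3 * δ) F) y - s * G y) atTop
      (𝓝 (F (y + s • dir i) - F y - s * G y)) :=
    ((tendsto_moll hφ0 hb hF (hmem s hs)).sub
      (tendsto_moll hφ0 hb hF (Metric.mem_ball_self hδ))).sub_const _
  simp only [zero_smul, add_zero, sub_zero, smul_eq_mul]
  refine le_of_tendsto hlim.norm ?_
  filter_upwards [hφ0.eventually_le_const hδ] with k hk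
  have := Convex.norm_image_sub_le_of_norm_hasDerivWithin_le (C := η)
    (f := fun s : ℝ => moll (φ k) (cut y (3 * δ) F) (y + s • dir i) - s * G y)
    (f' := fun s => fderiv ℝ (moll (φ k) (cut y (3 * δ) F)) (y + s • dir i) (dir i) - G y)
    (s := Metric.ball (0 : ℝ) δ) (x := 0) (y := s) (fun r hr => ?_) (fun r hr => ?_)
    (convex_ball _ _) (Metric.mem_ball_self hδ) hs
  · simpa [sub_right_comm] using this
  · have h1 := (fderiv_moll_of_weak hb h (φ k) hk (hmem r hr)).1.hasFDerivAt
    have h2 : HasDerivAt (fun s : ℝ => y + s • dir i) (dir i) r := by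
      simpa using ((hasDerivAt_id r).smul_const (dir i)).const_add y
    have h3 : HasDerivAt (fun s : ℝ => s * G y) (G y) r := by
      simpa using (hasDerivAt_id r).mul_const (G y)
    exact ((h1.comp_hasDerivAt r h2).sub h3).hasDerivWithinAt
  · rw [(fderiv_moll_of_weak hb h (φ k) hk (hmem r hr)).2]
    exact dist_moll_le hb h.locallyIntegrable_deriv hη.le hc hk (hmem r hr)

/-- A continuous function with continuous weak gradient is classically differentiable. -/
theorem hasFDerivAt_of_weak {F : Space d → ℝ} {G : Fin (d + 1) → Space d → ℝ}
    (h : ∀ i, IsWeakDeriv (unitIndex i) F (G i)) (hF : ContinuousOn F (halfBall d))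
    (hG : ∀ i, ContinuousOn (G i) (halfBall d)) {y : Space d} (hy : y ∈ halfBall d) :
    HasFDerivAt F (∑ i, G i y • (EuclideanSpace.proj (𝕜 := ℝ) i : Space d →L[ℝ] ℝ)) y := by
  obtain ⟨φ, hφ0, -⟩ := exists_bump_seq d
  set A : Space d →L[ℝ] ℝ := ∑ i, G i y • (EuclideanSpace.proj (𝕜 := ℝ) i : Space d →L[ℝ] ℝ)
    with hA
  have hAi : ∀ i, A (dir i) = G i y := fun i => by
    simp [hA, dir, PiLp.single_apply]
  rw [hasFDerivAt_iff_isLittleO, Asymptotics.isLittleO_iff]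
  intro η' hη'
  -- The operator norm is estimated by the sum over the d + 1 coordinate directions, each of which
  -- contributes η.
  set η := η' / (d + 1) with hηdef
  have hη : 0 < η := by positivity
  have hε : ∀ᶠ z in 𝓝 y, ∀ i, |G i z - G i y| < η := by
    refine eventually_all.2 fun i => ?_
    exact Metric.tendsto_nhds.1 ((hG i).continuousAt ((isOpen_halfBall d).mem_nhds hy)) η hη
  obtain ⟨ε, hε, hGε⟩ := Metric.eventually_nhds_iff.1 hε
  obtain ⟨δ₀, hδ₀, hb₀⟩ := exists_ball_three hy
  set δ := min δ₀ (ε / 4)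
  have hδ : 0 < δ := by positivity
  have hb : Metric.closedBall y (3 * δ) ⊆ halfBall d :=
    (Metric.closedBall_subset_closedBall (by linarith [min_le_left δ₀ (ε / 4)])).trans hb₀
  have hc : ∀ i, ∀ z ∈ Metric.closedBall y (3 * δ), |G i z - G i y| ≤ η := fun i z hz => by
    have hz' : dist z y < ε :=
      lt_of_le_of_lt (Metric.mem_closedBall.1 hz) (by linarith [min_le_right δ₀ (ε / 4)])
    exact (hGε hz' i).le
  filter_upwards [Metric.ball_mem_nhds y hδ] with x hx
  have hlim : Tendsto (fun k => moll (φ k) (cut y (3 * δ) F) x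
      - moll (φ k) (cut y (3 * δ) F) y - A (x - y)) atTop (𝓝 (F x - F y - A (x - y))) :=
    ((tendsto_moll hφ0 hb hF hx).sub
      (tendsto_moll hφ0 hb hF (Metric.mem_ball_self hδ))).sub_const _
  refine le_of_tendsto hlim.norm ?_
  filter_upwards [hφ0.eventually_le_const hδ] with k hk
  refine Convex.norm_image_sub_le_of_norm_fderiv_le' (𝕜 := ℝ) (s := Metric.ball y δ)
    (fun z hz => (fderiv_moll_of_weak hb (h 0) (φ k) hk hz).1) (fun z hz => ?_)
    (convex_ball y δ) (Metric.mem_ball_self hδ) hx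
  refine (opNorm_le_sum _).trans ?_
  have : ∀ i ∈ (Finset.univ : Finset (Fin (d + 1))),
      |(fderiv ℝ (moll (φ k) (cut y (3 * δ) F)) z - A) (dir i)| ≤ η := fun i _ => by
    rw [_root_.sub_apply, (fderiv_moll_of_weak hb (h i) (φ k) hk hz).2, hAi]
    exact dist_moll_le hb (h i).locallyIntegrable_deriv hη.le (hc i) hk hz
  refine (Finset.sum_le_sum this).trans (le_of_eq ?_)
  simp [hηdef]
  field_simp

end Representatives

end DegenerateSystem

namespace DegenerateSystem
open Set Filter Topology

variable {d m : ℕ}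

/-! ### Regularity classes with all tangential derivatives -/

section Tangential

/-- `F` is of class `C^k` together with its tangential derivatives up to order `m`. -/
def TangentialReg (k : ℕ) : ℕ → (Space d → ℝ) → Prop
  | 0, F => ContDiffOn ℝ k F (halfBall d)
  | m + 1, F => ContDiffOn ℝ k F (halfBall d) ∧ ∀ l : Fin (d + 1), l ≠ Fin.last d →
      (∀ y ∈ halfBall d, LineDifferentiableAt ℝ F y (dir l)) ∧
        TangentialReg k m fun y => lineDeriv ℝ F y (dir l)

variable {k n : ℕ} {F G : Space d → ℝ}

theorem TangentialReg.contDiffOn (h : TangentialReg k n F) : ContDiffOn ℝ k F (halfBall d) := by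
  cases n with
  | zero => exact h
  | succ n => exact h.1

theorem eventuallyEq_of_eqOn (h : EqOn F G (halfBall d)) {y : Space d} (hy : y ∈ halfBall d) :
    F =ᶠ[𝓝 y] G := h.eventuallyEq_of_mem ((isOpen_halfBall d).mem_nhds hy)

theorem TangentialReg.congr (hF : TangentialReg k n F) (h : EqOn F G (halfBall d)) :
    TangentialReg k n G := by
  induction n generalizing F G with
  | zero => exact ContDiffOn.congr hF fun y hy => (h hy).symm
  | succ n ih =>
    refine ⟨hF.1.congr fun y hy => (h hy).symm, fun l hl => ⟨fun y hy => ?_, ?_⟩⟩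
    · exact (eventuallyEq_of_eqOn h hy).lineDifferentiableAt_iff.1 ((hF.2 l hl).1 y hy)
    · exact ih (hF.2 l hl).2 fun y hy => (eventuallyEq_of_eqOn h hy).lineDeriv_eq

theorem TangentialReg.mk (hF : ContDiffOn ℝ k F (halfBall d))
    (h : ∀ l : Fin (d + 1), l ≠ Fin.last d → ∃ G : Space d → ℝ,
      (∀ y ∈ halfBall d, HasLineDerivAt ℝ F (G y) y (dir l)) ∧ TangentialReg k n G) :
    TangentialReg k (n + 1) F := by
  refine ⟨hF, fun l hl => ?_⟩
  obtain ⟨G, hG, hG'⟩ := h l hl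
  exact ⟨fun y hy => (hG y hy).lineDifferentiableAt,
    hG'.congr fun y hy => (hG y hy).lineDeriv.symm⟩

theorem TangentialReg.of_succ (h : TangentialReg k (n + 1) F) : TangentialReg k n F := by
  induction n generalizing F with
  | zero => exact h.1
  | succ n ih => exact ⟨h.1, fun l hl => ⟨(h.2 l hl).1, ih (h.2 l hl).2⟩⟩

theorem TangentialReg.const (c : ℝ) : TangentialReg k n fun _ : Space d => c := by
  induction n generalizing c with
  | zero => exact contDiffOn_const
  | succ n ih =>
    exact TangentialReg.mk contDiffOn_const fun l _ =>
      ⟨fun _ => 0, fun y _ => hasDerivAt_const (0 : ℝ) c, ih 0⟩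

theorem TangentialReg.add (hF : TangentialReg k n F) (hG : TangentialReg k n G) :
    TangentialReg k n fun y => F y + G y := by
  induction n generalizing F G with
  | zero => exact ContDiffOn.add hF hG
  | succ n ih =>
    exact TangentialReg.mk (hF.1.add hG.1) fun l hl =>
      ⟨_, fun y hy => (((hF.2 l hl).1 y hy).hasLineDerivAt).add ((hG.2 l hl).1 y hy).hasLineDerivAt,
        ih (hF.2 l hl).2 (hG.2 l hl).2⟩

theorem TangentialReg.mul (hF : TangentialReg k n F) (hG : TangentialReg k n G) :
    TangentialReg k n fun y => F y * G y := by
  induction n generalizing F G with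
  | zero => exact ContDiffOn.mul hF hG
  | succ n ih =>
    refine TangentialReg.mk (hF.1.mul hG.1) fun l hl => ⟨_, fun y hy => ?_,
        (ih (hF.2 l hl).2 hG.of_succ).add (ih hF.of_succ (hG.2 l hl).2)⟩
    have h := HasDerivAt.fun_mul ((hF.2 l hl).1 y hy).hasLineDerivAt
      ((hG.2 l hl).1 y hy).hasLineDerivAt
    simpa [HasLineDerivAt] using h

theorem TangentialReg.sum {ι : Type*} (s : Finset ι) {F : ι → Space d → ℝ}
    (hF : ∀ a ∈ s, TangentialReg k n (F a)) : TangentialReg k n fun y => ∑ a ∈ s, F a y := by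
  classical
  induction s using Finset.induction_on with
  | empty => simpa using TangentialReg.const 0
  | insert a s ha ih =>
    simp only [Finset.sum_insert ha]
    exact (hF a (Finset.mem_insert_self a s)).add
      (ih fun b hb => hF b (Finset.mem_insert_of_mem hb))

/-- The chain rule replaces B by its directional derivatives, which are again smooth on U. The
induction on the number of tangential derivatives therefore runs over all smooth B at once. -/
theorem TangentialReg.comp {E ι : Type*} [NormedAddCommGroup E] [NormedSpace ℝ E] [Fintype ι]
    {B : E → ℝ} {U : Set E} (hU : IsOpen U) (hB : ContDiffOn ℝ (⊤ : ℕ∞) B U) (e : ι → E)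
    {F : ι → Space d → ℝ} (hF : ∀ a, TangentialReg k n (F a))
    (hw : ∀ y ∈ halfBall d, ∑ a, F a y • e a ∈ U) :
    TangentialReg k n fun y => B (∑ a, F a y • e a) := by
  have h0 : ContDiffOn ℝ k (fun y => B (∑ a, F a y • e a)) (halfBall d) :=
    (hB.of_le (by exact_mod_cast le_top)).comp
      (ContDiffOn.sum fun a _ => (hF a).contDiffOn.smul contDiffOn_const) hw
  induction n generalizing B with
  | zero => exact h0
  | succ n ih =>
    refine TangentialReg.mk h0 fun l hl => ⟨fun y => ∑ a, lineDeriv ℝ (F a) y (dir l) *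
      fderiv ℝ B (∑ a, F a y • e a) (e a), fun y hy => ?_, ?_⟩
    · have h1 : HasDerivAt (fun t : ℝ => ∑ a, F a (y + t • dir l) • e a)
          (∑ a, lineDeriv ℝ (F a) y (dir l) • e a) 0 :=
        HasDerivAt.fun_sum fun a _ =>
          HasDerivAt.smul_const ((((hF a).2 l hl).1 y hy).hasLineDerivAt) (e a)
      have h2 : HasFDerivAt B (fderiv ℝ B (∑ a, F a y • e a))
          (∑ a, F a (y + (0 : ℝ) • dir l) • e a) := by
        simp only [zero_smul, add_zero]
        exact ((hB.contDiffAt (hU.mem_nhds (hw y hy))).differentiableAt (by simp)).hasFDerivAt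
      have h3 := h2.comp_hasDerivAt (0 : ℝ) h1
      simpa [HasLineDerivAt, Function.comp_def] using h3
    · refine TangentialReg.sum _ fun a _ => ((hF a).2 l hl).2.mul ?_
      have hBa : ContDiffOn ℝ (⊤ : ℕ∞) (fun x => fderiv ℝ B x (e a)) U :=
        (hB.fderiv_of_isOpen hU (m := (⊤ : ℕ∞)) (by simp)).clm_apply contDiffOn_const
      exact ih hBa (fun a => (hF a).of_succ) ((hBa.of_le (by exact_mod_cast le_top)).comp
        (ContDiffOn.sum fun a _ => (hF a).contDiffOn.smul contDiffOn_const) hw)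

/-- The factor 1 / y_n is smooth inside and constant in tangential directions, so dividing the
equation by y_n costs no tangential regularity. -/
theorem TangentialReg.inv_normalCoord :
    TangentialReg k n fun y : Space d => (normalCoord y)⁻¹ := by
  have h0 : ContDiffOn ℝ k (fun y : Space d => (normalCoord y)⁻¹) (halfBall d) :=
    ((smoothOn_normalCoord _).of_le (by exact_mod_cast le_top)).inv
      fun y hy => (normalCoord_pos hy).ne'
  cases n with
  | zero => exact h0
  | succ n =>
    refine TangentialReg.mk h0 fun l hl => ⟨fun _ => 0, fun y _ => ?_, TangentialReg.const 0⟩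
    have : ∀ t : ℝ, normalCoord (y + t • dir l) = normalCoord y := fun t => by
      simp [normalCoord, dir, Ne.symm hl]
    simp only [HasLineDerivAt, this]
    exact hasDerivAt_const _ _

/-- If the weak gradient of a continuous function has class `C^k` with all tangential derivatives,
then the function has class `C^(k+1)` with all tangential derivatives. -/
theorem TangentialReg.succ_of_weak {F : Space d → ℝ} {G : Fin (d + 1) → Space d → ℝ}
    (hF : ContinuousOn F (halfBall d)) (hFG : ∀ i, IsWeakDeriv (unitIndex i) F (G i))
    (hG : ∀ i n, TangentialReg k n (G i)) (n : ℕ) : TangentialReg (k + 1) n F := by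
  have h0 : ∀ {F : Space d → ℝ} {G : Fin (d + 1) → Space d → ℝ}, ContinuousOn F (halfBall d) →
      (∀ i, IsWeakDeriv (unitIndex i) F (G i)) → (∀ i n, TangentialReg k n (G i)) →
      ContDiffOn ℝ (k + 1 : ℕ) F (halfBall d) := fun {F G} hF hFG hG => by
    have hd : ∀ y ∈ halfBall d, HasFDerivAt F _ y := fun y hy =>
      hasFDerivAt_of_weak hFG hF (fun i => (hG i 0).contDiffOn.continuousOn) hy
    have hc : ContDiffOn ℝ k (fun y => ∑ i, G i y •
        (EuclideanSpace.proj (𝕜 := ℝ) i : Space d →L[ℝ] ℝ)) (halfBall d) :=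
      ContDiffOn.sum fun i _ => (hG i 0).contDiffOn.smul contDiffOn_const
    push_cast
    refine (contDiffOn_succ_iff_fderiv_of_isOpen (isOpen_halfBall d)).2
      ⟨fun y hy => (hd y hy).differentiableAt.differentiableWithinAt, by simp, ?_⟩
    exact hc.congr fun y hy => (hd y hy).fderiv
  induction n generalizing F G with
  | zero => exact h0 hF hFG hG
  | succ n ih =>
    refine TangentialReg.mk (h0 hF hFG hG) fun l hl => ⟨G l, fun y hy =>
      (hFG l).hasLineDerivAt hF (hG l 0).contDiffOn.continuousOn hy, ?_⟩
    -- Weak derivatives commute, so the weak gradient of ∂_l F consists of the tangential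
    -- derivatives ∂_l G_i, which still have tangential regularity of every order.
    refine ih (G := fun i y => lineDeriv ℝ (G i) y (dir l)) (hG l 0).contDiffOn.continuousOn
      (fun i => ?_) fun i n => ((hG i (n + 1)).2 l hl).2
    refine (hFG l).swap (hFG i) (isWeakDeriv_of_hasLineDerivAt (hG i 0).contDiffOn.continuousOn
      (((hG i 1).2 l hl).2.contDiffOn.continuousOn) fun y hy => ?_)
    exact (((hG i 1).2 l hl).1 y hy).hasLineDerivAt

end Tangential

/-! ### Coordinates on the space of values of (v, ∇v) -/

section State

/-- The space of values of `(v, ∇v)`. -/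
abbrev State (d m : ℕ) : Type := (Fin m → ℝ) × Grad d m

/-- Labels of the components of `(v, ∇v)`. -/
abbrev StateIndex (d m : ℕ) : Type := Fin m ⊕ Fin m × Fin (d + 1)

/-- The coordinate basis of the space of values of `(v, ∇v)`. -/
def stateBasis : StateIndex d m → State d m
  | Sum.inl j => (Pi.single j 1, 0)
  | Sum.inr (j, i) => (0, Pi.single j (Pi.single i 1))

theorem norm_stateBasis_le (a : StateIndex d m) : ‖(stateBasis a : State d m)‖ ≤ 1 := by
  rcases a with j | ⟨j, i⟩ <;> simp [stateBasis, Prod.norm_def, Pi.norm_single]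

/-- The point with given coordinates. -/
noncomputable def ofComps (x : StateIndex d m → ℝ) : State d m := ∑ a, x a • stateBasis a

theorem ofComps_eq (x : StateIndex d m → ℝ) :
    ofComps x = (fun j => x (Sum.inl j), fun j i => x (Sum.inr (j, i))) := by
  classical
  have h1 : (∑ a, x a • stateBasis a : State d m)
      = ∑ j, x (Sum.inl j) • stateBasis (Sum.inl j)
        + ∑ p, x (Sum.inr p) • stateBasis (Sum.inr p) := Fintype.sum_sum_type _
  rw [ofComps, h1]
  refine Prod.ext ?_ ?_
  · ext j
    simp [stateBasis, Prod.fst_sum, Pi.single_apply]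
  · ext j i
    simp [stateBasis, Prod.snd_sum, Fintype.sum_prod_type, Pi.single_apply]

theorem norm_ofComps_lt {x : StateIndex d m → ℝ} {ρ : ℝ} (hρ : 0 < ρ) (h : ∀ a, |x a| < ρ) :
    ‖ofComps x‖ < ρ := by
  rw [ofComps_eq, Prod.norm_def, max_lt_iff]
  refine ⟨(pi_norm_lt_iff hρ).2 fun j => h _, (pi_norm_lt_iff hρ).2 fun j =>
    (pi_norm_lt_iff hρ).2 fun i => h _⟩

end State

end DegenerateSystem

namespace DegenerateSystem
open Set Filter Topology

variable {d m : ℕ}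

/-! ### Reading weak derivatives and bounds off the norms -/

section Norms

variable {p : ℝ≥0∞} {μ : MultiIndex d} {u w : Space d → ℝ}

theorem derivNorm_eq (h : IsWeakDeriv μ u w) :
    derivNorm p μ u = eLpNorm w p (volume.restrict (halfBall d)) :=
  le_antisymm (iInf₂_le w h) (le_iInf₂ fun _ h' => (eLpNorm_congr_ae (isWeakDeriv_unique h h')).le)

theorem weightedDerivNorm_eq (h : IsWeakDeriv μ u w) :
    weightedDerivNorm p μ u
      = eLpNorm (fun y => normalCoord y * w y) p (volume.restrict (halfBall d)) :=
  le_antisymm (iInf₂_le w h) (le_iInf₂ fun _ h' => (eLpNorm_congr_ae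
    ((isWeakDeriv_unique h h').mono fun y hy => by simp only [hy])).le)

theorem exists_isWeakDeriv_of_derivNorm (h : derivNorm p μ u < ∞) : ∃ w, IsWeakDeriv μ u w := by
  obtain ⟨w, hw⟩ := iInf_lt_iff.1 h
  obtain ⟨hw, -⟩ := iInf_lt_iff.1 hw
  exact ⟨w, hw⟩

theorem exists_isWeakDeriv_of_weightedDerivNorm (h : weightedDerivNorm p μ u < ∞) :
    ∃ w, IsWeakDeriv μ u w := by
  obtain ⟨w, hw⟩ := iInf_lt_iff.1 h
  obtain ⟨hw, -⟩ := iInf_lt_iff.1 hw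
  exact ⟨w, hw⟩

theorem exists_ae_bound {f : Space d → ℝ}
    (h : eLpNorm f ∞ (volume.restrict (halfBall d)) < ∞) :
    ∃ M, ∀ᵐ y ∂(volume.restrict (halfBall d)), |f y| ≤ M := by
  refine ⟨(eLpNorm f ∞ (volume.restrict (halfBall d))).toReal, ?_⟩
  rw [eLpNorm_exponent_top] at h ⊢
  filter_upwards [ae_le_eLpNormEssSup (f := f) (μ := volume.restrict (halfBall d))] with y hy
  have := ENNReal.toReal_mono h.ne hy
  simpa using this

theorem tangential_term_le {R : ℝ} {K : ℝ≥0∞} {v : Space d → Fin m → ℝ}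
    (h : tangentialNorm R v ≤ K) (j : Fin m) (i : Fin (d + 1)) {μ : MultiIndex d}
    (hμ : μ (Fin.last d) = 0) :
    ENNReal.ofReal (R ^ order μ / ((order μ).factorial : ℝ)) *
        (weightedDerivNorm ∞ (μ + unitIndex i + unitIndex (Fin.last d)) (fun y => v y j)
          + derivNorm ∞ (μ + unitIndex i) (fun y => v y j)) ≤ K := by
  refine le_trans ?_ h
  unfold tangentialNorm
  refine le_trans ?_ (Finset.single_le_sum (fun _ _ => zero_le) (Finset.mem_univ j))
  refine le_trans ?_ (Finset.single_le_sum (fun _ _ => zero_le) (Finset.mem_univ i))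
  exact ENNReal.le_tsum (⟨μ, hμ⟩ : {μ : MultiIndex d // μ (Fin.last d) = 0})

theorem tangential_term_lt_top {R : ℝ} (hR : 0 < R) {K : ℝ≥0∞} (hK : K < ∞)
    {v : Space d → Fin m → ℝ} (h : tangentialNorm R v ≤ K) (j : Fin m) (i : Fin (d + 1))
    {μ : MultiIndex d} (hμ : μ (Fin.last d) = 0) :
    weightedDerivNorm ∞ (μ + unitIndex i + unitIndex (Fin.last d)) (fun y => v y j) < ∞ ∧
      derivNorm ∞ (μ + unitIndex i) (fun y => v y j) < ∞ := by
  have h1 := (tangential_term_le h j i hμ).trans_lt hK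
  have h2 : ENNReal.ofReal (R ^ order μ / ((order μ).factorial : ℝ)) ≠ 0 := by
    rw [Ne, ENNReal.ofReal_eq_zero, not_le]
    positivity
  have h3 := ENNReal.lt_top_of_mul_ne_top_right h1.ne h2
  exact ⟨lt_of_le_of_lt le_self_add h3, lt_of_le_of_lt le_add_self h3⟩

end Norms

/-! ### Interior smoothness -/

section Interior

theorem exists_continuous_rep' {F : Space d → ℝ} {G : Fin (d + 1) → Space d → ℝ}
    (hFG : ∀ i, IsWeakDeriv (unitIndex i) F (G i))
    (hG : ∀ i, ∃ M, ∀ᵐ y ∂(volume.restrict (halfBall d)), |normalCoord y * G i y| ≤ M) :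
    ∃ f : Space d → ℝ, ContinuousOn f (halfBall d) ∧ F =ᵐ[volume.restrict (halfBall d)] f := by
  choose M hM using hG
  refine exists_continuous_rep (M := ∑ i, |M i|) hFG fun i => (hM i).mono fun y hy => ?_
  exact hy.trans ((le_abs_self _).trans
    (Finset.single_le_sum (f := fun i => |M i|) (fun _ _ => abs_nonneg _) (Finset.mem_univ i)))

theorem ae_bound_weighted {f : Space d → ℝ}
    (h : ∃ M, ∀ᵐ y ∂(volume.restrict (halfBall d)), |f y| ≤ M) :
    ∃ M, ∀ᵐ y ∂(volume.restrict (halfBall d)), |normalCoord y * f y| ≤ M := by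
  obtain ⟨M, hM⟩ := h
  refine ⟨M, ?_⟩
  filter_upwards [hM, ae_restrict_mem (measurableSet_halfBall d)] with y hy hyU
  rw [abs_mul, abs_of_pos (normalCoord_pos hyU)]
  exact (mul_le_of_le_one_left (abs_nonneg _) (normalCoord_lt_one hyU).le).trans hy

theorem add_unit_last {μ : MultiIndex d} (hμ : μ (Fin.last d) = 0) {l : Fin (d + 1)}
    (hl : l ≠ Fin.last d) : (μ + unitIndex l) (Fin.last d) = 0 := by
  simp [hμ, unitIndex_ne (Ne.symm hl)]

/-- The tangential derivatives of the gradient have continuous representatives. -/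
theorem exists_tangential_rep {R : ℝ} (hR : 0 < R) {K : ℝ≥0∞} (hK : K < ∞)
    {v : Space d → Fin m → ℝ} (h : tangentialNorm R v ≤ K) :
    ∃ W : MultiIndex d → Fin m → Fin (d + 1) → Space d → ℝ,
      ∀ μ, μ (Fin.last d) = 0 → ∀ j i, ContinuousOn (W μ j i) (halfBall d) ∧
        IsWeakDeriv (μ + unitIndex i) (fun y => v y j) (W μ j i) := by
  have h0 : ∀ μ : MultiIndex d, μ (Fin.last d) = 0 → ∀ (j : Fin m) (i : Fin (d + 1)),
      ∃ w, IsWeakDeriv (μ + unitIndex i) (fun y => v y j) w ∧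
        ∃ M, ∀ᵐ y ∂(volume.restrict (halfBall d)), |w y| ≤ M := fun μ hμ j i => by
    have h2 := (tangential_term_lt_top hR hK h j i hμ).2
    obtain ⟨w, hw⟩ := exists_isWeakDeriv_of_derivNorm h2
    rw [derivNorm_eq hw] at h2
    exact ⟨w, hw, exists_ae_bound h2⟩
  have key : ∀ μ : MultiIndex d, μ (Fin.last d) = 0 → ∀ (j : Fin m) (i : Fin (d + 1)),
      ∃ f, ContinuousOn f (halfBall d) ∧ IsWeakDeriv (μ + unitIndex i) (fun y => v y j) f := by
    intro μ hμ j i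
    obtain ⟨w, hw, -⟩ := h0 μ hμ j i
    -- The tangential derivatives of w are bounded by the terms of the tangential norm one order
    -- higher. Its normal derivative is bounded only after multiplication by y_n, which is all that
    -- a continuous representative needs.
    have hG : ∀ l, ∃ G, IsWeakDeriv (unitIndex l) w G ∧
        ∃ M, ∀ᵐ y ∂(volume.restrict (halfBall d)), |normalCoord y * G y| ≤ M := by
      intro l
      by_cases hl : l = Fin.last d
      · subst hl
        have h2 := (tangential_term_lt_top hR hK h j i hμ).1
        obtain ⟨G, hG⟩ := exists_isWeakDeriv_of_weightedDerivNorm h2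
        rw [weightedDerivNorm_eq hG] at h2
        exact ⟨G, hw.step hG, exists_ae_bound h2⟩
      · obtain ⟨G, hG, hM⟩ := h0 _ (add_unit_last hμ hl) j i
        rw [add_right_comm] at hG
        exact ⟨G, hw.step hG, ae_bound_weighted hM⟩
    choose G hG hM using hG
    obtain ⟨f, hf, hwf⟩ := exists_continuous_rep' hG hM
    exact ⟨f, hf, isWeakDeriv_congr EventuallyEq.rfl hwf hw⟩
  choose! W hW using key
  exact ⟨W, fun μ hμ j i => hW μ hμ j i⟩

/-- The components of `(V, ∇V)`. -/
noncomputable def comps (V : Fin m → Space d → ℝ) (a : StateIndex d m) : Space d → ℝ :=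
  Sum.elim V (fun p => partialDeriv p.2 (V p.1)) a

/-- The values of `(V, ∇V)`. -/
noncomputable def jet (V : Fin m → Space d → ℝ) (y : Space d) : State d m :=
  ofComps fun a => comps V a y

theorem jet_eq (V : Fin m → Space d → ℝ) (y : Space d) :
    jet V y = (fun j => V j y, fun j i => partialDeriv i (V j) y) := by
  rw [jet, ofComps_eq]; rfl

/-- The continuous function max (|f|, M) equals M almost everywhere, hence everywhere. -/
theorem abs_le_of_ae {f : Space d → ℝ} {M : ℝ} (hf : ContinuousOn f (halfBall d))
    (h : ∀ᵐ y ∂(volume.restrict (halfBall d)), |f y| ≤ M) {y : Space d} (hy : y ∈ halfBall d) :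
    |f y| ≤ M := by
  have h1 : ContinuousOn (fun y => max |f y| M) (halfBall d) := ContinuousOn.sup hf.abs continuousOn_const
  have := eqOn_of_ae_eq (isOpen_halfBall d) h1 continuousOn_const
    (h.mono fun y hy => max_eq_right hy) hy
  exact max_eq_right_iff.1 this

theorem TangentialReg.of_le {k k' n : ℕ} (hk : k ≤ k') {F : Space d → ℝ}
    (h : TangentialReg k' n F) : TangentialReg k n F := by
  induction n generalizing F with
  | zero => exact ContDiffOn.of_le h (by exact_mod_cast hk)
  | succ n ih =>
    exact ⟨h.1.of_le (by exact_mod_cast hk), fun l hl => ⟨(h.2 l hl).1, ih (h.2 l hl).2⟩⟩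

end Interior

end DegenerateSystem

namespace DegenerateSystem
open Set Filter Topology

variable {d m : ℕ}

/-- The ball on which all coefficients are smooth and the operator is not degenerate in the normal
direction. -/
structure CoeffSmooth (A : Fin m → Fin (d + 1) → Fin (d + 1) → Grad d m → ℝ)
    (g : Fin m → State d m → ℝ) (ρ : ℝ) : Prop where
  A_smooth : ∀ j k l, ContDiffOn ℝ (⊤ : ℕ∞) (fun x : State d m => A j k l x.2) (Metric.ball 0 ρ)
  g_smooth : ∀ j, ContDiffOn ℝ (⊤ : ℕ∞) (g j) (Metric.ball 0 ρ)
  A_small : ∀ j, ∀ x ∈ Metric.ball (0 : State d m) ρ, A j (Fin.last d) (Fin.last d) x.2 < 1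

/-- The classical form of the system. -/
def ClassicalSolution (γ : Fin m → ℝ)
    (A : Fin m → Fin (d + 1) → Fin (d + 1) → Grad d m → ℝ)
    (g : Fin m → State d m → ℝ) (V : Fin m → Space d → ℝ) : Prop :=
  ∀ j, ∀ y ∈ halfBall d,
    normalCoord y * partialDeriv (Fin.last d) (partialDeriv (Fin.last d) (V j)) y
        + γ j * partialDeriv (Fin.last d) (V j) y
      = normalCoord y * (∑ k, ∑ l, A j k l (jet V y).2 * partialDeriv k (partialDeriv l (V j)) y)
        + g j (jet V y)

/-- Solutions with controlled tangential derivatives are smooth inside the half ball. -/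
theorem exists_smooth_solution {γ : Fin m → ℝ}
    {A : Fin m → Fin (d + 1) → Fin (d + 1) → Grad d m → ℝ}
    {g : Fin m → State d m → ℝ} {ρ : ℝ} (hc : CoeffSmooth A g ρ) (hρ : 0 < ρ)
    {v : Space d → Fin m → ℝ} (hv : IsSolution γ A g v) {ε R : ℝ} (hR : 0 < R)
    (hvε : ∀ j, ∀ᵐ y ∂(volume.restrict (halfBall d)), |v y j| ≤ ε) (hε : ε < ρ)
    {T : ℝ} (hT : T < ρ) (hT0 : 0 ≤ T) (ht : tangentialNorm R v ≤ ENNReal.ofReal T) :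
    ∃ V : Fin m → Space d → ℝ, (∀ j, SmoothOn (V j) (halfBall d)) ∧
      (∀ j, (fun y => v y j) =ᵐ[volume.restrict (halfBall d)] V j) ∧
      ClassicalSolution γ A g V ∧ (∀ y ∈ halfBall d, jet V y ∈ Metric.ball (0 : State d m) ρ) := by
  classical
  obtain ⟨W, hW⟩ := exists_tangential_rep hR ENNReal.ofReal_lt_top ht
  have hz : (0 : MultiIndex d) (Fin.last d) = 0 := rfl
  have hU := isOpen_halfBall d
  have hun : ∀ {l : Fin (d + 1)}, l ≠ Fin.last d → (unitIndex l : MultiIndex d) (Fin.last d) = 0 :=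
    fun hl => unitIndex_ne (Ne.symm hl)
  have hW0 : ∀ j i, IsWeakDeriv (unitIndex i) (fun y => v y j) (W 0 j i) := fun j i => by
    simpa using (hW 0 hz j i).2
  -- The μ = 0 term of the tangential norm bounds ∇v by T < ρ. Together with |v| ≤ ε < ρ it keeps
  -- (v, ∇v) inside the ball where the coefficients are smooth.
  have hWb : ∀ j i, ∀ y ∈ halfBall d, |W 0 j i y| ≤ T := fun j i y hy => by
    refine abs_le_of_ae (hW 0 hz j i).1 ?_ hy
    have h1 := tangential_term_le ht j i hz
    rw [order_zero, pow_zero, Nat.factorial_zero, Nat.cast_one, div_one, ENNReal.ofReal_one,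
      one_mul, derivNorm_eq (hW 0 hz j i).2] at h1
    have h2 := le_trans le_add_self h1
    rw [eLpNorm_exponent_top] at h2
    filter_upwards [ae_le_eLpNormEssSup (f := W 0 j i) (μ := volume.restrict (halfBall d))]
      with y hy
    have h3 := hy.trans h2
    rw [← ofReal_norm] at h3
    exact (ENNReal.ofReal_le_ofReal_iff hT0).1 h3
  have hrep : ∀ j, ∃ f, ContinuousOn f (halfBall d) ∧
      (fun y => v y j) =ᵐ[volume.restrict (halfBall d)] f := fun j =>
    exists_continuous_rep' (hW0 j) fun i => by
      refine ae_bound_weighted ⟨T, ?_⟩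
      filter_upwards [ae_restrict_mem (measurableSet_halfBall d)] with y hy using hWb j i y hy
  choose V hVc hVv using hrep
  have hV0 : ∀ j i, IsWeakDeriv (unitIndex i) (V j) (W 0 j i) := fun j i =>
    isWeakDeriv_congr (hVv j) EventuallyEq.rfl (hW0 j i)
  have hVW : ∀ {μ} j i, μ (Fin.last d) = 0 → IsWeakDeriv (μ + unitIndex i) (V j) (W μ j i) :=
    fun j i hμ => isWeakDeriv_congr (hVv j) EventuallyEq.rfl (hW _ hμ j i).2
  have hVb : ∀ j, ∀ y ∈ halfBall d, |V j y| ≤ ε := fun j y hy =>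
    abs_le_of_ae (hVc j) (by filter_upwards [hVv j, hvε j] with y h1 h2; rwa [← h1]) hy
  -- the coordinates of the jet
  set F : StateIndex d m → Space d → ℝ := fun a => Sum.elim V (fun p => W 0 p.1 p.2) a with hF
  have hball : ∀ y ∈ halfBall d, ∑ a, F a y • stateBasis a ∈ Metric.ball (0 : State d m) ρ := by
    intro y hy
    rw [mem_ball_zero_iff]
    refine norm_ofComps_lt (x := fun a => F a y) hρ fun a => ?_
    rcases a with j | ⟨j, i⟩
    · exact (hVb j y hy).trans_lt hε
    · exact (hWb j i y hy).trans_lt hT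
  have hFe : ∀ y, ∑ a, F a y • stateBasis a = (fun j => V j y, fun j i => W 0 j i y) :=
    fun y => ofComps_eq fun a => F a y
  -- line derivatives in tangential directions
  have hline : ∀ {μ : MultiIndex d} j i {l}, μ (Fin.last d) = 0 → l ≠ Fin.last d →
      ∀ y ∈ halfBall d, HasLineDerivAt ℝ (W μ j i) (W (μ + unitIndex l) j i y) y (dir l) := by
    intro μ j i l hμ hl y hy
    have h1 := hVW j i (add_unit_last hμ hl)
    rw [add_right_comm] at h1
    exact ((hVW j i hμ).step h1).hasLineDerivAt (hW μ hμ j i).1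
      (hW _ (add_unit_last hμ hl) j i).1 hy
  obtain ⟨D, H, hD, hH, heq⟩ := hv
  have hDW : ∀ j i, (fun y => D y j i) =ᵐ[volume.restrict (halfBall d)] W 0 j i := fun j i =>
    isWeakDeriv_unique (hD j i) (hW0 j i)
  -- the mixed second derivatives
  set S : Fin m → Fin (d + 1) → Fin (d + 1) → Space d → ℝ := fun j k l =>
    if l ≠ Fin.last d then W (unitIndex l) j k else W (unitIndex k) j l with hS
  have hSw : ∀ j k l, ¬(k = Fin.last d ∧ l = Fin.last d) →
      IsWeakDeriv (unitIndex k + unitIndex l) (V j) (S j k l) := by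
    intro j k l hkl
    by_cases hl : l = Fin.last d
    · have hk : k ≠ Fin.last d := fun hk => hkl ⟨hk, hl⟩
      simp only [hS, hl, ne_eq, not_true_eq_false, if_false]
      exact hVW j _ (hun hk)
    · simp only [hS, ne_eq, hl, not_false_eq_true, if_true]
      rw [add_comm]
      exact hVW j _ (hun hl)
  -- This is the equation divided by y_n and solved for ∂_n² v^j, which is possible because A_nn < 1
  -- on the ball. The right side involves only v, ∇v and second derivatives with a tangential index.
  set Ψ : Fin m → Space d → ℝ := fun j y =>
    (1 - A j (Fin.last d) (Fin.last d) (∑ a, F a y • stateBasis a : State d m).2)⁻¹ *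
      ((normalCoord y)⁻¹ * (g j (∑ a, F a y • stateBasis a) + (-γ j) * W 0 j (Fin.last d) y)
        + ∑ k, ∑ l, (if k = Fin.last d ∧ l = Fin.last d then (fun _ => 0) else
          fun y => A j k l (∑ a, F a y • stateBasis a : State d m).2 * S j k l y) y) with hΨ
  have hHΨ : ∀ j, H j (Fin.last d) (Fin.last d) =ᵐ[volume.restrict (halfBall d)] Ψ j := by
    intro j
    have hHS : ∀ k l, ¬(k = Fin.last d ∧ l = Fin.last d) →
        H j k l =ᵐ[volume.restrict (halfBall d)] S j k l := fun k l hkl =>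
      isWeakDeriv_unique (isWeakDeriv_congr (hVv j) EventuallyEq.rfl (hH j k l)) (hSw j k l hkl)
    have hHS' : ∀ᵐ y ∂(volume.restrict (halfBall d)), ∀ k l,
        ¬(k = Fin.last d ∧ l = Fin.last d) → H j k l y = S j k l y := by
      refine ae_all_iff.2 fun k => ae_all_iff.2 fun l => ?_
      by_cases hkl : k = Fin.last d ∧ l = Fin.last d
      · exact Eventually.of_forall fun y h => absurd hkl h
      · exact (hHS k l hkl).mono fun y hy _ => hy
    have hD' : ∀ᵐ y ∂(volume.restrict (halfBall d)), ∀ j i, D y j i = W 0 j i y :=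
      ae_all_iff.2 fun j => ae_all_iff.2 fun i => hDW j i
    have hV' : ∀ᵐ y ∂(volume.restrict (halfBall d)), ∀ j, v y j = V j y :=
      ae_all_iff.2 fun j => hVv j
    filter_upwards [heq j, hHS', hD', hV', ae_restrict_mem (measurableSet_halfBall d)]
      with y h1 h2 h3 h4 hy
    have hDy : D y = (∑ a, F a y • stateBasis a : State d m).2 := by
      rw [hFe]; ext j i; exact h3 j i
    have hvy : (v y, D y) = ∑ a, F a y • stateBasis a := by
      rw [hFe]; exact Prod.ext (funext h4) (by ext j i; exact h3 j i)
    have hlt := hc.A_small j _ (hball y hy)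
    have hsum : ∑ k, ∑ l, A j k l (D y) * H j k l y
        = A j (Fin.last d) (Fin.last d) (D y) * H j (Fin.last d) (Fin.last d) y
          + ∑ k, ∑ l, (if k = Fin.last d ∧ l = Fin.last d then (fun _ => 0) else
          fun y => A j k l (∑ a, F a y • stateBasis a : State d m).2 * S j k l y) y := by
      have : ∀ k l, A j k l (D y) * H j k l y
          = (if k = Fin.last d then if l = Fin.last d then
              A j (Fin.last d) (Fin.last d) (D y) * H j (Fin.last d) (Fin.last d) y else 0 else 0)
            + (if k = Fin.last d ∧ l = Fin.last d then (fun _ => 0) else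
          fun y => A j k l (∑ a, F a y • stateBasis a : State d m).2 * S j k l y) y := by
        intro k l
        by_cases hkl : k = Fin.last d ∧ l = Fin.last d
        · simp [hkl.1, hkl.2]
        · rw [if_neg hkl, ← hDy, h2 k l hkl]
          by_cases hk : k = Fin.last d
          · have hl : l ≠ Fin.last d := fun hl => hkl ⟨hk, hl⟩
            simp [hl]
          · simp [hk]
      rw [Finset.sum_congr rfl fun k _ => Finset.sum_congr rfl fun l _ => this k l]
      simp only [Finset.sum_add_distrib]
      congr 1
      rw [Finset.sum_eq_single (Fin.last d) (fun b _ hb => by simp only [hb, if_false,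
        Finset.sum_const_zero]) (fun h => absurd (Finset.mem_univ _) h),
        Finset.sum_eq_single (Fin.last d) (fun b _ hb => by simp only [hb, if_false, if_true])
        (fun h => absurd (Finset.mem_univ _) h), if_pos rfl, if_pos rfl]
    rw [hsum, hvy, h3, hDy] at h1
    have ht := normalCoord_pos hy
    simp only [hΨ]
    set a := A j (Fin.last d) (Fin.last d) (∑ a, F a y • stateBasis a : State d m).2
    have ha : 1 - a ≠ 0 := by linarith
    rw [eq_inv_mul_iff_mul_eq₀ ha]
    field_simp
    linarith
  -- regularity
  have hstep : ∀ k, (∀ j i n, TangentialReg k n (W 0 j i)) → (∀ j n, TangentialReg k n (V j)) →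
      ∀ j i n, TangentialReg (k + 1) n (W 0 j i) := by
    intro k hk hkV j i
    have hF' : ∀ n a, TangentialReg k n (F a) := fun n a => by
      rcases a with j | ⟨j, i⟩
      · exact hkV j n
      · exact hk j i n
    have hWu : ∀ j i {l} n, l ≠ Fin.last d → TangentialReg k n (W (unitIndex l) j i) := by
      intro j i l n hl
      refine ((hk j i (n + 1)).2 l hl).2.congr fun y hy => ?_
      have := (hline j i hz hl y hy).lineDeriv
      rwa [zero_add] at this
    have hA : ∀ n j k' l', TangentialReg k n fun y =>
        A j k' l' (∑ a, F a y • stateBasis a : State d m).2 := fun n j k' l' =>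
      TangentialReg.comp (B := fun x : State d m => A j k' l' x.2) Metric.isOpen_ball
        (hc.A_smooth j k' l') stateBasis (hF' n) hball
    have hΨr : ∀ n, TangentialReg k n (Ψ j) := by
      intro n
      refine TangentialReg.mul ?_ ((TangentialReg.inv_normalCoord.mul
        ((TangentialReg.comp Metric.isOpen_ball (hc.g_smooth j) stateBasis (hF' n) hball).add
          ((TangentialReg.const _).mul (hk j _ n)))).add (TangentialReg.sum _ fun k' _ =>
            TangentialReg.sum _ fun l' _ => ?_))
      · refine TangentialReg.comp (B := fun x : State d m =>
          (1 - A j (Fin.last d) (Fin.last d) x.2)⁻¹) Metric.isOpen_ball ?_ stateBasis (hF' n) hball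
        exact (contDiffOn_const.sub (hc.A_smooth j _ _)).inv fun x hx => by
          have := hc.A_small j x hx
          linarith
      · by_cases hkl : k' = Fin.last d ∧ l' = Fin.last d
        · simp only [hkl, and_self, if_true]
          exact TangentialReg.const 0
        · simp only [hkl, if_false]
          refine (hA n j k' l').mul ?_
          by_cases hl : l' = Fin.last d
          · have hk' : k' ≠ Fin.last d := fun hk => hkl ⟨hk, hl⟩
            simp only [hS, hl, ne_eq, not_true_eq_false, if_false]
            exact hWu j _ n hk'
          · simp only [hS, ne_eq, hl, not_false_eq_true, if_true]
            exact hWu j _ n hl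
    refine TangentialReg.succ_of_weak (G := fun l => if l ≠ Fin.last d then W (unitIndex l) j i
      else if i ≠ Fin.last d then W (unitIndex i) j (Fin.last d) else Ψ j) (hW 0 hz j i).1 ?_ ?_
    · intro l
      by_cases hl : l = Fin.last d
      · by_cases hi : i = Fin.last d
        · simp only [hl, hi, ne_eq, not_true_eq_false, if_false]
          refine isWeakDeriv_congr EventuallyEq.rfl (hHΨ j) ?_
          exact (hW0 j _).step (hH j _ _)
        · simp only [hl, ne_eq, not_true_eq_false, if_false, hi, not_false_eq_true, if_true]
          exact (hV0 j i).step (hVW j _ (hun hi))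
      · simp only [ne_eq, hl, not_false_eq_true, if_true]
        have := hVW j i (hun hl)
        rw [add_comm] at this
        exact (hV0 j i).step this
    · intro l n
      by_cases hl : l = Fin.last d
      · by_cases hi : i = Fin.last d
        · simp only [hl, hi, ne_eq, not_true_eq_false, if_false]
          exact hΨr n
        · simp only [hl, ne_eq, not_true_eq_false, if_false, hi, not_false_eq_true, if_true]
          exact hWu j _ n hi
      · simp only [ne_eq, hl, not_false_eq_true, if_true]
        exact hWu j _ n hl
  have hVreg : ∀ k, (∀ j i n, TangentialReg k n (W 0 j i)) →
      ∀ j n, TangentialReg (k + 1) n (V j) := fun k hk j n =>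
    TangentialReg.succ_of_weak (hVc j) (hV0 j) (fun i n => hk j i n) n
  have hbase : ∀ n, ∀ {μ : MultiIndex d} j i, μ (Fin.last d) = 0 →
      TangentialReg 0 n (W μ j i) := by
    intro n
    induction n with
    | zero => exact fun j i hμ => contDiffOn_zero.2 (hW _ hμ j i).1
    | succ n ih =>
      exact fun {μ} j i hμ => TangentialReg.mk (contDiffOn_zero.2 (hW _ hμ j i).1) fun l hl =>
        ⟨W (μ + unitIndex l) j i, hline j i hμ hl, ih j i (add_unit_last hμ hl)⟩
  have hreg : ∀ k j i n, TangentialReg k n (W 0 j i) := by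
    intro k
    induction k with
    | zero => exact fun j i n => hbase n j i hz
    | succ k ih => exact hstep k ih fun j n => (hVreg k ih j n).of_le (Nat.le_succ k)
  have hVs : ∀ j, SmoothOn (V j) (halfBall d) := fun j =>
    contDiffOn_infty.2 fun k => ((hVreg k (hreg k) j 0).of_le (Nat.le_succ k)).contDiffOn
  have hpd : ∀ j i, EqOn (partialDeriv i (V j)) (W 0 j i) (halfBall d) := fun j i y hy => by
    rw [partialDeriv_apply, (hasFDerivAt_of_weak (hV0 j) (hVc j) (fun i => (hW 0 hz j i).1) hy).fderiv]
    simp [dir, PiLp.single_apply]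
  have hjet : ∀ y ∈ halfBall d, jet V y = ∑ a, F a y • stateBasis a := fun y hy => by
    rw [jet_eq, hFe]
    exact Prod.ext rfl (by ext j i; exact hpd j i hy)
  refine ⟨V, hVs, hVv, ?_, fun y hy => by rw [hjet y hy]; exact hball y hy⟩
  intro j
  have hjs : ContDiffOn ℝ (⊤ : ℕ∞) (jet V) (halfBall d) := by
    have hcomp : ∀ a, SmoothOn (comps V a) (halfBall d) := fun a => by
      rcases a with j | ⟨j, i⟩
      · exact hVs j
      · exact (hVs j).partialDeriv hU i
    exact ContDiffOn.sum fun a _ => (hcomp a).smul contDiffOn_const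
  have hjm : MapsTo (jet V) (halfBall d) (Metric.ball 0 ρ) := fun y hy => by
    rw [hjet y hy]; exact hball y hy
  have hps : ∀ k l, ContinuousOn (partialDeriv k (partialDeriv l (V j))) (halfBall d) :=
    fun k l => (((hVs j).partialDeriv hU l).partialDeriv hU k).continuousOn
  have hn : ContinuousOn (normalCoord : Space d → ℝ) (halfBall d) :=
    (smoothOn_normalCoord _).continuousOn
  -- Both sides of the equation are now continuous, so it suffices that they agree almost
  -- everywhere.
  refine eqOn_of_ae_eq hU ((hn.mul (hps _ _)).add (continuousOn_const.mul
    ((hVs j).partialDeriv hU _).continuousOn)) ((hn.mul (continuousOn_finsetSum _ fun k _ =>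
      continuousOn_finsetSum _ fun l _ => (((hc.A_smooth j k l).comp hjs hjm).continuousOn).mul
        (hps k l))).add ((hc.g_smooth j).comp hjs hjm).continuousOn) ?_
  have hHp : ∀ k l, H j k l =ᵐ[volume.restrict (halfBall d)]
      partialDeriv k (partialDeriv l (V j)) := fun k l => by
    have h1 := isWeakDeriv_multiDeriv (hVs j) (unitIndex k + unitIndex l)
    refine (isWeakDeriv_unique (isWeakDeriv_congr (hVv j) EventuallyEq.rfl (hH j k l)) h1).trans ?_
    filter_upwards [ae_restrict_mem (measurableSet_halfBall d)] with y hy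
    rw [multiDeriv_add_unit hU (hVs j) _ l hy,
      partialDeriv_congr hU (multiDeriv_unit hU (hVs j) k) l hy, partialDeriv_comm hU (hVs j) l k hy]
  have hHp' : ∀ᵐ y ∂(volume.restrict (halfBall d)), ∀ k l,
      H j k l y = partialDeriv k (partialDeriv l (V j)) y :=
    ae_all_iff.2 fun k => ae_all_iff.2 fun l => hHp k l
  have hD' : ∀ᵐ y ∂(volume.restrict (halfBall d)), ∀ j i, D y j i = W 0 j i y :=
    ae_all_iff.2 fun j => ae_all_iff.2 fun i => hDW j i
  have hV' : ∀ᵐ y ∂(volume.restrict (halfBall d)), ∀ j, v y j = V j y :=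
    ae_all_iff.2 fun j => hVv j
  filter_upwards [heq j, hHp', hD', hV', ae_restrict_mem (measurableSet_halfBall d)]
    with y h1 h2 h3 h4 hy
  have hjy : jet V y = (v y, D y) := by
    rw [jet_eq]
    refine Prod.ext (funext fun j => (h4 j).symm) ?_
    ext j i
    change partialDeriv i (V j) y = D y j i
    rw [h3]
    exact hpd j i hy
  simp only [h2, h3] at h1
  simp only [hpd j _ hy, hjy]
  exact h1

end DegenerateSystem

namespace DegenerateSystem
open Set Filter Topology

variable {d m : ℕ}

/-! ### Comparison principle for Fuchsian inequalities -/

section Fuchsian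

/-- Comparison for a Fuchsian differential inequality on an interval `(0, T]`. -/
theorem fuchsian_bound {h h' : ℝ → ℝ} {T K M lam θ : ℝ} (hT : 0 < T) (hθ : θ < lam) (hlam : 0 < lam)
    (hder : ∀ τ ∈ Ioc 0 T, HasDerivAt h (h' τ) τ)
    (hle : ∀ τ ∈ Ioc 0 T, τ * h' τ + lam * h τ ≤ K)
    (hM : ∀ τ ∈ Ioc 0 T, h τ ≤ M * τ ^ (-θ)) : h T ≤ K / lam := by
  -- With the integrating factor τ^λ one has φ' = τ^{λ-1} (τ h' + λ h - K) ≤ 0. The growth bound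
  -- with θ < λ excludes the homogeneous solution τ^{-λ}: it bounds φ from above, near 0, by a
  -- function tending to 0. So φ(T) ≤ 0.
  set φ : ℝ → ℝ := fun τ => τ ^ lam * (h τ - K / lam) with hφ
  have hφd : ∀ τ ∈ Ioc 0 T, HasDerivAt φ
      (lam * τ ^ (lam - 1) * (h τ - K / lam) + τ ^ lam * h' τ) τ := fun τ hτ =>
    (Real.hasDerivAt_rpow_const (Or.inl hτ.1.ne')).mul ((hder τ hτ).sub_const _)
  have hanti : AntitoneOn φ (Ioc 0 T) := by
    refine antitoneOn_of_deriv_nonpos (convex_Ioc 0 T)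
      (fun τ hτ => (hφd τ hτ).continuousAt.continuousWithinAt) (fun τ hτ => ?_) fun τ hτ => ?_
    · exact (hφd τ (interior_subset hτ)).differentiableAt.differentiableWithinAt
    · have hτ' := interior_subset hτ
      rw [(hφd τ hτ').deriv]
      have e : τ ^ lam = τ ^ (lam - 1) * τ := by
        rw [← Real.rpow_add_one hτ'.1.ne', sub_add_cancel]
      have h1 : lam * τ ^ (lam - 1) * (h τ - K / lam) + τ ^ lam * h' τ
          = τ ^ (lam - 1) * (τ * h' τ + lam * h τ - K) := by
        rw [e]; field_simp; ring
      rw [h1]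
      exact mul_nonpos_of_nonneg_of_nonpos (Real.rpow_nonneg hτ'.1.le _)
        (by linarith [hle τ hτ'])
  have hlim : Tendsto (fun τ : ℝ => M * τ ^ (lam - θ) - τ ^ lam * (K / lam)) (𝓝[>] 0) (𝓝 0) := by
    have h1 : ∀ b : ℝ, 0 < b → Tendsto (fun τ : ℝ => τ ^ b) (𝓝[>] 0) (𝓝 0) := fun b hb => by
      have := (Real.continuousAt_rpow_const 0 b (Or.inr hb.le)).tendsto
      rw [Real.zero_rpow hb.ne'] at this
      exact this.mono_left nhdsWithin_le_nhds
    simpa using ((h1 (lam - θ) (by linarith)).const_mul M).sub ((h1 lam hlam).mul_const (K / lam))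
  have hφT : φ T ≤ 0 := by
    refine ge_of_tendsto hlim ?_
    filter_upwards [Ioc_mem_nhdsGT hT] with τ hτ
    refine (hanti hτ (right_mem_Ioc.2 hT) hτ.2).trans ?_
    have h1 := mul_le_mul_of_nonneg_left (hM τ hτ) (Real.rpow_nonneg hτ.1.le lam)
    have h2 : τ ^ lam * (M * τ ^ (-θ)) = M * τ ^ (lam - θ) := by
      rw [sub_eq_add_neg, Real.rpow_add hτ.1]; ring
    simp only [hφ, mul_sub]
    linarith
  have : 0 < T ^ lam := Real.rpow_pos_of_pos hT lam
  have := nonpos_of_mul_nonpos_right hφT this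
  linarith

/-- The comparison principle along the normal rays of the half ball. -/
theorem normal_fuchsian_bound {f : Space d → ℝ} {K M lam θ : ℝ} (hf : SmoothOn f (halfBall d))
    (hθ : θ < lam) (hlam : 0 < lam)
    (hle : ∀ y ∈ halfBall d, normalCoord y * partialDeriv (Fin.last d) f y + lam * f y ≤ K)
    (hM : ∀ y ∈ halfBall d, f y ≤ M * normalCoord y ^ (-θ)) {y : Space d} (hy : y ∈ halfBall d) :
    f y ≤ K / lam := by
  set z : ℝ → Space d := fun τ => y + (τ - normalCoord y) • dir (Fin.last d) with hz
  have hzn : ∀ τ, normalCoord (z τ) = τ := fun τ => by simp [hz, normalCoord, dir]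
  have hzU : ∀ τ ∈ Ioc 0 (normalCoord y), z τ ∈ halfBall d := fun τ hτ =>
    halfBall_normal_segment hy hτ.1 hτ.2
  have := fuchsian_bound (h := fun τ => f (z τ)) (h' := fun τ => partialDeriv (Fin.last d) f (z τ))
    (T := normalCoord y) (K := K) (M := M) (normalCoord_pos hy) hθ hlam (fun τ hτ => ?_)
    (fun τ hτ => ?_) (fun τ hτ => ?_)
  · simpa [hz] using this
  · have h1 : HasDerivAt z (dir (Fin.last d)) τ := by
      simpa [hz] using (((hasDerivAt_id τ).sub_const (normalCoord y)).smul_const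
        (dir (Fin.last d))).const_add y
    exact (hf.differentiableAt (isOpen_halfBall d) (hzU τ hτ)).hasFDerivAt.comp_hasDerivAt τ h1
  · have := hle (z τ) (hzU τ hτ)
    rwa [hzn] at this
  · have := hM (z τ) (hzU τ hτ)
    rwa [hzn] at this

theorem normal_fuchsian_abs_bound {f : Space d → ℝ} {K M lam : ℝ} (hf : SmoothOn f (halfBall d))
    (hlam : 0 < lam)
    (hle : ∀ y ∈ halfBall d, |normalCoord y * partialDeriv (Fin.last d) f y + lam * f y| ≤ K)
    (hM : ∀ y ∈ halfBall d, |f y| ≤ M) {y : Space d} (hy : y ∈ halfBall d) :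
    |f y| ≤ K / lam := by
  rw [abs_le]
  constructor
  · have hn : ∀ z, partialDeriv (Fin.last d) (fun y => -f y) z = -partialDeriv (Fin.last d) f z :=
      fun z => by simp only [partialDeriv_apply]; rw [fderiv_fun_neg]; rfl
    have := normal_fuchsian_bound (f := fun y => -f y) (K := K) (M := M) (θ := 0) hf.neg hlam hlam
      (fun z hz => by
        rw [hn]
        have := (abs_le.1 (hle z hz)).1
        linarith) (fun z hz => by
          have := (abs_le.1 (hM z hz)).1
          simp; linarith) hy
    linarith
  · exact normal_fuchsian_bound (K := K) (M := M) (θ := 0) hf hlam hlam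
      (fun z hz => (abs_le.1 (hle z hz)).2) (fun z hz => by simpa using (abs_le.1 (hM z hz)).2) hy

end Fuchsian

/-! ### Commuting derivatives with the weight y_n -/

section NormalCoordinate

/-- Derivatives of a product with the normal coordinate. -/
theorem multiDeriv_normalCoord_mul {f : Space d → ℝ} (hf : SmoothOn f (halfBall d))
    (μ : MultiIndex d) :
    EqOn (multiDeriv μ fun y => normalCoord y * f y)
      (fun y => normalCoord y * multiDeriv μ f y
        + (μ (Fin.last d) : ℝ) * multiDeriv (μ - unitIndex (Fin.last d)) f y) (halfBall d) := by
  have hU := isOpen_halfBall d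
  have ht := smoothOn_normalCoord (halfBall d)
  induction μ using multiIndex_induction with
  | zero => intro y _; simp [multiDeriv_zero]
  | step μ i ih =>
    refine (multiDeriv_add_unit hU (ht.mul hf) μ i).trans ((partialDeriv_congr hU ih i).trans ?_)
    have s1 := multiDeriv_smooth hU hf μ
    have s2 := multiDeriv_smooth hU hf (μ - unitIndex (Fin.last d))
    intro y hy
    rw [partialDeriv_add hU (ht.mul s1) (contDiffOn_const.mul s2) i hy]
    beta_reduce
    rw [partialDeriv_mul hU ht s1 i hy, partialDeriv_mul hU contDiffOn_const s2 i hy]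
    beta_reduce
    rw [partialDeriv_normalCoord, partialDeriv_const, ← multiDeriv_add_unit hU hf μ i hy,
      ← multiDeriv_add_unit hU hf _ i hy]
    by_cases hi : i = Fin.last d
    · subst hi
      rw [add_tsub_cancel_right, if_pos rfl, Pi.add_apply, unitIndex_self]
      rcases Nat.eq_zero_or_pos (μ (Fin.last d)) with h0 | h0
      · simp [h0]; ring
      · have : μ - unitIndex (Fin.last d) + unitIndex (Fin.last d) = μ := by
          refine tsub_add_cancel_of_le fun j => ?_
          rcases eq_or_ne j (Fin.last d) with rfl | hj
          · rw [unitIndex_self]; exact h0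
          · rw [unitIndex_ne hj]; exact Nat.zero_le _
        rw [this]; push_cast; ring
    · have h1 : μ + unitIndex i - unitIndex (Fin.last d)
          = μ - unitIndex (Fin.last d) + unitIndex i := by
        ext j
        rcases eq_or_ne j (Fin.last d) with rfl | hj
        · simp [unitIndex_ne (Ne.symm hi)]
        · simp [unitIndex_ne hj]
      rw [h1, Pi.add_apply, unitIndex_ne (Ne.symm hi), if_neg hi]
      simp

/-- Every normal derivative that meets the factor y_n leaves one copy of ∂^μ f, so differentiation
raises the Fuchsian exponent by μ_n. This is the source of the weight μ_n + 1 in the norms. -/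
theorem multiDeriv_weighted_normal {f : Space d → ℝ} (hf : SmoothOn f (halfBall d))
    (μ : MultiIndex d) :
    EqOn (multiDeriv μ fun y => normalCoord y * partialDeriv (Fin.last d) f y)
      (fun y => normalCoord y * partialDeriv (Fin.last d) (multiDeriv μ f) y
        + (μ (Fin.last d) : ℝ) * multiDeriv μ f y) (halfBall d) := by
  have hU := isOpen_halfBall d
  intro y hy
  rw [multiDeriv_normalCoord_mul (hf.partialDeriv hU _) μ hy]
  beta_reduce
  rw [multiDeriv_partialDeriv hU hf μ _ hy, multiDeriv_add_unit hU hf μ _ hy]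
  rcases Nat.eq_zero_or_pos (μ (Fin.last d)) with h0 | h0
  · simp [h0]
  · obtain ⟨ν, rfl⟩ := exists_sub_unit h0.ne'
    rw [add_tsub_cancel_right, multiDeriv_partialDeriv hU hf ν _ hy]

/-- The right side contains exactly the two quantities of the weighted norm at the index ν + e_l,
which has one normal derivative fewer than ν + e_n. This trade is what later gains the factor r. -/
theorem multiDeriv_weighted_tangential {f : Space d → ℝ} (hf : SmoothOn f (halfBall d))
    (ν : MultiIndex d) (l : Fin (d + 1)) :
    EqOn (multiDeriv (ν + unitIndex (Fin.last d)) fun y => normalCoord y * partialDeriv l f y)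
      (fun y => normalCoord y * partialDeriv (Fin.last d) (multiDeriv (ν + unitIndex l) f) y
        + ((ν (Fin.last d) : ℝ) + 1) * multiDeriv (ν + unitIndex l) f y) (halfBall d) := by
  have hU := isOpen_halfBall d
  intro y hy
  rw [multiDeriv_normalCoord_mul (hf.partialDeriv hU _) _ hy]
  beta_reduce
  rw [add_tsub_cancel_right,
    multiDeriv_partialDeriv hU hf _ _ hy, multiDeriv_partialDeriv hU hf _ _ hy,
    ← multiDeriv_add_unit hU hf _ _ hy, add_right_comm, Pi.add_apply, unitIndex_self]
  push_cast
  ring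

theorem multiDeriv_weighted_of_tangential {f : Space d → ℝ} (hf : SmoothOn f (halfBall d))
    {μ : MultiIndex d} (hμ : μ (Fin.last d) = 0) (l : Fin (d + 1)) :
    EqOn (multiDeriv μ fun y => normalCoord y * partialDeriv l f y)
      (fun y => normalCoord y * multiDeriv (μ + unitIndex l) f y) (halfBall d) := by
  have hU := isOpen_halfBall d
  intro y hy
  rw [multiDeriv_normalCoord_mul (hf.partialDeriv hU _) _ hy]
  beta_reduce
  rw [hμ,
    multiDeriv_partialDeriv hU hf _ _ hy]
  simp

end NormalCoordinate

/-! ### Leibniz rule modulo bounded functions -/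

section Bounded

/-- Boundedness on the half ball. -/
def BoundedOn (f : Space d → ℝ) : Prop := ∃ M, ∀ y ∈ halfBall d, |f y| ≤ M

variable {f g : Space d → ℝ} {μ : MultiIndex d}

theorem BoundedOn.congr (hf : BoundedOn f) (h : EqOn f g (halfBall d)) : BoundedOn g := by
  obtain ⟨M, hM⟩ := hf
  exact ⟨M, fun y hy => by rw [← h hy]; exact hM y hy⟩

theorem BoundedOn.add (hf : BoundedOn f) (hg : BoundedOn g) : BoundedOn fun y => f y + g y := by
  obtain ⟨M, hM⟩ := hf
  obtain ⟨N, hN⟩ := hg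
  exact ⟨M + N, fun y hy => (abs_add_le _ _).trans (add_le_add (hM y hy) (hN y hy))⟩

theorem BoundedOn.neg (hf : BoundedOn f) : BoundedOn fun y => -f y := by
  obtain ⟨M, hM⟩ := hf
  exact ⟨M, fun y hy => by rw [abs_neg]; exact hM y hy⟩

theorem BoundedOn.sub (hf : BoundedOn f) (hg : BoundedOn g) : BoundedOn fun y => f y - g y :=
  (hf.add hg.neg).congr fun y _ => by ring

theorem BoundedOn.mul (hf : BoundedOn f) (hg : BoundedOn g) : BoundedOn fun y => f y * g y := by
  obtain ⟨M, hM⟩ := hf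
  obtain ⟨N, hN⟩ := hg
  refine ⟨M * N, fun y hy => ?_⟩
  rw [abs_mul]
  exact mul_le_mul (hM y hy) (hN y hy) (abs_nonneg _) ((abs_nonneg _).trans (hM y hy))

theorem BoundedOn.const (c : ℝ) : BoundedOn fun _ : Space d => c := ⟨|c|, fun _ _ => le_rfl⟩

theorem BoundedOn.sum {ι : Type*} (s : Finset ι) {F : ι → Space d → ℝ}
    (hF : ∀ a ∈ s, BoundedOn (F a)) : BoundedOn fun y => ∑ a ∈ s, F a y := by
  classical
  induction s using Finset.induction_on with
  | empty => simpa using BoundedOn.const 0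
  | insert a s ha ih =>
    simp only [Finset.sum_insert ha]
    exact (hF a (Finset.mem_insert_self a s)).add
      (ih fun b hb => hF b (Finset.mem_insert_of_mem hb))

theorem boundedOn_normalCoord : BoundedOn (normalCoord (d := d)) :=
  ⟨1, fun y hy => by
    rw [abs_of_pos (normalCoord_pos hy)]; exact (normalCoord_lt_one hy).le⟩

/-- All derivatives up to `μ` are bounded. -/
def BoundedUpTo (μ : MultiIndex d) (f : Space d → ℝ) : Prop :=
  ∀ ν ≤ μ, BoundedOn (multiDeriv ν f)

/-- All derivatives strictly below `μ` are bounded. -/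
def BoundedBelow (μ : MultiIndex d) (f : Space d → ℝ) : Prop :=
  ∀ ν ≤ μ, ν ≠ μ → BoundedOn (multiDeriv ν f)

theorem BoundedUpTo.mono {ν : MultiIndex d} (h : BoundedUpTo μ f) (hν : ν ≤ μ) :
    BoundedUpTo ν f := fun κ hκ => h κ (hκ.trans hν)

theorem order_mono {μ ν : MultiIndex d} (h : ν ≤ μ) : order ν ≤ order μ :=
  Finset.sum_le_sum fun i _ => h i

theorem BoundedUpTo.partialDeriv {i : Fin (d + 1)} (hf : SmoothOn f (halfBall d))
    (h : BoundedUpTo (μ + unitIndex i) f) : BoundedUpTo μ (partialDeriv i f) := fun ν hν =>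
  (h (ν + unitIndex i) (add_le_add_left hν _)).congr
    (multiDeriv_partialDeriv (isOpen_halfBall d) hf ν i).symm

theorem BoundedBelow.partialDeriv {i : Fin (d + 1)} (hf : SmoothOn f (halfBall d))
    (h : BoundedBelow (μ + unitIndex i) f) : BoundedBelow μ (partialDeriv i f) := fun ν hν hne =>
  (h (ν + unitIndex i) (add_le_add_left hν _) fun h' => hne (add_right_cancel h')).congr
    (multiDeriv_partialDeriv (isOpen_halfBall d) hf ν i).symm

theorem ne_add_unit (μ : MultiIndex d) (i : Fin (d + 1)) : μ ≠ μ + unitIndex i := fun h => by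
  have := congrArg order h
  rw [order_add_unit] at this
  omega

theorem BoundedBelow.boundedUpTo {i : Fin (d + 1)} (h : BoundedBelow (μ + unitIndex i) f) :
    BoundedUpTo μ f := fun ν hν => h ν (hν.trans le_self_add) fun h' => by
  have h1 := order_mono hν
  rw [h', order_add_unit] at h1
  omega

theorem BoundedUpTo.boundedBelow (h : BoundedUpTo μ f) : BoundedBelow μ f := fun ν hν _ => h ν hν

theorem multiDeriv_mul_add_unit (hf : SmoothOn f (halfBall d)) (hg : SmoothOn g (halfBall d))
    (ν : MultiIndex d) (i : Fin (d + 1)) :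
    EqOn (multiDeriv (ν + unitIndex i) fun y => f y * g y)
      (fun y => multiDeriv ν (fun y => DegenerateSystem.partialDeriv i f y * g y) y
        + multiDeriv ν (fun y => f y * DegenerateSystem.partialDeriv i g y) y) (halfBall d) := by
  have hU := isOpen_halfBall d
  refine (multiDeriv_partialDeriv hU (hf.mul hg) ν i).symm.trans ?_
  refine (multiDeriv_congr hU (partialDeriv_mul hU hf hg i) ν).trans ?_
  exact multiDeriv_add hU ((hf.partialDeriv hU i).mul hg) (hf.mul (hg.partialDeriv hU i)) ν

theorem boundedOn_multiDeriv_mul (hf : SmoothOn f (halfBall d)) (hg : SmoothOn g (halfBall d))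
    (h1 : BoundedUpTo μ f) (h2 : BoundedUpTo μ g) :
    BoundedOn (multiDeriv μ fun y => f y * g y) := by
  have hU := isOpen_halfBall d
  induction μ using multiIndex_induction generalizing f g with
  | zero =>
    rw [multiDeriv_zero]
    simpa [multiDeriv_zero] using (h1 0 le_rfl).mul (h2 0 le_rfl)
  | step ν i ih =>
    refine BoundedOn.congr ?_ (multiDeriv_mul_add_unit hf hg ν i).symm
    exact (ih (hf.partialDeriv hU i) hg (h1.partialDeriv hf) (h2.mono le_self_add)).add
      (ih hf (hg.partialDeriv hU i) (h1.mono le_self_add) (h2.partialDeriv hg))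

theorem BoundedBelow.boundedOn_partialDeriv {ν : MultiIndex d} {i : Fin (d + 1)}
    (hf : SmoothOn f (halfBall d)) (hν : ν ≠ 0) (h : BoundedBelow (ν + unitIndex i) f) :
    BoundedOn (DegenerateSystem.partialDeriv i f) := by
  refine (h (unitIndex i) le_add_self fun h' => hν ?_).congr
    (multiDeriv_unit (isOpen_halfBall d) hf i)
  exact (left_eq_add.1 (h'.trans (add_comm _ _)))

/-- The Leibniz rule, modulo bounded functions. -/
theorem boundedOn_leibniz (hμ : μ ≠ 0) (hf : SmoothOn f (halfBall d))
    (hg : SmoothOn g (halfBall d)) (h1 : BoundedBelow μ f) (h2 : BoundedBelow μ g) :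
    BoundedOn fun y => multiDeriv μ (fun y => f y * g y) y
      - (multiDeriv μ f y * g y + f y * multiDeriv μ g y) := by
  have hU := isOpen_halfBall d
  induction μ using multiIndex_induction generalizing f g with
  | zero => exact absurd rfl hμ
  | step ν i ih =>
    have e := multiDeriv_mul_add_unit hf hg ν i
    by_cases hν : ν = 0
    · subst hν
      refine (BoundedOn.const 0).congr fun y hy => ?_
      simp only [e hy]
      rw [zero_add, multiDeriv_unit hU hf i hy, multiDeriv_unit hU hg i hy]
      simp [multiDeriv_zero]
    · have f1 := hf.partialDeriv hU i
      have g1 := hg.partialDeriv hU i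
      have a1 := ih hν f1 hg (h1.partialDeriv hf) h2.boundedUpTo.boundedBelow
      have a2 := ih hν hf g1 h1.boundedUpTo.boundedBelow (h2.partialDeriv hg)
      have b1 := (h1.boundedOn_partialDeriv hf hν).mul (h2.boundedUpTo ν le_rfl)
      have b2 := (h1.boundedUpTo ν le_rfl).mul (h2.boundedOn_partialDeriv hg hν)
      refine ((a1.add a2).add (b1.add b2)).congr fun y hy => ?_
      simp only [e hy, ← multiDeriv_partialDeriv hU hf ν i hy,
        ← multiDeriv_partialDeriv hU hg ν i hy]
      ring

end Bounded

/-! ### Chain rule modulo bounded functions -/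

section Composition

variable {ι E : Type*} [Fintype ι] [NormedAddCommGroup E] [NormedSpace ℝ E]
  {B : E → ℝ} {O : Set E} {e : ι → E} {F : ι → Space d → ℝ} {μ : MultiIndex d}

theorem smoothOn_comp (hB : ContDiffOn ℝ (⊤ : ℕ∞) B O) (hF : ∀ a, SmoothOn (F a) (halfBall d))
    (hw : ∀ y ∈ halfBall d, ∑ a, F a y • e a ∈ O) :
    SmoothOn (fun y => B (∑ a, F a y • e a)) (halfBall d) :=
  hB.comp (ContDiffOn.sum fun a _ => (hF a).smul contDiffOn_const) hw

theorem smooth_fderiv_apply (hO : IsOpen O) (hB : ContDiffOn ℝ (⊤ : ℕ∞) B O) (v : E) :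
    ContDiffOn ℝ (⊤ : ℕ∞) (fun x => fderiv ℝ B x v) O :=
  (hB.fderiv_of_isOpen hO (m := (⊤ : ℕ∞)) (by simp)).clm_apply contDiffOn_const

theorem partialDeriv_comp (hO : IsOpen O) (hB : ContDiffOn ℝ (⊤ : ℕ∞) B O)
    (hF : ∀ a, SmoothOn (F a) (halfBall d)) (hw : ∀ y ∈ halfBall d, ∑ a, F a y • e a ∈ O)
    (i : Fin (d + 1)) :
    EqOn (partialDeriv i fun y => B (∑ a, F a y • e a))
      (fun y => ∑ a, fderiv ℝ B (∑ a, F a y • e a) (e a) * partialDeriv i (F a) y)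
      (halfBall d) := fun y hy => by
  have h1 : HasFDerivAt (fun y => ∑ a, F a y • e a)
      (∑ a, (fderiv ℝ (F a) y).smulRight (e a)) y :=
    HasFDerivAt.fun_sum fun a _ =>
      ((hF a).differentiableAt (isOpen_halfBall d) hy).hasFDerivAt.smul_const (e a)
  have h2 := ((hB.contDiffAt (hO.mem_nhds (hw y hy))).differentiableAt (by simp)).hasFDerivAt
  have h3 : HasFDerivAt (fun y => B (∑ a, F a y • e a)) _ y := h2.comp y h1
  rw [partialDeriv_apply, h3.fderiv]
  simp [partialDeriv_apply, mul_comm]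

/-- The values stay in a compact subset of the domain, on which B and its derivatives are bounded.
The induction on the order is over all smooth B, because the chain rule replaces B by its
derivatives. -/
theorem boundedOn_multiDeriv_comp {K : Set E} (hO : IsOpen O) (hK : IsCompact K) (hKO : K ⊆ O)
    (hF : ∀ a, SmoothOn (F a) (halfBall d)) (hw : ∀ y ∈ halfBall d, ∑ a, F a y • e a ∈ K)
    (hB : ContDiffOn ℝ (⊤ : ℕ∞) B O) (h : ∀ a, BoundedUpTo μ (F a)) :
    BoundedOn (multiDeriv μ fun y => B (∑ a, F a y • e a)) := by
  have hU := isOpen_halfBall d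
  have hwO : ∀ y ∈ halfBall d, ∑ a, F a y • e a ∈ O := fun y hy => hKO (hw y hy)
  induction hn : order μ using Nat.strong_induction_on generalizing μ B with
  | _ n ih =>
  rcases Nat.eq_zero_or_pos n with rfl | hpos
  · rw [eq_zero_of_order hn, multiDeriv_zero]
    obtain ⟨M, hM⟩ := hK.exists_bound_of_continuousOn (hB.continuousOn.mono hKO)
    exact ⟨M, fun y hy => hM _ (hw y hy)⟩
  · obtain ⟨k, rfl⟩ := Nat.exists_eq_succ_of_ne_zero hpos.ne'
    obtain ⟨ν, i, rfl, hν⟩ := exists_unit_of_order_succ hn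
    have hBa := fun a => smooth_fderiv_apply hO hB (e a)
    have hs := fun a => smoothOn_comp (hBa a) hF hwO
    refine BoundedOn.congr ?_ (((multiDeriv_congr hU (partialDeriv_comp hO hB hF hwO i) ν).trans
      (multiDeriv_sum hU _ (fun a _ => (hs a).mul ((hF a).partialDeriv hU i)) ν)).symm.trans
        (multiDeriv_partialDeriv hU (smoothOn_comp hB hF hwO) ν i))
    refine BoundedOn.sum _ fun a _ => boundedOn_multiDeriv_mul (hs a) ((hF a).partialDeriv hU i)
      (fun κ hκ => ?_) ((h a).partialDeriv (hF a))
    exact ih (order κ) (by have := order_mono hκ; omega) (hBa a)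
      (fun b => (h b).mono (hκ.trans le_self_add)) rfl

/-- The chain rule, modulo bounded functions. -/
theorem boundedOn_chain {K : Set E} (hO : IsOpen O) (hK : IsCompact K) (hKO : K ⊆ O)
    (hF : ∀ a, SmoothOn (F a) (halfBall d)) (hw : ∀ y ∈ halfBall d, ∑ a, F a y • e a ∈ K)
    (hB : ContDiffOn ℝ (⊤ : ℕ∞) B O) (hμ : μ ≠ 0) (h : ∀ a, BoundedBelow μ (F a)) :
    BoundedOn fun y => multiDeriv μ (fun y => B (∑ a, F a y • e a)) y
      - ∑ a, fderiv ℝ B (∑ a, F a y • e a) (e a) * multiDeriv μ (F a) y := by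
  have hU := isOpen_halfBall d
  have hwO : ∀ y ∈ halfBall d, ∑ a, F a y • e a ∈ O := fun y hy => hKO (hw y hy)
  obtain ⟨k, hk⟩ : ∃ k, order μ = k + 1 :=
    Nat.exists_eq_succ_of_ne_zero fun h => hμ (eq_zero_of_order h)
  obtain ⟨ν, i, rfl, hν⟩ := exists_unit_of_order_succ hk
  have hBa := fun a => smooth_fderiv_apply hO hB (e a)
  have hs := fun a => smoothOn_comp (hBa a) hF hwO
  have e1 := ((multiDeriv_congr hU (partialDeriv_comp hO hB hF hwO i) ν).trans
      (multiDeriv_sum hU _ (fun a _ => (hs a).mul ((hF a).partialDeriv hU i)) ν)).symm.trans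
        (multiDeriv_partialDeriv hU (smoothOn_comp hB hF hwO) ν i)
  by_cases hν0 : ν = 0
  · subst hν0
    refine (BoundedOn.const 0).congr fun y hy => ?_
    simp only [← e1 hy, multiDeriv_zero]
    rw [zero_add]
    simp only [multiDeriv_unit hU (hF _) i hy, sub_self]
  · have hB' : ∀ a, BoundedUpTo ν fun y => fderiv ℝ B (∑ a, F a y • e a) (e a) := fun a κ hκ =>
      boundedOn_multiDeriv_comp hO hK hKO hF hw (hBa a) fun b => (h b).boundedUpTo.mono hκ
    have key := BoundedOn.sum Finset.univ fun a _ =>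
      (boundedOn_leibniz hν0 (hs a) ((hF a).partialDeriv hU i) (hB' a).boundedBelow
        ((h a).partialDeriv (hF a))).add
        ((hB' a ν le_rfl).mul ((h a).boundedOn_partialDeriv (hF a) hν0))
    refine key.congr fun y hy => ?_
    simp only [← e1 hy]
    rw [← Finset.sum_sub_distrib]
    refine Finset.sum_congr rfl fun a _ => ?_
    rw [← multiDeriv_partialDeriv hU (hF a) ν i hy]
    ring

end Composition

end DegenerateSystem

/-! ### Boundedness of all derivatives up to the flat boundary -/

namespace DegenerateSystem
open Set Filter Topology

variable {d m : ℕ}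

/-- The weight of a multi-index, normal derivatives counted twice. -/
def level (μ : MultiIndex d) : ℕ := order μ + μ (Fin.last d)

theorem level_add_tangential (μ : MultiIndex d) {l : Fin (d + 1)} (hl : l ≠ Fin.last d) :
    level (μ + unitIndex l) = level μ + 1 := by
  simp only [level, order_add_unit, Pi.add_apply, unitIndex_ne (Ne.symm hl)]
  omega

theorem level_add_normal (μ : MultiIndex d) :
    level (μ + unitIndex (Fin.last d)) = level μ + 2 := by
  simp only [level, order_add_unit, Pi.add_apply, unitIndex_self]
  omega

/-- `∂^μ f` and `y_n ∂_n ∂^μ f` are bounded. -/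
def WeightedBounded (μ : MultiIndex d) (f : Space d → ℝ) : Prop :=
  BoundedOn (multiDeriv μ f) ∧
    BoundedOn fun y => normalCoord y * partialDeriv (Fin.last d) (multiDeriv μ f) y

variable {f : Space d → ℝ}

theorem multiDeriv_partialDeriv_swap (hf : SmoothOn f (halfBall d)) (ν : MultiIndex d)
    (i l : Fin (d + 1)) :
    EqOn (multiDeriv (ν + unitIndex i) (partialDeriv l f))
      (multiDeriv (ν + unitIndex l) (partialDeriv i f)) (halfBall d) := by
  have hU := isOpen_halfBall d
  have := (multiDeriv_partialDeriv hU hf (ν + unitIndex l) i).symm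
  rw [add_right_comm] at this
  exact (multiDeriv_partialDeriv hU hf (ν + unitIndex i) l).trans this

theorem WeightedBounded.swap (hf : SmoothOn f (halfBall d)) {ν : MultiIndex d}
    {i l : Fin (d + 1)} (h : WeightedBounded (ν + unitIndex l) (partialDeriv i f)) :
    WeightedBounded (ν + unitIndex i) (partialDeriv l f) := by
  have e := multiDeriv_partialDeriv_swap hf ν l i
  refine ⟨h.1.congr e, h.2.congr fun y hy => ?_⟩
  simp only [partialDeriv_congr (isOpen_halfBall d) e _ hy]

/-- If κ = ν + e_n, then ∂^κ ∂_l = ∂^{ν + e_l} ∂_n, and the level drops from level ν + 2 to level ν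
+ 1. At each level only the derivatives of ∂_n v are therefore new. -/
theorem WeightedBounded.of_lower (hf : SmoothOn f (halfBall d)) {κ : MultiIndex d}
    (hlow : ∀ ν : MultiIndex d, level ν < level κ → ∀ i, WeightedBounded ν (partialDeriv i f))
    (htan : ∀ ν : MultiIndex d, ν (Fin.last d) = 0 → ∀ i, WeightedBounded ν (partialDeriv i f))
    {l : Fin (d + 1)} (hl : l ≠ Fin.last d) : WeightedBounded κ (partialDeriv l f) := by
  by_cases hκ : κ (Fin.last d) = 0
  · exact htan κ hκ l
  · obtain ⟨ν, rfl⟩ := exists_sub_unit hκ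
    refine WeightedBounded.swap hf (hlow _ ?_ _)
    rw [level_add_normal, level_add_tangential ν hl]
    omega

theorem boundedOn_weighted_normal {i : Fin (d + 1)} (hf : SmoothOn f (halfBall d))
    {κ : MultiIndex d} (h : WeightedBounded κ (partialDeriv i f)) :
    BoundedOn (multiDeriv κ fun y => normalCoord y *
      partialDeriv (Fin.last d) (partialDeriv i f) y) :=
  (h.2.add ((BoundedOn.const _).mul h.1)).congr
    (multiDeriv_weighted_normal (hf.partialDeriv (isOpen_halfBall d) i) κ).symm

/-- Weighted second derivatives other than the purely normal one are controlled by lower levels. -/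
theorem boundedOn_weighted_second (hf : SmoothOn f (halfBall d)) {κ : MultiIndex d}
    (hlow : ∀ ν : MultiIndex d, level ν < level κ → ∀ i, WeightedBounded ν (partialDeriv i f))
    (htan : ∀ ν : MultiIndex d, ν (Fin.last d) = 0 → ∀ i, WeightedBounded ν (partialDeriv i f))
    {k l : Fin (d + 1)} (hkl : ¬(k = Fin.last d ∧ l = Fin.last d)) :
    BoundedOn (multiDeriv κ fun y => normalCoord y * partialDeriv k (partialDeriv l f) y) := by
  have hU := isOpen_halfBall d
  by_cases hk : k = Fin.last d
  · subst hk
    exact boundedOn_weighted_normal hf (WeightedBounded.of_lower hf hlow htan fun hl => hkl ⟨rfl, hl⟩)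
  by_cases hl : l = Fin.last d
  · subst hl
    refine (boundedOn_weighted_normal hf (WeightedBounded.of_lower hf hlow htan hk)).congr
      (multiDeriv_congr hU (fun y hy => ?_) κ)
    simp only [partialDeriv_comm hU hf _ k hy]
  by_cases hκ : κ (Fin.last d) = 0
  · exact (boundedOn_normalCoord.mul (htan _ (add_unit_last hκ hk) l).1).congr
      (multiDeriv_weighted_of_tangential (hf.partialDeriv hU l) hκ k).symm
  · obtain ⟨ν, rfl⟩ := exists_sub_unit hκ
    have h := hlow (ν + unitIndex k)
      (by rw [level_add_normal, level_add_tangential ν hk]; omega) l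
    exact (h.2.add ((BoundedOn.const _).mul h.1)).congr
      (multiDeriv_weighted_tangential (hf.partialDeriv hU l) ν k).symm

/-- The coefficient of `∂^μ ∂_n v^i` in the differentiated `j`-th equation that is due to the
nonlinearity. -/
noncomputable def nonlinearCoeff (A : Fin m → Fin (d + 1) → Fin (d + 1) → Grad d m → ℝ)
    (g : Fin m → State d m → ℝ) (V : Fin m → Space d → ℝ) (j i : Fin m) (y : Space d) : ℝ :=
  (∑ k, ∑ l, fderiv ℝ (fun x : State d m => A j k l x.2) (jet V y)
      (stateBasis (Sum.inr (i, Fin.last d))) *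
      (normalCoord y * partialDeriv k (partialDeriv l (V j)) y))
    + fderiv ℝ (g j) (jet V y) (stateBasis (Sum.inr (i, Fin.last d)))

theorem smoothOn_comps {V : Fin m → Space d → ℝ} (hV : ∀ j, SmoothOn (V j) (halfBall d))
    (a : StateIndex d m) : SmoothOn (comps V a) (halfBall d) := by
  rcases a with j | ⟨j, i⟩
  · exact hV j
  · exact (hV j).partialDeriv (isOpen_halfBall d) i

/-- An energy estimate for Fuchsian systems along the normal rays. -/
theorem fuchsian_system_bound {U E : Fin m → Space d → ℝ} {a : Fin m → Space d → ℝ}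
    {b : Fin m → Fin m → Space d → ℝ} {γ : Fin m → ℝ} (hγ : ∀ j, 1 < γ j) {k : ℝ} (hk : 1 ≤ k)
    (hU : ∀ j, SmoothOn (U j) (halfBall d))
    (ha : ∀ j, ∀ y ∈ halfBall d, |a j y| ≤ 1 / 2)
    (hb : ∀ j i, ∀ y ∈ halfBall d, |b j i y| * (24 * m) ≤ 1)
    (hE : ∀ j, BoundedOn (E j))
    (hEq : ∀ j, ∀ y ∈ halfBall d,
      (1 - a j y) * (normalCoord y * partialDeriv (Fin.last d) (U j) y + k * U j y) + γ j * U j y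
        - ∑ i, b j i y * U i y = E j y)
    (htU : ∀ j, BoundedOn fun y => normalCoord y * U j y) (j : Fin m) : BoundedOn (U j) := by
  choose M hM using hE
  choose N hN using htU
  have ho := isOpen_halfBall d
  set S : Space d → ℝ := fun y => ∑ j, U j y * U j y with hS
  have hSs : SmoothOn S (halfBall d) := ContDiffOn.sum fun j _ => (hU j).mul (hU j)
  have hSd : ∀ y ∈ halfBall d, partialDeriv (Fin.last d) S y
      = ∑ j, 2 * U j y * partialDeriv (Fin.last d) (U j) y := fun y hy => by
    have h1 := multiDeriv_sum ho Finset.univ (fun j _ => (hU j).mul (hU j))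
      (unitIndex (Fin.last d)) hy
    rw [multiDeriv_unit ho hSs _ hy] at h1
    rw [h1]
    refine Finset.sum_congr rfl fun j _ => ?_
    rw [multiDeriv_unit ho ((hU j).mul (hU j)) _ hy, partialDeriv_mul ho (hU j) (hU j) _ hy]
    ring
  -- In the equation solved for y_n ∂_n U_j the damping contributes 2k + 2cγ_j ≥ 2 + 4/3 with c = 1
  -- / (1 - a) ≥ 2/3. After the exponent 3 is split off, 1/3 of U_j² is left. One half of it absorbs
  -- the error E_j at the price 24 M_j², and the other half absorbs the coupling, which is why |b|
  -- has to be below 1 / (24 m).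
  have hkey : ∀ y ∈ halfBall d,
      normalCoord y * partialDeriv (Fin.last d) S y + 3 * S y ≤ ∑ j, 24 * M j ^ 2 := by
    intro y hy
    have h1 : ∀ j, 2 * U j y * (normalCoord y * partialDeriv (Fin.last d) (U j) y)
        + 3 * (U j y * U j y)
        ≤ 24 * M j ^ 2 - 1 / 6 * (U j y * U j y)
          + 4 * |U j y| * ∑ i, |b j i y| * |U i y| := by
      intro j
      have e := hEq j y hy
      obtain ⟨ha1, ha2⟩ := abs_le.1 (ha j y hy)
      set u := U j y
      set w := normalCoord y * partialDeriv (Fin.last d) (U j) y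
      set c := (1 - a j y)⁻¹ with hc
      have hca : c * (1 - a j y) = 1 := inv_mul_cancel₀ (by linarith)
      have hc1 : 2 / 3 ≤ c := by
        rw [hc, le_inv_comm₀ (by norm_num) (by linarith)]; norm_num; linarith
      have hc2 : c ≤ 2 := by
        rw [hc, inv_le_comm₀ (by linarith) (by norm_num)]; norm_num; linarith
      have hw : w = -k * u + c * (E j y - γ j * u + ∑ i, b j i y * U i y) := by
        linear_combination c * e - (w + k * u) * hca
      have hs : |∑ i, b j i y * U i y| ≤ ∑ i, |b j i y| * |U i y| :=
        (Finset.abs_sum_le_sum_abs _ _).trans_eq (Finset.sum_congr rfl fun i _ => abs_mul _ _)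
      set s := ∑ i, b j i y * U i y
      set s' := ∑ i, |b j i y| * |U i y|
      have hM2 : E j y ^ 2 ≤ M j ^ 2 := sq_le_sq' (abs_le.1 (hM j y hy)).1 (abs_le.1 (hM j y hy)).2
      have h3 : 2 * c * (u * s) ≤ 4 * |u| * s' := by
        have : u * s ≤ |u| * s' := (le_abs_self _).trans ((abs_mul u s).trans_le
          (mul_le_mul_of_nonneg_left hs (abs_nonneg u)))
        have h0 : 0 ≤ |u| * s' := mul_nonneg (abs_nonneg u) ((abs_nonneg s).trans hs)
        nlinarith
      have h4 : 2 * c * (u * E j y) ≤ 1 / 6 * u ^ 2 + 24 * E j y ^ 2 := by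
        have h5 : u * E j y ≤ |u| * |E j y| := (le_abs_self _).trans (abs_mul _ _).le
        have h6 : 0 ≤ |u| * |E j y| := by positivity
        have h7 : 2 * c * (u * E j y) ≤ 4 * (|u| * |E j y|) := by nlinarith
        have h8 : 0 ≤ (1 / 6 : ℝ) * (|u| - 12 * |E j y|) ^ 2 := by positivity
        rw [← sq_abs u, ← sq_abs (E j y)]
        linarith
      have h9 : 4 / 3 * u ^ 2 ≤ 2 * c * γ j * u ^ 2 := by
        have : 2 / 3 ≤ c * γ j := by nlinarith [hγ j]
        nlinarith [sq_nonneg u]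
      have h10 : 2 * u ^ 2 ≤ 2 * k * u ^ 2 := by nlinarith [sq_nonneg u]
      rw [hw]
      linarith
    have h2 : ∑ j, 4 * |U j y| * ∑ i, |b j i y| * |U i y| ≤ 1 / 6 * S y := by
      have hm : ∀ j i, 4 * |U j y| * (|b j i y| * |U i y|) * m
          ≤ 1 / 12 * (U j y * U j y + U i y * U i y) := fun j i => by
        have h3 := hb j i y hy
        have h4 : 0 ≤ |U j y| * |U i y| := by positivity
        have h5 := mul_le_mul_of_nonneg_left h3 h4
        have h6 : 2 * (|U j y| * |U i y|) ≤ U j y * U j y + U i y * U i y := by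
          have := two_mul_le_add_sq (|U j y|) (|U i y|)
          rw [sq_abs, sq_abs] at this
          linarith
        linarith
      rcases Nat.eq_zero_or_pos m with rfl | hm0
      · simp [hS]
      have hm0' : (0 : ℝ) < m := by exact_mod_cast hm0
      refine le_of_mul_le_mul_right ?_ hm0'
      simp only [Finset.mul_sum, Finset.sum_mul]
      refine (Finset.sum_le_sum fun j _ => Finset.sum_le_sum fun i _ => hm j i).trans_eq ?_
      simp only [mul_add, Finset.sum_add_distrib, Finset.sum_const, Finset.card_univ,
        Fintype.card_fin, nsmul_eq_mul, ← Finset.mul_sum, hS]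
      ring
    rw [hSd y hy, Finset.mul_sum, hS]
    have h3 := Finset.sum_le_sum fun j (_ : j ∈ Finset.univ) => h1 j
    simp only [Finset.sum_add_distrib, Finset.sum_sub_distrib, ← Finset.mul_sum] at h3 h2 ⊢
    have e : ∑ j, 2 * U j y * (normalCoord y * partialDeriv (Fin.last d) (U j) y)
        = ∑ j, normalCoord y * (2 * U j y * partialDeriv (Fin.last d) (U j) y) :=
      Finset.sum_congr rfl fun j _ => by ring
    rw [e] at h3
    simp only [hS, ← Finset.mul_sum] at h2 h3 ⊢
    linarith
  -- Boundedness of y_n U_j only allows S to grow like y_n^{-2}. Since 2 < 3, the comparison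
  -- principle applies.
  have hSb : ∀ y ∈ halfBall d, S y ≤ (∑ j, N j ^ 2) * normalCoord y ^ (-2 : ℝ) := by
    intro y hy
    have ht := normalCoord_pos hy
    rw [Real.rpow_neg ht.le, ← div_eq_mul_inv, le_div_iff₀ (Real.rpow_pos_of_pos ht _)]
    rw [show (2 : ℝ) = ((2 : ℕ) : ℝ) by norm_num, Real.rpow_natCast, hS, Finset.sum_mul]
    refine Finset.sum_le_sum fun j _ => ?_
    have := sq_le_sq' (abs_le.1 (hN j y hy)).1 (abs_le.1 (hN j y hy)).2
    linarith
  refine ⟨√((∑ j, 24 * M j ^ 2) / 3), fun y hy => ?_⟩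
  have h := normal_fuchsian_bound hSs (by norm_num) (by norm_num : (0 : ℝ) < 3) hkey hSb hy
  refine Real.le_sqrt_of_sq_le (le_trans ?_ h)
  rw [sq_abs, sq]
  exact Finset.single_le_sum (f := fun j => U j y * U j y) (fun i _ => mul_self_nonneg _)
    (Finset.mem_univ j)

theorem level_lt_of_lt {κ μ : MultiIndex d} (h : κ ≤ μ) (hne : κ ≠ μ) : level κ < level μ := by
  have h1 : order κ < order μ :=
    Finset.sum_lt_sum (fun i _ => h i) (by
      by_contra! hc
      exact hne (le_antisymm h fun i => hc i (Finset.mem_univ i)))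
  have h2 : κ (Fin.last d) ≤ μ (Fin.last d) := h _
  simp only [level]
  omega

theorem level_lt_add_unit (μ : MultiIndex d) (i : Fin (d + 1)) :
    level μ < level (μ + unitIndex i) :=
  level_lt_of_lt le_self_add (ne_add_unit μ i)

/-- A nontrivial derivative of f is a derivative of ∇f of strictly lower level, so v itself never
enters at top level. -/
theorem boundedOn_multiDeriv_of_lower {L : ℕ} (hf : SmoothOn f (halfBall d)) (hf0 : BoundedOn f)
    (hlow : ∀ ν : MultiIndex d, level ν < L → ∀ i, WeightedBounded ν (partialDeriv i f))
    {κ : MultiIndex d} (hκ : level κ ≤ L) : BoundedOn (multiDeriv κ f) := by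
  induction κ using multiIndex_induction with
  | zero => rwa [multiDeriv_zero]
  | step ν i _ =>
    exact (hlow ν ((level_lt_add_unit ν i).trans_le hκ) i).1.congr
      (multiDeriv_partialDeriv (isOpen_halfBall d) hf ν i)

/-- The chain rule for functions of `(v, ∇v)`: modulo bounded terms, only the derivatives of
`∂_n v` of the highest level remain. -/
theorem boundedOn_chain_jet {B : State d m → ℝ} {ρ ρ₀ : ℝ} (hρ : ρ₀ < ρ)
    (hB : ContDiffOn ℝ (⊤ : ℕ∞) B (Metric.ball 0 ρ))
    {V : Fin m → Space d → ℝ} (hV : ∀ j, SmoothOn (V j) (halfBall d))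
    (hjet : ∀ y ∈ halfBall d, jet V y ∈ Metric.closedBall (0 : State d m) ρ₀)
    (hV0 : ∀ j, BoundedOn (V j))
    (htan : ∀ j (ν : MultiIndex d), ν (Fin.last d) = 0 → ∀ i,
      WeightedBounded ν (partialDeriv i (V j)))
    {μ : MultiIndex d} (hμ : μ ≠ 0)
    (hlow : ∀ j (ν : MultiIndex d), level ν < level μ → ∀ i,
      WeightedBounded ν (partialDeriv i (V j))) :
    BoundedBelow μ (fun y => B (jet V y)) ∧
    BoundedOn fun y => multiDeriv μ (fun y => B (jet V y)) y
      - ∑ i, fderiv ℝ B (jet V y) (stateBasis (Sum.inr (i, Fin.last d)))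
        * multiDeriv μ (partialDeriv (Fin.last d) (V i)) y := by
  have hK : IsCompact (Metric.closedBall (0 : State d m) ρ₀) := isCompact_closedBall _ _
  have hKO := Metric.closedBall_subset_ball hρ (x := (0 : State d m))
  have hF := smoothOn_comps hV
  have hbel : ∀ a, BoundedBelow μ (comps V a) := by
    rintro (j | ⟨j, i⟩) κ hκ hne
    · exact boundedOn_multiDeriv_of_lower (hV j) (hV0 j) (hlow j) (level_lt_of_lt hκ hne).le
    · exact (hlow j κ (level_lt_of_lt hκ hne) i).1
  refine ⟨fun κ hκ hne => boundedOn_multiDeriv_comp Metric.isOpen_ball hK hKO hF hjet hB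
    fun a ν hν => hbel a ν (hν.trans hκ) fun h => hne (le_antisymm hκ (h ▸ hν)), ?_⟩
  have h1 := boundedOn_chain Metric.isOpen_ball hK hKO hF hjet hB hμ hbel
  have hD : ∀ a, BoundedOn fun y => fderiv ℝ B (jet V y) (stateBasis a) := fun a => by
    obtain ⟨M, hM⟩ := hK.exists_bound_of_continuousOn
      ((smooth_fderiv_apply Metric.isOpen_ball hB (stateBasis a)).continuousOn.mono hKO)
    exact ⟨M, fun y hy => hM _ (hjet y hy)⟩
  -- The chain rule terms with derivatives of v, and below those of tangential derivatives of v, are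
  -- already bounded. They go into the error and leave only ∂_n v.
  have h2 : BoundedOn fun y =>
      ∑ j, fderiv ℝ B (jet V y) (stateBasis (Sum.inl j)) * multiDeriv μ (V j) y :=
    BoundedOn.sum _ fun j _ => (hD _).mul
      (boundedOn_multiDeriv_of_lower (hV j) (hV0 j) (hlow j) le_rfl)
  have h3 : BoundedOn fun y => ∑ j, ∑ l : Fin d,
      fderiv ℝ B (jet V y) (stateBasis (Sum.inr (j, l.castSucc)))
        * multiDeriv μ (partialDeriv l.castSucc (V j)) y :=
    BoundedOn.sum _ fun j _ => BoundedOn.sum _ fun l _ => (hD _).mul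
      (WeightedBounded.of_lower (hV j) (hlow j) (htan j) (Fin.castSucc_lt_last l).ne).1
  refine (h1.add (h2.add h3)).congr fun y _ => ?_
  simp only [Fintype.sum_sum_type, Fintype.sum_prod_type, Fin.sum_univ_castSucc,
    Finset.sum_add_distrib]
  simp only [jet, ofComps, comps, Sum.elim_inl, Sum.elim_inr, Fintype.sum_sum_type,
    Fintype.sum_prod_type, Fin.sum_univ_castSucc, Finset.sum_add_distrib]
  ring

/-- The differentiated equation, modulo bounded terms. -/
theorem boundedOn_differentiated_equation {γ : Fin m → ℝ}
    {A : Fin m → Fin (d + 1) → Fin (d + 1) → Grad d m → ℝ}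
    {g : Fin m → State d m → ℝ} {ρ ρ₀ : ℝ} (hc : CoeffSmooth A g ρ) (hρ : ρ₀ < ρ)
    {V : Fin m → Space d → ℝ} (hV : ∀ j, SmoothOn (V j) (halfBall d))
    (hsol : ClassicalSolution γ A g V)
    (hjet : ∀ y ∈ halfBall d, jet V y ∈ Metric.closedBall (0 : State d m) ρ₀)
    (hV0 : ∀ j, BoundedOn (V j))
    (htan : ∀ j (ν : MultiIndex d), ν (Fin.last d) = 0 → ∀ i,
      WeightedBounded ν (partialDeriv i (V j)))
    {μ : MultiIndex d} (hμ : μ ≠ 0)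
    (hlow : ∀ j (ν : MultiIndex d), level ν < level μ → ∀ i,
      WeightedBounded ν (partialDeriv i (V j))) (j : Fin m) :
    BoundedOn fun y =>
      (1 - A j (Fin.last d) (Fin.last d) (jet V y).2) *
        (normalCoord y *
            partialDeriv (Fin.last d) (multiDeriv μ (partialDeriv (Fin.last d) (V j))) y
          + (μ (Fin.last d) : ℝ) * multiDeriv μ (partialDeriv (Fin.last d) (V j)) y)
      + γ j * multiDeriv μ (partialDeriv (Fin.last d) (V j)) y
      - ∑ i, nonlinearCoeff A g V j i y * multiDeriv μ (partialDeriv (Fin.last d) (V i)) y := by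
  have hU := isOpen_halfBall d
  have hdist : ∀ k l, BoundedBelow μ fun y =>
      normalCoord y * partialDeriv k (partialDeriv l (V j)) y := fun k l κ hκ hne => by
    have hlt := level_lt_of_lt hκ hne
    by_cases hkl : k = Fin.last d ∧ l = Fin.last d
    · rw [hkl.1, hkl.2]
      exact boundedOn_weighted_normal (hV j) (hlow j κ hlt _)
    · exact boundedOn_weighted_second (hV j) (fun ν hν => hlow j ν (hν.trans hlt)) (htan j) hkl
  have hA := fun k l => boundedOn_chain_jet hρ (hc.A_smooth j k l) hV hjet hV0 htan hμ hlow
  have hg := boundedOn_chain_jet hρ (hc.g_smooth j) hV hjet hV0 htan hμ hlow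
  have hjO : ∀ y ∈ halfBall d, ∑ a, comps V a y • stateBasis a ∈ Metric.ball (0 : State d m) ρ :=
    fun y hy => Metric.closedBall_subset_ball hρ (hjet y hy)
  have hAs : ∀ k l, SmoothOn (fun y => A j k l (jet V y).2) (halfBall d) := fun k l =>
    smoothOn_comp (hc.A_smooth j k l) (smoothOn_comps hV) hjO
  have hgs : SmoothOn (fun y => g j (jet V y)) (halfBall d) :=
    smoothOn_comp (hc.g_smooth j) (smoothOn_comps hV) hjO
  have hp : ∀ k l, SmoothOn (partialDeriv k (partialDeriv l (V j))) (halfBall d) := fun k l =>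
    ((hV j).partialDeriv hU l).partialDeriv hU k
  have hZs : ∀ k l, SmoothOn (fun y => normalCoord y * partialDeriv k (partialDeriv l (V j)) y)
      (halfBall d) := fun k l => (smoothOn_normalCoord _).mul (hp k l)
  have hu := (hV j).partialDeriv hU (Fin.last d)
  -- the two sides of the differentiated equation
  have heq : EqOn (fun y => normalCoord y *
        partialDeriv (Fin.last d) (partialDeriv (Fin.last d) (V j)) y
        + γ j * partialDeriv (Fin.last d) (V j) y)
      (fun y => ∑ k, ∑ l, A j k l (jet V y).2 *
        (normalCoord y * partialDeriv k (partialDeriv l (V j)) y) + g j (jet V y))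
      (halfBall d) := fun y hy => by
    refine (hsol j y hy).trans ?_
    simp only [Finset.mul_sum]
    congr 1
    exact Finset.sum_congr rfl fun k _ => Finset.sum_congr rfl fun l _ => by ring
  have hL := (multiDeriv_add hU (hZs (Fin.last d) (Fin.last d))
    ((contDiffOn_const (c := γ j)).mul hu) μ)
  have hR := multiDeriv_add hU (ContDiffOn.sum fun k (_ : k ∈ Finset.univ) =>
    ContDiffOn.sum fun l (_ : l ∈ Finset.univ) => (hAs k l).mul (hZs k l)) hgs μ
  have key : EqOn (fun y => normalCoord y *
        partialDeriv (Fin.last d) (multiDeriv μ (partialDeriv (Fin.last d) (V j))) y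
        + (μ (Fin.last d) : ℝ) * multiDeriv μ (partialDeriv (Fin.last d) (V j)) y
        + γ j * multiDeriv μ (partialDeriv (Fin.last d) (V j)) y)
      (fun y => ∑ k, ∑ l, multiDeriv μ (fun y => A j k l (jet V y).2 *
        (normalCoord y * partialDeriv k (partialDeriv l (V j)) y)) y
        + multiDeriv μ (fun y => g j (jet V y)) y) (halfBall d) := fun y hy => by
    have h := multiDeriv_congr hU heq μ hy
    rw [hL hy, hR hy] at h
    beta_reduce at h
    rw [multiDeriv_weighted_normal hu μ hy, multiDeriv_const_mul hU hu _ _ hy,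
      multiDeriv_sum hU _ (fun k _ => ContDiffOn.sum fun l (_ : l ∈ Finset.univ) =>
        (hAs k l).mul (hZs k l)) μ hy] at h
    refine h.trans ?_
    congr 1
    exact Finset.sum_congr rfl fun k _ =>
      multiDeriv_sum hU _ (fun l _ => (hAs k l).mul (hZs k l)) μ hy
  -- In each product only the two extreme Leibniz terms can be unbounded. All derivatives on A give
  -- a coefficient times ∂^μ ∂_n v. All derivatives on the weighted second derivative matter only
  -- for k = l = n, where they modify the principal part.
  have hterm : ∀ k l, BoundedOn fun y => multiDeriv μ (fun y => A j k l (jet V y).2 *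
        (normalCoord y * partialDeriv k (partialDeriv l (V j)) y)) y
      - (∑ i, fderiv ℝ (fun x : State d m => A j k l x.2) (jet V y)
          (stateBasis (Sum.inr (i, Fin.last d))) *
          (normalCoord y * partialDeriv k (partialDeriv l (V j)) y)
          * multiDeriv μ (partialDeriv (Fin.last d) (V i)) y)
      - (if k = Fin.last d then if l = Fin.last d then A j (Fin.last d) (Fin.last d) (jet V y).2 *
        (normalCoord y *
            partialDeriv (Fin.last d) (multiDeriv μ (partialDeriv (Fin.last d) (V j))) y
          + (μ (Fin.last d) : ℝ) * multiDeriv μ (partialDeriv (Fin.last d) (V j)) y)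
          else 0 else 0) := fun k l => by
    have h1 := boundedOn_leibniz hμ (hAs k l) (hZs k l) (hA k l).1 (hdist k l)
    have h0 : BoundedOn fun y => normalCoord y * partialDeriv k (partialDeriv l (V j)) y := by
      simpa [multiDeriv_zero] using hdist k l 0 (fun _ => Nat.zero_le _) (Ne.symm hμ)
    have h2 := (hA k l).2.mul h0
    by_cases hkl : k = Fin.last d ∧ l = Fin.last d
    · obtain ⟨rfl, rfl⟩ := hkl
      refine (h1.add h2).congr fun y hy => ?_
      simp only [if_true]
      rw [multiDeriv_weighted_normal hu μ hy, sub_mul, Finset.sum_mul,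
        Finset.sum_congr rfl fun i _ => mul_right_comm _ _ _]
      ring
    · have h3 : BoundedOn fun y => A j k l (jet V y).2 := by
        have := (hA k l).1 0 (fun _ => Nat.zero_le _) (Ne.symm hμ)
        rwa [multiDeriv_zero] at this
      have h4 := h3.mul (boundedOn_weighted_second (hV j) (hlow j) (htan j) hkl)
      refine ((h1.add h2).add h4).congr fun y hy => ?_
      have : (if k = Fin.last d then if l = Fin.last d then
          A j (Fin.last d) (Fin.last d) (jet V y).2 * (normalCoord y *
            partialDeriv (Fin.last d) (multiDeriv μ (partialDeriv (Fin.last d) (V j))) y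
          + (μ (Fin.last d) : ℝ) * multiDeriv μ (partialDeriv (Fin.last d) (V j)) y)
          else 0 else 0) = 0 := by
        by_cases hk : k = Fin.last d
        · rw [if_pos hk, if_neg fun hl => hkl ⟨hk, hl⟩]
        · rw [if_neg hk]
      rw [this]
      beta_reduce
      rw [sub_mul, Finset.sum_mul, Finset.sum_congr rfl fun i _ => mul_right_comm _ _ _]
      ring
  refine ((BoundedOn.sum Finset.univ fun k _ => BoundedOn.sum Finset.univ fun l _ =>
    hterm k l).add hg.2).congr fun y hy => ?_
  have hk := key hy
  simp only [Finset.sum_sub_distrib, Finset.sum_ite_eq', Finset.mem_univ, if_true,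
    Finset.sum_const_zero, Finset.sum_ite_irrel] at hk ⊢
  have e : ∑ i, nonlinearCoeff A g V j i y * multiDeriv μ (partialDeriv (Fin.last d) (V i)) y
      = (∑ k, ∑ l, ∑ i, fderiv ℝ (fun x : State d m => A j k l x.2) (jet V y)
          (stateBasis (Sum.inr (i, Fin.last d))) *
          (normalCoord y * partialDeriv k (partialDeriv l (V j)) y)
          * multiDeriv μ (partialDeriv (Fin.last d) (V i)) y)
        + ∑ i, fderiv ℝ (g j) (jet V y) (stateBasis (Sum.inr (i, Fin.last d)))
          * multiDeriv μ (partialDeriv (Fin.last d) (V i)) y := by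
    simp only [nonlinearCoeff, add_mul, Finset.sum_add_distrib, Finset.sum_mul]
    congr 1
    rw [Finset.sum_comm]
    exact Finset.sum_congr rfl fun k _ => Finset.sum_comm
  rw [e]
  linarith

/-- All derivatives of the gradient of a small solution are bounded. -/
theorem weightedBounded_of_solution {γ : Fin m → ℝ} (hγ : ∀ j, 1 < γ j)
    {A : Fin m → Fin (d + 1) → Fin (d + 1) → Grad d m → ℝ}
    {g : Fin m → State d m → ℝ} {ρ ρ₀ : ℝ} (hc : CoeffSmooth A g ρ) (hρ : ρ₀ < ρ)
    {V : Fin m → Space d → ℝ} (hV : ∀ j, SmoothOn (V j) (halfBall d))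
    (hsol : ClassicalSolution γ A g V)
    (hjet : ∀ y ∈ halfBall d, jet V y ∈ Metric.closedBall (0 : State d m) ρ₀)
    (hV0 : ∀ j, BoundedOn (V j))
    (htan : ∀ j (ν : MultiIndex d), ν (Fin.last d) = 0 → ∀ i,
      WeightedBounded ν (partialDeriv i (V j)))
    (ha : ∀ j, ∀ y ∈ halfBall d, |A j (Fin.last d) (Fin.last d) (jet V y).2| ≤ 1 / 2)
    (hb : ∀ j i, ∀ y ∈ halfBall d, |nonlinearCoeff A g V j i y| * (24 * m) ≤ 1)
    (μ : MultiIndex d) (j : Fin m) (i : Fin (d + 1)) :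
    WeightedBounded μ (partialDeriv i (V j)) := by
  have hU := isOpen_halfBall d
  induction hL : level μ using Nat.strong_induction_on generalizing μ j i with
  | _ L ih =>
  subst hL
  have hlow : ∀ j (ν : MultiIndex d), level ν < level μ → ∀ i,
      WeightedBounded ν (partialDeriv i (V j)) := fun j ν hν i => ih _ hν ν j i rfl
  by_cases hμ0 : μ (Fin.last d) = 0
  · exact htan j μ hμ0 i
  by_cases hi : i ≠ Fin.last d
  · exact WeightedBounded.of_lower (hV j) (hlow j) (htan j) hi
  rw [not_not] at hi
  subst hi
  have hμ : μ ≠ 0 := fun h => hμ0 (by rw [h]; rfl)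
  have hs : ∀ j, SmoothOn (multiDeriv μ (partialDeriv (Fin.last d) (V j))) (halfBall d) := fun j =>
    multiDeriv_smooth hU ((hV j).partialDeriv hU _) μ
  have hE := boundedOn_differentiated_equation hc hρ hV hsol hjet hV0 htan hμ hlow
  have hk : (1 : ℝ) ≤ μ (Fin.last d) := by exact_mod_cast Nat.one_le_iff_ne_zero.2 hμ0
  obtain ⟨ν, hν⟩ := exists_sub_unit hμ0
  -- The growth bound required by the energy estimate comes from the lower index ν = μ - e_n: there
  -- y_n ∂_n ∂^ν ∂_n v = y_n ∂^μ ∂_n v is bounded by induction.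
  have hB : ∀ j, BoundedOn (multiDeriv μ (partialDeriv (Fin.last d) (V j))) :=
    fuchsian_system_bound hγ hk hs ha hb hE (fun _ _ _ => rfl) fun j => by
      refine (hlow j ν (by rw [hν]; exact level_lt_add_unit ν _) (Fin.last d)).2.congr
        fun y hy => ?_
      simp only [hν, multiDeriv_add_unit hU ((hV j).partialDeriv hU _) ν _ hy]
  refine ⟨hB j, ?_⟩
  have hbB : ∀ i, BoundedOn fun y => nonlinearCoeff A g V j i y *
      multiDeriv μ (partialDeriv (Fin.last d) (V i)) y := fun i => by
    refine BoundedOn.mul ⟨1, fun y hy => ?_⟩ (hB i)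
    have h1 := hb j i y hy
    have hm : (1 : ℝ) ≤ m := by exact_mod_cast Nat.one_le_iff_ne_zero.2 (by rintro rfl; exact i.elim0)
    nlinarith [abs_nonneg (nonlinearCoeff A g V j i y)]
  have hinv : BoundedOn fun y => (1 - A j (Fin.last d) (Fin.last d) (jet V y).2)⁻¹ := by
    refine ⟨2, fun y hy => ?_⟩
    have := (abs_le.1 (ha j y hy)).2
    rw [abs_of_nonneg (inv_nonneg.2 (by linarith)), inv_le_comm₀ (by linarith) (by norm_num)]
    linarith
  -- With ∂^μ ∂_n v bounded, the equation solved for y_n ∂_n ∂^μ ∂_n v bounds the weighted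
  -- derivative as well.
  refine ((hinv.mul (((hE j).sub ((BoundedOn.const (γ j)).mul (hB j))).add
    (BoundedOn.sum Finset.univ fun i _ => hbB i))).sub
      ((BoundedOn.const (μ (Fin.last d) : ℝ)).mul (hB j))).congr fun y hy => ?_
  have := (abs_le.1 (ha j y hy)).2
  have h0 : 1 - A j (Fin.last d) (Fin.last d) (jet V y).2 ≠ 0 := by linarith
  field_simp
  ring

end DegenerateSystem

namespace DegenerateSystem
open Set Filter Topology

variable {d m : ℕ}

/-! ### Supremum norms with values in [0, ∞] -/

section SupNorm

variable {f g : Space d → ℝ}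

/-- The supremum norm on the half ball. -/
noncomputable def supNorm (f : Space d → ℝ) : ℝ≥0∞ := ⨆ y ∈ halfBall d, ‖f y‖ₑ

theorem supNorm_le_iff {c : ℝ≥0∞} : supNorm f ≤ c ↔ ∀ y ∈ halfBall d, ‖f y‖ₑ ≤ c := iSup₂_le_iff

theorem le_supNorm {y : Space d} (hy : y ∈ halfBall d) : ‖f y‖ₑ ≤ supNorm f :=
  supNorm_le_iff.1 le_rfl y hy

theorem supNorm_congr (h : EqOn f g (halfBall d)) : supNorm f = supNorm g :=
  iSup_congr fun y => iSup_congr fun hy => by rw [h hy]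

theorem supNorm_add_le : supNorm (fun y => f y + g y) ≤ supNorm f + supNorm g :=
  supNorm_le_iff.2 fun _ hy =>
    (enorm_add_le _ _).trans (add_le_add (le_supNorm hy) (le_supNorm hy))

theorem supNorm_mul_le : supNorm (fun y => f y * g y) ≤ supNorm f * supNorm g :=
  supNorm_le_iff.2 fun y hy => by
    rw [enorm_mul]; exact mul_le_mul' (le_supNorm hy) (le_supNorm hy)

theorem supNorm_const_le (c : ℝ) : supNorm (fun _ : Space d => c) ≤ ‖c‖ₑ :=
  supNorm_le_iff.2 fun _ _ => le_rfl

theorem supNorm_normalCoord_le : supNorm (normalCoord (d := d)) ≤ 1 :=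
  supNorm_le_iff.2 fun y hy => by
    rw [← ofReal_norm, Real.norm_of_nonneg (normalCoord_pos hy).le]
    exact ENNReal.ofReal_le_one.2 (normalCoord_lt_one hy).le

theorem supNorm_normalCoord_mul_le : supNorm (fun y => normalCoord y * f y) ≤ supNorm f :=
  supNorm_mul_le.trans ((mul_le_mul_left supNorm_normalCoord_le _).trans_eq (one_mul _))

theorem supNorm_le_ofReal {M : ℝ} (h : ∀ y ∈ halfBall d, |f y| ≤ M) :
    supNorm f ≤ ENNReal.ofReal M :=
  supNorm_le_iff.2 fun y hy => by
    rw [← ofReal_norm]; exact ENNReal.ofReal_le_ofReal (h y hy)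

theorem abs_le_of_supNorm {M : ℝ} (hM : 0 ≤ M) (h : supNorm f ≤ ENNReal.ofReal M) {y : Space d}
    (hy : y ∈ halfBall d) : |f y| ≤ M := by
  have := (le_supNorm hy).trans h
  rw [← ofReal_norm] at this
  exact (ENNReal.ofReal_le_ofReal_iff hM).1 this

theorem BoundedOn.supNorm_lt_top (h : BoundedOn f) : supNorm f < ∞ := by
  obtain ⟨M, hM⟩ := h
  exact (supNorm_le_ofReal hM).trans_lt ENNReal.ofReal_lt_top

theorem boundedOn_of_supNorm_lt_top (h : supNorm f < ∞) : BoundedOn f :=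
  ⟨(supNorm f).toReal, fun _ hy =>
    abs_le_of_supNorm ENNReal.toReal_nonneg (ENNReal.ofReal_toReal h.ne).ge hy⟩

end SupNorm

/-! ### Truncated majorants as submultiplicative norms -/

section Majorant

variable {f g : Space d → ℝ} {s k : ℕ} {R r : ℝ≥0∞}

/-- The largest derivative of order `k`, a normal derivative being weighted with `r`. -/
noncomputable def orderSup (r : ℝ≥0∞) (k : ℕ) (f : Space d → ℝ) : ℝ≥0∞ :=
  ⨆ (μ : MultiIndex d) (_ : order μ = k), r ^ μ (Fin.last d) * supNorm (multiDeriv μ f)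

theorem orderSup_le_iff {c : ℝ≥0∞} : orderSup r k f ≤ c ↔
    ∀ μ : MultiIndex d, order μ = k → r ^ μ (Fin.last d) * supNorm (multiDeriv μ f) ≤ c :=
  iSup₂_le_iff

theorem le_orderSup (μ : MultiIndex d) :
    r ^ μ (Fin.last d) * supNorm (multiDeriv μ f) ≤ orderSup r (order μ) f :=
  orderSup_le_iff.1 le_rfl μ rfl

theorem orderSup_zero : orderSup r 0 f = supNorm f := by
  refine le_antisymm (orderSup_le_iff.2 fun μ hμ => ?_) ?_
  · rw [eq_zero_of_order hμ, multiDeriv_zero]; simp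
  · have := le_orderSup (r := r) (f := f) (0 : MultiIndex d)
    rw [order_zero, multiDeriv_zero] at this
    simpa using this

theorem orderSup_congr (h : EqOn f g (halfBall d)) : orderSup r k f = orderSup r k g :=
  iSup_congr fun μ => iSup_congr fun _ => by rw [supNorm_congr (multiDeriv_congr (isOpen_halfBall d) h μ)]

theorem orderSup_add_le (hf : SmoothOn f (halfBall d)) (hg : SmoothOn g (halfBall d)) :
    orderSup r k (fun y => f y + g y) ≤ orderSup r k f + orderSup r k g :=
  orderSup_le_iff.2 fun μ hμ => by
    subst hμ
    rw [supNorm_congr (multiDeriv_add (isOpen_halfBall d) hf hg μ)]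
    refine (mul_le_mul_right supNorm_add_le _).trans ?_
    rw [mul_add]
    exact add_le_add (le_orderSup μ) (le_orderSup μ)

theorem orderSup_partialDeriv_le (hf : SmoothOn f (halfBall d)) (i : Fin (d + 1)) :
    r ^ (unitIndex i : MultiIndex d) (Fin.last d) * orderSup r k (partialDeriv i f)
      ≤ orderSup r (k + 1) f := by
  simp only [orderSup, ENNReal.mul_iSup]
  refine iSup₂_le fun μ hμ => ?_
  rw [supNorm_congr (multiDeriv_partialDeriv (isOpen_halfBall d) hf μ i), ← mul_assoc, ← pow_add]
  have := le_orderSup (r := r) (f := f) (μ + unitIndex i)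
  rw [order_add_unit, hμ, Pi.add_apply, add_comm] at this
  exact this

/-- One derivative is peeled off and Pascal's rule recombines the two resulting sums. The binomial
coefficients depend on orders only, and the weight r^{μ_n} is multiplicative, so the supremum over
all multi-indices of one order obeys the one-variable Leibniz bound. -/
theorem orderSup_mul_le (hf : SmoothOn f (halfBall d)) (hg : SmoothOn g (halfBall d)) :
    orderSup r k (fun y => f y * g y) ≤ ∑ p ∈ Finset.HasAntidiagonal.antidiagonal k,
      (k.choose p.1 : ℝ≥0∞) * (orderSup r p.1 f * orderSup r p.2 g) := by
  have hU := isOpen_halfBall d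
  induction k generalizing f g with
  | zero =>
    simp only [Finset.Nat.antidiagonal_zero, Finset.sum_singleton, orderSup_zero, Nat.choose_self,
      Nat.cast_one, one_mul]
    exact supNorm_mul_le
  | succ k ih =>
    refine orderSup_le_iff.2 fun μ hμ => ?_
    obtain ⟨ν, i, rfl, hν⟩ := exists_unit_of_order_succ hμ
    have hf' := hf.partialDeriv hU i
    have hg' := hg.partialDeriv hU i
    rw [supNorm_congr (multiDeriv_mul_add_unit hf hg ν i)]
    set c := r ^ (unitIndex i : MultiIndex d) (Fin.last d) with hc
    have e : r ^ (ν + unitIndex i) (Fin.last d) = c * r ^ ν (Fin.last d) := by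
      rw [Pi.add_apply, pow_add, mul_comm]
    rw [Finset.sum_antidiagonal_choose_succ_mul
      (fun a b => orderSup r a f * orderSup r b g) k, e, add_comm]
    refine (mul_le_mul_right supNorm_add_le _).trans ?_
    rw [mul_add, mul_assoc, mul_assoc]
    have h1 := (le_orderSup (r := r) (f := fun y => partialDeriv i f y * g y) ν).trans
      (hν ▸ ih hf' hg)
    have h2 := (le_orderSup (r := r) (f := fun y => f y * partialDeriv i g y) ν).trans
      (hν ▸ ih hf hg')
    refine add_le_add ((mul_le_mul_right h1 c).trans ?_) ((mul_le_mul_right h2 c).trans ?_)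
    · rw [Finset.mul_sum, hν]
      refine Finset.sum_le_sum fun p hp => ?_
      rw [Finset.HasAntidiagonal.mem_antidiagonal] at hp
      rw [← Nat.choose_symm_of_eq_add hp.symm, mul_left_comm, ← mul_assoc c]
      gcongr
      exact orderSup_partialDeriv_le hf i
    · rw [Finset.mul_sum, hν]
      refine Finset.sum_le_sum fun p hp => ?_
      rw [mul_left_comm, mul_left_comm c]
      gcongr
      exact orderSup_partialDeriv_le hg i

/-- The truncated majorant `∑_{k ≤ s} R^k / k! ‖D^k f‖`. -/
noncomputable def majorant (s : ℕ) (R r : ℝ≥0∞) (f : Space d → ℝ) : ℝ≥0∞ :=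
  ∑ k ∈ Finset.range (s + 1), R ^ k / (k.factorial : ℝ≥0∞) * orderSup r k f

theorem majorant_congr (h : EqOn f g (halfBall d)) : majorant s R r f = majorant s R r g :=
  Finset.sum_congr rfl fun k _ => by rw [orderSup_congr h]

theorem le_majorant (hk : k ≤ s) :
    R ^ k / (k.factorial : ℝ≥0∞) * orderSup r k f ≤ majorant s R r f :=
  Finset.single_le_sum (f := fun k => R ^ k / (k.factorial : ℝ≥0∞) * orderSup r k f)
    (fun _ _ => zero_le) (Finset.mem_range.2 (Nat.lt_succ_of_le hk))

theorem supNorm_le_majorant : supNorm f ≤ majorant s R r f := by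
  have := le_majorant (R := R) (r := r) (f := f) (Nat.zero_le s)
  rw [orderSup_zero] at this
  simpa using this

theorem majorant_add_le (hf : SmoothOn f (halfBall d)) (hg : SmoothOn g (halfBall d)) :
    majorant s R r (fun y => f y + g y) ≤ majorant s R r f + majorant s R r g := by
  rw [majorant, majorant, majorant, ← Finset.sum_add_distrib]
  refine Finset.sum_le_sum fun k _ => ?_
  rw [← mul_add]
  exact mul_le_mul_right (orderSup_add_le hf hg) _

theorem majorant_const_le (c : ℝ) : majorant s R r (fun _ : Space d => c) ≤ ‖c‖ₑ := by
  rw [majorant, Finset.sum_eq_single 0]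
  · simp only [pow_zero, Nat.factorial_zero, Nat.cast_one, div_one, one_mul, orderSup_zero]
    exact supNorm_const_le c
  · intro k _ hk
    have : orderSup r k (fun _ : Space d => c) ≤ 0 := orderSup_le_iff.2 fun μ hμ => by
      have h0 : μ ≠ 0 := by
        rintro rfl
        exact hk (by rw [← hμ, order_zero])
      have : supNorm (multiDeriv μ fun _ : Space d => c) ≤ 0 :=
        supNorm_le_iff.2 fun y _ => by rw [multiDeriv_const c h0]; simp
      rw [nonpos_iff_eq_zero.1 this, mul_zero]
    rw [nonpos_iff_eq_zero.1 this, mul_zero]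
  · intro h
    exact absurd (Finset.mem_range.2 (Nat.succ_pos s)) h

theorem majorant_sum_le {ι : Type*} (t : Finset ι) {F : ι → Space d → ℝ}
    (hF : ∀ a ∈ t, SmoothOn (F a) (halfBall d)) :
    majorant s R r (fun y => ∑ a ∈ t, F a y) ≤ ∑ a ∈ t, majorant s R r (F a) := by
  classical
  induction t using Finset.induction_on with
  | empty => simpa using majorant_const_le (s := s) (R := R) (r := r) (d := d) 0
  | insert a t ha ih =>
    simp only [Finset.sum_insert ha]
    have ht : ∀ b ∈ t, SmoothOn (F b) (halfBall d) := fun b hb => hF b (Finset.mem_insert_of_mem hb)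
    exact (majorant_add_le (hF a (Finset.mem_insert_self a t)) (ContDiffOn.sum ht)).trans
      (add_le_add_right (ih ht) _)

theorem sum_antidiagonal_le {a b : ℕ → ℝ≥0∞} (s : ℕ) :
    ∑ k ∈ Finset.range (s + 1), ∑ p ∈ Finset.HasAntidiagonal.antidiagonal k, a p.1 * b p.2
      ≤ (∑ k ∈ Finset.range (s + 1), a k) * ∑ k ∈ Finset.range (s + 1), b k := by
  rw [Finset.sum_mul_sum, ← Finset.sum_product']
  set P := (Finset.range (s + 1) ×ˢ Finset.range (s + 1)).filter
    fun p => p.1 + p.2 ∈ Finset.range (s + 1) with hP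
  refine le_trans (le_of_eq ?_) (Finset.sum_le_sum_of_subset (Finset.filter_subset _ _) : ∑ p ∈ P, _ ≤ _)
  have hmap : ∀ p ∈ P, p.1 + p.2 ∈ Finset.range (s + 1) := fun p hp => (Finset.mem_filter.1 hp).2
  rw [← Finset.sum_fiberwise_of_maps_to hmap]
  refine Finset.sum_congr rfl fun k hk => Finset.sum_congr ?_ fun _ _ => rfl
  ext p
  simp only [hP, Finset.HasAntidiagonal.mem_antidiagonal, Finset.mem_filter, Finset.mem_product,
    Finset.mem_range] at hk ⊢
  omega

/-- Division by k! turns the binomial convolution into a Cauchy product, and truncation only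
discards nonnegative terms. -/
theorem majorant_mul_le (hf : SmoothOn f (halfBall d)) (hg : SmoothOn g (halfBall d)) :
    majorant s R r (fun y => f y * g y) ≤ majorant s R r f * majorant s R r g := by
  refine le_trans (Finset.sum_le_sum fun k _ => ?_) (sum_antidiagonal_le s)
  refine (mul_le_mul_right (orderSup_mul_le hf hg) _).trans ?_
  rw [Finset.mul_sum]
  refine Finset.sum_le_sum fun p hp => ?_
  rw [Finset.HasAntidiagonal.mem_antidiagonal] at hp
  have h1 : R ^ k / (k.factorial : ℝ≥0∞) * (k.choose p.1 : ℝ≥0∞)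
      = R ^ p.1 / (p.1.factorial : ℝ≥0∞) * (R ^ p.2 / (p.2.factorial : ℝ≥0∞)) := by
    subst hp
    have hf0 : ∀ n : ℕ, (n.factorial : ℝ≥0∞) ≠ 0 := fun n => by
      exact_mod_cast n.factorial_ne_zero
    have hft : ∀ n : ℕ, (n.factorial : ℝ≥0∞) ≠ ∞ := fun n => ENNReal.natCast_ne_top _
    have h2 : (((p.1 + p.2).choose p.1 : ℕ) : ℝ≥0∞) * p.1.factorial * p.2.factorial
        = ((p.1 + p.2).factorial : ℝ≥0∞) := by
      rw [Nat.choose_symm_add]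
      exact_mod_cast Nat.add_choose_mul_factorial_mul_factorial p.1 p.2
    rw [ENNReal.div_eq_inv_mul, ENNReal.div_eq_inv_mul, ENNReal.div_eq_inv_mul, ← h2, pow_add,
      ENNReal.mul_inv (Or.inr (hft _)) (Or.inr (hf0 _)),
      ENNReal.mul_inv (Or.inr (hft _)) (Or.inr (hf0 _))]
    have hc0 : (((p.1 + p.2).choose p.1 : ℕ) : ℝ≥0∞) ≠ 0 := by
      exact_mod_cast (Nat.choose_pos (Nat.le_add_right _ _)).ne'
    have h3 := ENNReal.inv_mul_cancel hc0 (ENNReal.natCast_ne_top _)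
    calc _ = ((((p.1 + p.2).choose p.1 : ℕ) : ℝ≥0∞)⁻¹ * (((p.1 + p.2).choose p.1 : ℕ) : ℝ≥0∞))
          * ((p.1.factorial : ℝ≥0∞)⁻¹ * R ^ p.1 * ((p.2.factorial : ℝ≥0∞)⁻¹ * R ^ p.2)) := by ring
      _ = _ := by rw [h3, one_mul]
  rw [← mul_assoc, h1]
  exact le_of_eq (by ring)

theorem majorant_const_mul_le (c : ℝ) (hf : SmoothOn f (halfBall d)) :
    majorant s R r (fun y => c * f y) ≤ ‖c‖ₑ * majorant s R r f :=
  (majorant_mul_le contDiffOn_const hf).trans (mul_le_mul_left (majorant_const_le c) _)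

theorem majorant_prod_le {ι : Type*} (t : Finset ι) {F : ι → Space d → ℝ}
    (hF : ∀ a ∈ t, SmoothOn (F a) (halfBall d)) :
    majorant s R r (fun y => ∏ a ∈ t, F a y) ≤ ∏ a ∈ t, majorant s R r (F a) := by
  classical
  induction t using Finset.induction_on with
  | empty => simpa using majorant_const_le (s := s) (R := R) (r := r) (d := d) 1
  | insert a t ha ih =>
    simp only [Finset.prod_insert ha]
    have ht : ∀ b ∈ t, SmoothOn (F b) (halfBall d) := fun b hb => hF b (Finset.mem_insert_of_mem hb)
    exact (majorant_mul_le (hF a (Finset.mem_insert_self a t)) (contDiffOn_prod ht)).trans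
      (mul_le_mul_right (ih ht) _)

end Majorant

end DegenerateSystem

namespace DegenerateSystem
open Set Filter Topology

variable {d m : ℕ}

/-! ### Majorants of infinite series -/

section TermwiseDifferentiation

variable {f : Space d → ℝ} {q : ℕ → Space d → ℝ} {s : ℕ} {R r : ℝ≥0∞}

/-- The constant depends on μ but not on f, so summability of majorants gives summability of every
fixed derivative in the supremum norm. -/
theorem supNorm_multiDeriv_le_majorant (hR : R ≠ 0) (hr : r ≠ 0) (hR' : R ≠ ∞) (hr' : r ≠ ∞)
    {μ : MultiIndex d} (hμ : order μ ≤ s) :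
    ∃ c : ℝ≥0∞, c ≠ ∞ ∧ ∀ f : Space d → ℝ, supNorm (multiDeriv μ f) ≤ c * majorant s R r f := by
  set a : ℝ≥0∞ := R ^ order μ / ((order μ).factorial : ℝ≥0∞) * r ^ μ (Fin.last d) with ha
  have hft : ((order μ).factorial : ℝ≥0∞) ≠ ∞ := ENNReal.natCast_ne_top _
  have hf0 : ((order μ).factorial : ℝ≥0∞) ≠ 0 := by exact_mod_cast (order μ).factorial_ne_zero
  have ha0 : a ≠ 0 := mul_ne_zero (ENNReal.div_ne_zero.2 ⟨pow_ne_zero _ hR, hft⟩) (pow_ne_zero _ hr)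
  have hat : a ≠ ∞ := ENNReal.mul_ne_top (ENNReal.div_ne_top (ENNReal.pow_ne_top hR') hf0)
    (ENNReal.pow_ne_top hr')
  refine ⟨a⁻¹, ENNReal.inv_ne_top.2 ha0, fun f => ?_⟩
  have h : a * supNorm (multiDeriv μ f) ≤ majorant s R r f := by
    rw [ha, mul_assoc]
    exact (mul_le_mul_right (le_orderSup μ) _).trans (le_majorant hμ)
  calc supNorm (multiDeriv μ f) = a⁻¹ * (a * supNorm (multiDeriv μ f)) := by
        rw [← mul_assoc, ENNReal.inv_mul_cancel ha0 hat, one_mul]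
    _ ≤ _ := mul_le_mul_right h _

theorem hasSum_multiDeriv (hf : SmoothOn f (halfBall d)) (hq : ∀ n, SmoothOn (q n) (halfBall d))
    (hsum : ∀ y ∈ halfBall d, HasSum (fun n => q n y) (f y))
    (hfin : ∀ μ : MultiIndex d, order μ ≤ s → ∑' n, supNorm (multiDeriv μ (q n)) ≠ ∞)
    {μ : MultiIndex d} (hμ : order μ ≤ s) {y : Space d} (hy : y ∈ halfBall d) :
    HasSum (fun n => multiDeriv μ (q n) y) (multiDeriv μ f y) := by
  have hU := isOpen_halfBall d
  induction μ using multiIndex_induction generalizing y with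
  | zero => simpa only [multiDeriv_zero] using hsum y hy
  | step μ i ih =>
    have ih' := fun {z} hz => ih (by rw [order_add_unit] at hμ; omega) (y := z) hz
    have hline : Continuous fun t : ℝ => y + t • dir i := by fun_prop
    -- Termwise differentiation is applied on a line. Convexity of the half ball makes this
    -- parameter set an interval, on which the differentiated series converges uniformly.
    set T : Set ℝ := (fun t : ℝ => y + t • dir i) ⁻¹' halfBall d with hT
    have hTo : IsOpen T := hU.preimage hline
    have hTc : Convex ℝ T := by
      intro a ha b hb α β hα hβ hαβ
      have := (convex_halfBall d) ha hb hα hβ hαβ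
      simp only [hT, mem_preimage]
      obtain rfl : β = 1 - α := by linarith
      convert! this using 1
      simp only [smul_eq_mul]
      module
    have h0T : (0 : ℝ) ∈ T := by simpa [hT] using hy
    set u : ℕ → ℝ := fun n => (supNorm (multiDeriv (μ + unitIndex i) (q n))).toReal with hu
    have husum : Summable u := ENNReal.summable_toReal (hfin _ hμ)
    have hub : ∀ n, ∀ z ∈ halfBall d, ‖multiDeriv (μ + unitIndex i) (q n) z‖ ≤ u n := by
      intro n z hz
      have hne : supNorm (multiDeriv (μ + unitIndex i) (q n)) ≠ ∞ :=
        ENNReal.ne_top_of_tsum_ne_top (hfin _ hμ) n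
      exact abs_le_of_supNorm ENNReal.toReal_nonneg (ENNReal.ofReal_toReal hne).ge hz
    have hder : ∀ {h : Space d → ℝ}, SmoothOn h (halfBall d) → ∀ t ∈ T,
        HasDerivAt (fun t : ℝ => multiDeriv μ h (y + t • dir i))
          (multiDeriv (μ + unitIndex i) h (y + t • dir i)) t := by
      intro h hh t ht
      rw [multiDeriv_add_unit hU hh μ i ht]
      have h1 : HasDerivAt (fun t : ℝ => y + t • dir i) (dir i) t := by
        simpa using ((hasDerivAt_id t).smul_const (dir i)).const_add y
      exact ((multiDeriv_smooth hU hh μ).differentiableAt hU ht).hasFDerivAt.comp_hasDerivAt t h1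
    have h1 := hasDerivAt_tsum_of_isPreconnected husum hTo hTc.isPreconnected
      (fun n t ht => hder (hq n) t ht) (fun n t ht => hub n _ ht) h0T
      (by simpa using (ih' hy).summable) h0T
    have h2 := (hder hf 0 h0T).congr_of_eventuallyEq (f₁ := fun t : ℝ =>
      ∑' n, multiDeriv μ (q n) (y + t • dir i)) (by
        filter_upwards [hTo.mem_nhds h0T] with t ht using (ih' ht).tsum_eq)
    have h3 := h1.unique h2
    simp only [zero_smul, add_zero] at h3
    rw [← h3]
    exact (Summable.of_norm_bounded husum fun n => hub n y hy).hasSum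

theorem majorant_tsum_le (hf : SmoothOn f (halfBall d)) (hq : ∀ n, SmoothOn (q n) (halfBall d))
    (hsum : ∀ y ∈ halfBall d, HasSum (fun n => q n y) (f y))
    (hR : R ≠ 0) (hr : r ≠ 0) (hR' : R ≠ ∞) (hr' : r ≠ ∞) :
    majorant s R r f ≤ ∑' n, majorant s R r (q n) := by
  by_cases hfin : ∑' n, majorant s R r (q n) = ∞
  · rw [hfin]; exact le_top
  have hfin' : ∀ μ : MultiIndex d, order μ ≤ s → ∑' n, supNorm (multiDeriv μ (q n)) ≠ ∞ := by
    intro μ hμ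
    obtain ⟨c, hc, h⟩ := supNorm_multiDeriv_le_majorant hR hr hR' hr' hμ
    refine ne_top_of_le_ne_top ?_ (ENNReal.tsum_le_tsum fun n => h (q n))
    rw [ENNReal.tsum_mul_left]
    exact ENNReal.mul_ne_top hc hfin
  simp only [majorant]
  rw [Summable.tsum_finsetSum fun _ _ => ENNReal.summable]
  refine Finset.sum_le_sum fun k hk => ?_
  rw [ENNReal.tsum_mul_left]
  refine mul_le_mul_right (orderSup_le_iff.2 fun μ hμ => ?_) _
  have hμs : order μ ≤ s := by rw [hμ]; exact Nat.lt_succ_iff.1 (Finset.mem_range.1 hk)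
  have h1 : supNorm (multiDeriv μ f) ≤ ∑' n, supNorm (multiDeriv μ (q n)) :=
    supNorm_le_iff.2 fun y hy => by
      have h2 := hasSum_multiDeriv hf hq hsum hfin' hμs hy
      rw [← h2.tsum_eq]
      exact enorm_tsum_le_tsum_enorm.trans (ENNReal.tsum_le_tsum fun n => le_supNorm hy)
  refine (mul_le_mul_right h1 _).trans ?_
  rw [← ENNReal.tsum_mul_left]
  exact ENNReal.tsum_le_tsum fun n => hμ ▸ le_orderSup μ

end TermwiseDifferentiation

/-! ### Majorants of compositions with analytic functions -/

section Composition

variable {ι E : Type*} [Fintype ι] [NormedAddCommGroup E] [NormedSpace ℝ E]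
  {e : ι → E} {F : ι → Space d → ℝ} {s : ℕ} {R r : ℝ≥0∞}

theorem multilinear_expand {n : ℕ} (p : ContinuousMultilinearMap ℝ (fun _ : Fin n => E) ℝ)
    (x : ι → ℝ) : p (fun _ => ∑ a, x a • e a)
      = ∑ σ : Fin n → ι, p (fun i => e (σ i)) * ∏ i, x (σ i) := by
  classical
  rw [p.map_sum]
  refine Finset.sum_congr rfl fun σ _ => ?_
  rw [p.map_smul_univ, smul_eq_mul, mul_comm]

theorem smoothOn_multilinear {n : ℕ} (p : ContinuousMultilinearMap ℝ (fun _ : Fin n => E) ℝ)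
    (hF : ∀ a, SmoothOn (F a) (halfBall d)) :
    SmoothOn (fun y => p fun _ => ∑ a, F a y • e a) (halfBall d) := by
  simp only [multilinear_expand p]
  exact ContDiffOn.sum fun σ _ => contDiffOn_const.mul (contDiffOn_prod fun i _ => hF (σ i))

/-- Expanding in the vectors e gives a sum of monomials over words of length n. By
submultiplicativity the sum of their majorants is at most the n-th power of the sum of the majorants
of the F a. -/
theorem majorant_multilinear_le {n : ℕ} (p : ContinuousMultilinearMap ℝ (fun _ : Fin n => E) ℝ)
    (he : ∀ a, ‖e a‖ ≤ 1) (hF : ∀ a, SmoothOn (F a) (halfBall d)) :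
    majorant s R r (fun y => p fun _ => ∑ a, F a y • e a)
      ≤ ‖p‖ₑ * (∑ a, majorant s R r (F a)) ^ n := by
  simp only [multilinear_expand p]
  have hs : ∀ σ : Fin n → ι, SmoothOn (fun y => ∏ i, F (σ i) y) (halfBall d) := fun σ =>
    contDiffOn_prod fun i _ => hF (σ i)
  refine (majorant_sum_le _ fun σ _ => contDiffOn_const.mul (hs σ)).trans ?_
  rw [Fintype.sum_pow, Finset.mul_sum]
  refine Finset.sum_le_sum fun σ _ => (majorant_const_mul_le _ (hs σ)).trans ?_
  refine mul_le_mul' ?_ (majorant_prod_le _ fun i _ => hF (σ i))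
  rw [← ofReal_norm, ← ofReal_norm]
  refine ENNReal.ofReal_le_ofReal ((p.le_opNorm _).trans ?_)
  exact mul_le_of_le_one_right (norm_nonneg _)
    (Finset.prod_le_one (fun _ _ => norm_nonneg _) fun i _ => he _)

theorem enorm_comb_le (he : ∀ a, ‖e a‖ ≤ 1) {y : Space d} (hy : y ∈ halfBall d) :
    ‖∑ a, F a y • e a‖ₑ ≤ ∑ a, majorant s R r (F a) := by
  refine (enorm_sum_le _ _).trans (Finset.sum_le_sum fun a _ => ?_)
  rw [enorm_smul]
  have h1 : ‖e a‖ₑ ≤ 1 := by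
    rw [← ofReal_norm]; exact ENNReal.ofReal_le_one.2 (he a)
  exact ((mul_le_mul_right h1 _).trans_eq (mul_one _)).trans
    ((le_supNorm hy).trans supNorm_le_majorant)

theorem tsum_pow_add_le {x : ℝ≥0∞} (hx : x ≤ 2⁻¹) (k : ℕ) : ∑' n : ℕ, x ^ (n + k) ≤ 2 * x ^ k := by
  simp only [pow_add]
  rw [ENNReal.tsum_mul_right, ENNReal.tsum_geometric]
  refine mul_le_mul_left ?_ _
  rw [ENNReal.inv_le_iff_inv_le]
  calc (2 : ℝ≥0∞)⁻¹ = 1 - 2⁻¹ := ENNReal.one_sub_inv_two.symm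
    _ ≤ 1 - x := tsub_le_tsub_left hx 1

/-- Composition with an analytic function, in majorant norms. -/
theorem exists_majorant_comp_le {B : E → ℝ} (hB : AnalyticAt ℝ B 0) :
    ∃ ρ : ℝ, 0 < ρ ∧ ∃ L : ℝ≥0∞, L ≠ ∞ ∧ AnalyticOnNhd ℝ B (Metric.ball 0 ρ) ∧
      ∀ (e : ι → E), (∀ a, ‖e a‖ ≤ 1) → ∀ F : ι → Space d → ℝ,
      (∀ a, SmoothOn (F a) (halfBall d)) → ∀ (s : ℕ) (R r : ℝ≥0∞), R ≠ 0 → r ≠ 0 → R ≠ ∞ → r ≠ ∞ →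
      ∑ a, majorant s R r (F a) < ENNReal.ofReal ρ →
      majorant s R r (fun y => B (∑ a, F a y • e a) - B 0) ≤ L * ∑ a, majorant s R r (F a) ∧
      majorant s R r (fun y => B (∑ a, F a y • e a) - B 0 - fderiv ℝ B 0 (∑ a, F a y • e a))
        ≤ L * (∑ a, majorant s R r (F a)) ^ 2 := by
  obtain ⟨p, ρ₁, hp⟩ := hB
  obtain ⟨η, hη0, hη⟩ := ENNReal.lt_iff_exists_nnreal_btwn.1 hp.r_pos
  have hη0' : 0 < η := by exact_mod_cast hη0
  obtain ⟨C, hC, hpn⟩ := p.norm_mul_pow_le_of_lt_radius (hη.trans_le hp.r_le)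
  set κ : ℝ≥0∞ := (η : ℝ≥0∞)⁻¹ with hκ
  have hκt : κ ≠ ∞ := ENNReal.inv_ne_top.2 hη0.ne'
  have hpn' : ∀ n, ‖p n‖ₑ ≤ ENNReal.ofReal C * κ ^ n := fun n => by
    have h1 : ‖p n‖ₑ * (η : ℝ≥0∞) ^ n ≤ ENNReal.ofReal C := by
      rw [← ofReal_norm, ← ENNReal.ofReal_coe_nnreal, ← ENNReal.ofReal_pow η.coe_nonneg,
        ← ENNReal.ofReal_mul (norm_nonneg _)]
      exact ENNReal.ofReal_le_ofReal (hpn n)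
    rw [hκ, ← ENNReal.inv_pow, ← div_eq_mul_inv, ENNReal.le_div_iff_mul_le
      (Or.inl (pow_ne_zero _ hη0.ne')) (Or.inl (ENNReal.pow_ne_top ENNReal.coe_ne_top))]
    exact h1
  -- Halving the radius η makes the ratio κ N at most 1/2, so the part of the series from degree k
  -- on is at most C · 2 (κ N)^k. The two summands of the constant serve k = 1 and k = 2.
  refine ⟨η / 2, by positivity, ENNReal.ofReal C * 2 * κ + ENNReal.ofReal C * 2 * κ ^ 2,
    ENNReal.add_ne_top.2 ⟨?_, ?_⟩, ?_, ?_⟩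
  · exact ENNReal.mul_ne_top (ENNReal.mul_ne_top ENNReal.ofReal_ne_top (by simp)) hκt
  · exact ENNReal.mul_ne_top (ENNReal.mul_ne_top ENNReal.ofReal_ne_top (by simp))
      (ENNReal.pow_ne_top hκt)
  · refine hp.analyticOnNhd.mono fun x hx => ?_
    rw [← Metric.eball_ofReal] at hx
    refine Metric.eball_subset_eball (le_trans ?_ hη.le) hx
    rw [← ENNReal.ofReal_coe_nnreal]
    exact ENNReal.ofReal_le_ofReal (by linarith [η.coe_nonneg])
  intro e he F hF s R r hR hr hR' hr' hN
  set N := ∑ a, majorant s R r (F a) with hNdef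
  have hx : κ * N ≤ 2⁻¹ := by
    have h1 : ENNReal.ofReal (η / 2) = (η : ℝ≥0∞) * 2⁻¹ := by
      rw [div_eq_mul_inv, ENNReal.ofReal_mul η.coe_nonneg, ENNReal.ofReal_coe_nnreal,
        ENNReal.ofReal_inv_of_pos (by norm_num)]
      simp
    rw [h1] at hN
    refine (mul_le_mul_right hN.le κ).trans_eq ?_
    rw [← mul_assoc, hκ, ENNReal.inv_mul_cancel hη0.ne' ENNReal.coe_ne_top, one_mul]
  have hW : ∀ y ∈ halfBall d, ∑ a, F a y • e a ∈ Metric.eball (0 : E) ρ₁ := fun y hy => by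
    rw [Metric.mem_eball, edist_zero_right]
    refine (enorm_comb_le (s := s) (R := R) (r := r) he hy).trans_lt (hN.trans (lt_of_le_of_lt ?_ hη))
    rw [← ENNReal.ofReal_coe_nnreal]
    exact ENNReal.ofReal_le_ofReal (by linarith [η.coe_nonneg])
  have hBs : SmoothOn (fun y => B (∑ a, F a y • e a)) (halfBall d) :=
    smoothOn_comp (hp.analyticOnNhd.contDiffOn Metric.isOpen_eball.uniqueDiffOn) hF hW
  set q : ℕ → Space d → ℝ := fun n y => p n fun _ => ∑ a, F a y • e a with hq
  have hqs : ∀ n, SmoothOn (q n) (halfBall d) := fun n => smoothOn_multilinear (p n) hF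
  have hsum : ∀ y ∈ halfBall d, HasSum (fun n => q n y) (B (∑ a, F a y • e a)) := fun y hy => by
    simpa using hp.hasSum (hW y hy)
  have hq0 : ∀ y, q 0 y = B 0 := fun y => hp.coeff_zero _
  have hq1 : ∀ y, q 1 y = fderiv ℝ B 0 (∑ a, F a y • e a) := fun y => by
    rw [hp.hasFPowerSeriesAt.hasFDerivAt.fderiv, continuousMultilinearCurryFin1_apply]
    simp only [hq]
    congr 1
  have htail : ∀ k, ∑' n, majorant s R r (q (n + k)) ≤ ENNReal.ofReal C * (2 * (κ * N) ^ k) :=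
    fun k => by
      refine (ENNReal.tsum_le_tsum fun n => (majorant_multilinear_le (p (n + k)) he hF).trans
        (mul_le_mul_left (hpn' _) _)).trans ?_
      simp only [mul_assoc, ← mul_pow]
      rw [ENNReal.tsum_mul_left]
      exact mul_le_mul_right (tsum_pow_add_le hx k) _
  constructor
  · refine (majorant_tsum_le (q := fun n => q (n + 1)) (hBs.sub contDiffOn_const)
      (fun n => hqs _) (fun y hy => ?_) hR hr hR' hr').trans ((htail 1).trans ?_)
    · have := (hasSum_nat_add_iff' 1).2 (hsum y hy)
      simpa [hq0] using this
    · rw [add_mul]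
      refine le_trans (le_of_eq ?_) le_self_add
      ring
  · have hl : SmoothOn (fun y => fderiv ℝ B 0 (∑ a, F a y • e a)) (halfBall d) :=
      (hqs 1).congr fun y _ => (hq1 y).symm
    refine (majorant_tsum_le (q := fun n => q (n + 2)) ((hBs.sub contDiffOn_const).sub hl)
      (fun n => hqs _) (fun y hy => ?_) hR hr hR' hr').trans ((htail 2).trans ?_)
    · have := (hasSum_nat_add_iff' 2).2 (hsum y hy)
      simpa [Finset.sum_range_succ, hq0, hq1, sub_sub] using this
    · rw [add_mul]
      refine le_trans (le_of_eq ?_) le_add_self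
      ring

end Composition

end DegenerateSystem

namespace DegenerateSystem
open Set Filter Topology

variable {d m : ℕ}

/-! ### Weighted majorants and the gains r and R -/

section WeightedMajorant

variable {f : Space d → ℝ} {s k : ℕ} {R r : ℝ≥0∞}

/-- The weighted norm of the derivative `∂^μ f`. -/
noncomputable def weightedTerm (μ : MultiIndex d) (f : Space d → ℝ) : ℝ≥0∞ :=
  supNorm (fun y => normalCoord y * partialDeriv (Fin.last d) (multiDeriv μ f) y)
    + ((μ (Fin.last d) : ℝ≥0∞) + 1) * supNorm (multiDeriv μ f)

/-- The largest weighted derivative of order `k`. -/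
noncomputable def weightedSup (r : ℝ≥0∞) (k : ℕ) (f : Space d → ℝ) : ℝ≥0∞ :=
  ⨆ (μ : MultiIndex d) (_ : order μ = k), r ^ μ (Fin.last d) * weightedTerm μ f

/-- The largest weighted tangential derivative of order `k`. -/
noncomputable def tangentialSup (k : ℕ) (f : Space d → ℝ) : ℝ≥0∞ :=
  ⨆ (μ : MultiIndex d) (_ : order μ = k ∧ μ (Fin.last d) = 0), weightedTerm μ f

theorem weightedSup_le_iff {c : ℝ≥0∞} : weightedSup r k f ≤ c ↔
    ∀ μ : MultiIndex d, order μ = k → r ^ μ (Fin.last d) * weightedTerm μ f ≤ c := iSup₂_le_iff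

theorem le_weightedSup (μ : MultiIndex d) :
    r ^ μ (Fin.last d) * weightedTerm μ f ≤ weightedSup r (order μ) f :=
  weightedSup_le_iff.1 le_rfl μ rfl

theorem le_tangentialSup {μ : MultiIndex d} (hμ : μ (Fin.last d) = 0) :
    weightedTerm μ f ≤ tangentialSup (order μ) f :=
  le_iSup₂_of_le (f := fun (ν : MultiIndex d) (_ : order ν = order μ ∧ ν (Fin.last d) = 0) =>
    weightedTerm ν f) μ ⟨rfl, hμ⟩ le_rfl

theorem supNorm_le_weightedTerm (μ : MultiIndex d) :
    supNorm (multiDeriv μ f) ≤ weightedTerm μ f := by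
  refine le_trans ?_ le_add_self
  rw [add_mul, one_mul]
  exact le_add_self

/-- The truncated weighted majorant. -/
noncomputable def weightedMajorant (s : ℕ) (R r : ℝ≥0∞) (f : Space d → ℝ) : ℝ≥0∞ :=
  ∑ k ∈ Finset.range (s + 1), R ^ k / (k.factorial : ℝ≥0∞) * weightedSup r k f

/-- The truncated tangential majorant. -/
noncomputable def tangentialMajorant (s : ℕ) (R : ℝ≥0∞) (f : Space d → ℝ) : ℝ≥0∞ :=
  ∑ k ∈ Finset.range (s + 1), R ^ k / (k.factorial : ℝ≥0∞) * tangentialSup k f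

theorem orderSup_le_weightedSup : orderSup r k f ≤ weightedSup r k f :=
  orderSup_le_iff.2 fun μ hμ =>
    (mul_le_mul_right (supNorm_le_weightedTerm μ) _).trans (hμ ▸ le_weightedSup μ)

theorem majorant_le_weightedMajorant : majorant s R r f ≤ weightedMajorant s R r f :=
  Finset.sum_le_sum fun _ _ => mul_le_mul_right orderSup_le_weightedSup _

theorem majorant_weighted_normal_le (hf : SmoothOn f (halfBall d)) :
    majorant s R r (fun y => normalCoord y * partialDeriv (Fin.last d) f y)
      ≤ weightedMajorant s R r f := by
  refine Finset.sum_le_sum fun k _ => mul_le_mul_right (orderSup_le_iff.2 fun μ hμ => ?_) _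
  refine (mul_le_mul_right ?_ _).trans (hμ ▸ le_weightedSup μ)
  rw [supNorm_congr (multiDeriv_weighted_normal hf μ)]
  refine supNorm_add_le.trans (add_le_add_right ?_ _)
  refine (supNorm_mul_le.trans (mul_le_mul_left (supNorm_const_le _) _)).trans ?_
  rw [add_mul, ← ofReal_norm, Real.norm_of_nonneg (Nat.cast_nonneg _), ENNReal.ofReal_natCast]
  exact le_self_add

/-- Tangential derivatives with weight `y_n` gain a factor `r`, up to purely tangential terms. -/
theorem orderSup_weighted_tangential_le (hf : SmoothOn f (halfBall d)) {l : Fin (d + 1)}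
    (hl : l ≠ Fin.last d) :
    orderSup r k (fun y => normalCoord y * partialDeriv l f y)
      ≤ r * weightedSup r k f + tangentialSup (k + 1) f := by
  refine orderSup_le_iff.2 fun μ hμ => ?_
  by_cases hμ0 : μ (Fin.last d) = 0
  · rw [hμ0, pow_zero, one_mul, supNorm_congr (multiDeriv_weighted_of_tangential hf hμ0 l)]
    refine (supNorm_normalCoord_mul_le.trans (supNorm_le_weightedTerm _)).trans
      (le_trans ?_ le_add_self)
    have := le_tangentialSup (f := f) (add_unit_last hμ0 hl)
    rwa [order_add_unit, hμ] at this
  · obtain ⟨ν, rfl⟩ := exists_sub_unit hμ0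
    have hln : (unitIndex l : MultiIndex d) (Fin.last d) = 0 := unitIndex_ne (Ne.symm hl)
    have h2 := le_weightedSup (r := r) (f := f) (ν + unitIndex l)
    rw [order_add_unit, ← order_add_unit ν (Fin.last d), hμ, Pi.add_apply, hln, add_zero] at h2
    refine le_trans ?_ (le_self_add (b := tangentialSup (k + 1) f))
    refine le_trans ?_ (mul_le_mul_right h2 r)
    rw [Pi.add_apply, unitIndex_self, pow_succ', mul_assoc]
    refine mul_le_mul_right (mul_le_mul_right ?_ _) _
    rw [supNorm_congr (multiDeriv_weighted_tangential hf ν l)]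
    refine supNorm_add_le.trans (add_le_add_right ?_ _)
    refine (supNorm_mul_le.trans (mul_le_mul_left (supNorm_const_le _) _)).trans (le_of_eq ?_)
    rw [Pi.add_apply, hln, add_zero, ← ofReal_norm, Real.norm_of_nonneg (by positivity),
      ENNReal.ofReal_add (Nat.cast_nonneg _) zero_le_one, ENNReal.ofReal_natCast, ENNReal.ofReal_one]

/-- Pays for the loss of one tangential derivative by shrinking the radius: k + 1 ≤ 2^k gives (k +
1) R^k ≤ R₁^k as soon as 2R ≤ R₁. -/
theorem pow_div_factorial_le {R R₁ : ℝ≥0∞} (hR : 2 * R ≤ R₁) (h0 : R₁ ≠ 0) (ht : R₁ ≠ ∞) (k : ℕ) :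
    R ^ k / (k.factorial : ℝ≥0∞)
      ≤ R₁⁻¹ * (R₁ ^ (k + 1) / ((k + 1).factorial : ℝ≥0∞)) := by
  have h1 : ((k : ℝ≥0∞) + 1) * R ^ k ≤ R₁ ^ k := by
    calc ((k : ℝ≥0∞) + 1) * R ^ k ≤ 2 ^ k * R ^ k := by
          refine mul_le_mul_left ?_ _
          exact_mod_cast Nat.lt_two_pow_self
      _ = (2 * R) ^ k := (mul_pow _ _ _).symm
      _ ≤ R₁ ^ k := pow_le_pow_left₀ zero_le hR k
  have hk0 : ((k : ℝ≥0∞) + 1) ≠ 0 := by simp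
  have hkt : ((k : ℝ≥0∞) + 1) ≠ ∞ := by exact_mod_cast ENNReal.natCast_ne_top (k + 1)
  have e : R₁⁻¹ * (R₁ ^ (k + 1) / ((k + 1).factorial : ℝ≥0∞))
      = ((k : ℝ≥0∞) + 1)⁻¹ * R₁ ^ k / (k.factorial : ℝ≥0∞) := by
    rw [Nat.factorial_succ, Nat.cast_mul, Nat.cast_succ, pow_succ', div_eq_mul_inv,
      div_eq_mul_inv, ENNReal.mul_inv (Or.inl hk0) (Or.inl hkt)]
    calc _ = (R₁⁻¹ * R₁) * (((k : ℝ≥0∞) + 1)⁻¹ * R₁ ^ k * (k.factorial : ℝ≥0∞)⁻¹) := by ring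
      _ = _ := by rw [ENNReal.inv_mul_cancel h0 ht, one_mul]
  rw [e]
  refine ENNReal.div_le_div_right ?_ _
  calc R ^ k = ((k : ℝ≥0∞) + 1)⁻¹ * (((k : ℝ≥0∞) + 1) * R ^ k) := by
        rw [← mul_assoc, ENNReal.inv_mul_cancel hk0 hkt, one_mul]
    _ ≤ _ := mul_le_mul_right h1 _

theorem majorant_weighted_tangential_le {R₁ : ℝ≥0∞} (hR : 2 * R ≤ R₁) (h0 : R₁ ≠ 0) (ht : R₁ ≠ ∞)
    (hf : SmoothOn f (halfBall d)) {l : Fin (d + 1)} (hl : l ≠ Fin.last d) :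
    majorant s R r (fun y => normalCoord y * partialDeriv l f y)
      ≤ r * weightedMajorant s R r f + R₁⁻¹ * tangentialMajorant (s + 1) R₁ f := by
  have h1 : ∑ k ∈ Finset.range (s + 1), R ^ k / (k.factorial : ℝ≥0∞) * tangentialSup (k + 1) f
      ≤ R₁⁻¹ * tangentialMajorant (s + 1) R₁ f := by
    rw [tangentialMajorant, Finset.sum_range_succ' _ (s + 1), mul_add, Finset.mul_sum]
    refine le_trans (Finset.sum_le_sum fun k _ => ?_) le_self_add
    rw [← mul_assoc]
    exact mul_le_mul_left (pow_div_factorial_le hR h0 ht k) _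
  refine le_trans (Finset.sum_le_sum fun k _ =>
    mul_le_mul_right (orderSup_weighted_tangential_le hf hl) _) ?_
  simp only [mul_add, Finset.sum_add_distrib]
  refine add_le_add (le_of_eq ?_) h1
  rw [weightedMajorant, Finset.mul_sum]
  exact Finset.sum_congr rfl fun k _ => by ring

/-- With μ = ν + e_n one has ∂^μ ∂_l = ∂^{ν + e_l} ∂_n, where one normal derivative fewer gains r.
The weights compare by ν_n + 2 ≤ 2 (ν_n + 1), hence the factor 2. For μ_n = 0 the term is purely
tangential. -/
theorem weightedSup_tangential_le (hf : SmoothOn f (halfBall d)) {l : Fin (d + 1)}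
    (hl : l ≠ Fin.last d) :
    weightedSup r k (partialDeriv l f)
      ≤ tangentialSup k (partialDeriv l f)
        + 2 * r * weightedSup r k (partialDeriv (Fin.last d) f) := by
  refine weightedSup_le_iff.2 fun μ hμ => ?_
  by_cases hμ0 : μ (Fin.last d) = 0
  · rw [hμ0, pow_zero, one_mul]
    exact (hμ ▸ le_tangentialSup hμ0).trans le_self_add
  · obtain ⟨ν, rfl⟩ := exists_sub_unit hμ0
    have hln : (unitIndex l : MultiIndex d) (Fin.last d) = 0 := unitIndex_ne (Ne.symm hl)
    have h2 := le_weightedSup (r := r) (f := partialDeriv (Fin.last d) f) (ν + unitIndex l)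
    rw [order_add_unit, ← order_add_unit ν (Fin.last d), hμ, Pi.add_apply, hln, add_zero] at h2
    refine le_trans ?_ (le_add_self (b := tangentialSup k (partialDeriv l f)))
    refine le_trans ?_ (mul_le_mul_right h2 (2 * r))
    have e := multiDeriv_partialDeriv_swap hf ν (Fin.last d) l
    have h3 : weightedTerm (ν + unitIndex (Fin.last d)) (partialDeriv l f)
        ≤ 2 * weightedTerm (ν + unitIndex l) (partialDeriv (Fin.last d) f) := by
      rw [weightedTerm, weightedTerm, supNorm_congr e,
        supNorm_congr (f := fun y => normalCoord y * partialDeriv (Fin.last d)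
          (multiDeriv (ν + unitIndex (Fin.last d)) (partialDeriv l f)) y)
        (g := fun y => normalCoord y * partialDeriv (Fin.last d)
          (multiDeriv (ν + unitIndex l) (partialDeriv (Fin.last d) f)) y)
        fun y hy => by simp only [partialDeriv_congr (isOpen_halfBall d) e _ hy], mul_add]
      refine add_le_add ?_ ?_
      · rw [two_mul]; exact le_self_add
      · rw [← mul_assoc, Pi.add_apply, Pi.add_apply, hln, unitIndex_self]
        refine mul_le_mul_left ?_ _
        push_cast
        rw [add_zero, mul_add, two_mul, mul_one, add_assoc, one_add_one_eq_two]
        exact add_le_add_left le_self_add _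
    rw [Pi.add_apply, unitIndex_self, pow_succ']
    refine (mul_le_mul_right h3 _).trans (le_of_eq ?_)
    ring

theorem weightedMajorant_tangential_le {R₁ : ℝ≥0∞} (hR : R ≤ R₁) (hf : SmoothOn f (halfBall d))
    {l : Fin (d + 1)} (hl : l ≠ Fin.last d) :
    weightedMajorant s R r (partialDeriv l f) ≤ tangentialMajorant s R₁ (partialDeriv l f)
      + 2 * r * weightedMajorant s R r (partialDeriv (Fin.last d) f) := by
  refine le_trans (Finset.sum_le_sum fun k _ =>
    mul_le_mul_right (weightedSup_tangential_le hf hl) _) ?_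
  simp only [mul_add, Finset.sum_add_distrib]
  refine add_le_add (Finset.sum_le_sum fun k _ => ?_) (le_of_eq ?_)
  · exact mul_le_mul_left (ENNReal.div_le_div_right (pow_le_pow_left₀ zero_le hR k) _) _
  · rw [weightedMajorant, Finset.mul_sum]
    exact Finset.sum_congr rfl fun k _ => by ring

theorem orderSup_succ_le (hf : SmoothOn f (halfBall d)) (hr : r ≤ 1) :
    orderSup r (k + 1) f ≤ ∑ i, weightedSup r k (partialDeriv i f) := by
  refine orderSup_le_iff.2 fun μ hμ => ?_
  obtain ⟨ν, i, rfl, hν⟩ := exists_unit_of_order_succ hμ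
  rw [supNorm_congr (multiDeriv_partialDeriv (isOpen_halfBall d) hf ν i).symm, Pi.add_apply,
    pow_add]
  refine le_trans ?_ (Finset.single_le_sum (f := fun i => weightedSup r k (partialDeriv i f))
    (fun _ _ => zero_le) (Finset.mem_univ i))
  refine le_trans ?_ (hν ▸ le_weightedSup ν)
  exact mul_le_mul' (mul_le_of_le_one_right zero_le (pow_le_one₀ zero_le hr))
    (supNorm_le_weightedTerm ν)

/-- A derivative of f of order k + 1 is one of ∇f of order k, and R^{k+1} / (k+1)! ≤ R · R^k / k!.
So the undifferentiated v is harmless for small R. -/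
theorem majorant_le_supNorm_add (hf : SmoothOn f (halfBall d)) (hr : r ≤ 1) :
    majorant s R r f ≤ supNorm f + R * ∑ i, weightedMajorant s R r (partialDeriv i f) := by
  have h0 : R ^ 0 / ((0 : ℕ).factorial : ℝ≥0∞) * orderSup r 0 f = supNorm f := by
    simp [orderSup_zero]
  rw [majorant, Finset.sum_range_succ', h0, add_comm]
  refine add_le_add_right ?_ _
  calc _ ≤ ∑ k ∈ Finset.range s, R * (R ^ k / (k.factorial : ℝ≥0∞) *
          ∑ i, weightedSup r k (partialDeriv i f)) := by
        refine Finset.sum_le_sum fun k _ => ?_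
        rw [← mul_assoc]
        refine mul_le_mul' ?_ (orderSup_succ_le hf hr)
        rw [pow_succ', mul_div_assoc]
        refine mul_le_mul_right (ENNReal.div_le_div_left ?_ _) _
        exact_mod_cast Nat.factorial_le (Nat.le_succ k)
    _ ≤ _ := by
        rw [← Finset.mul_sum]
        refine mul_le_mul_right ?_ _
        simp only [Finset.mul_sum, weightedMajorant]
        rw [Finset.sum_comm]
        exact Finset.sum_le_sum fun i _ =>
          Finset.sum_le_sum_of_subset (Finset.range_subset_range.2 (Nat.le_succ s))

/-- The a priori estimate for the Fuchsian operator `y_n ∂_n + γ`. -/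
theorem weightedMajorant_le_of_fuchsian {u F : Space d → ℝ} {γ : ℝ} (hγ : 1 ≤ γ)
    (hu : SmoothOn u (halfBall d)) (hb : ∀ μ : MultiIndex d, BoundedOn (multiDeriv μ u))
    (heq : ∀ y ∈ halfBall d, normalCoord y * partialDeriv (Fin.last d) u y + γ * u y = F y) :
    weightedMajorant s R r u ≤ 3 * majorant s R r F := by
  have hU := isOpen_halfBall d
  rw [majorant, Finset.mul_sum]
  refine Finset.sum_le_sum fun k _ => ?_
  rw [mul_left_comm]
  refine mul_le_mul_right (weightedSup_le_iff.2 fun μ hμ => ?_) _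
  refine le_trans ?_ (mul_le_mul_right (hμ ▸ le_orderSup μ) _)
  rw [mul_left_comm]
  refine mul_le_mul_right ?_ _
  by_cases hc : supNorm (multiDeriv μ F) = ∞
  · rw [hc, ENNReal.mul_top (by norm_num)]; exact le_top
  set K := (supNorm (multiDeriv μ F)).toReal with hK
  have hK0 : 0 ≤ K := ENNReal.toReal_nonneg
  have hKe : supNorm (multiDeriv μ F) = ENNReal.ofReal K := (ENNReal.ofReal_toReal hc).symm
  set n : ℝ := (μ (Fin.last d) : ℝ) with hn
  have hn0 : 0 ≤ n := Nat.cast_nonneg _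
  have hs := multiDeriv_smooth hU hu μ
  -- The differentiated equation has exponent γ + μ_n. Boundedness of ∂^μ u, with whatever bound,
  -- selects the regular solution.
  have hode : ∀ y ∈ halfBall d, |normalCoord y * partialDeriv (Fin.last d) (multiDeriv μ u) y
      + (γ + n) * multiDeriv μ u y| ≤ K := fun y hy => by
    have e := multiDeriv_congr hU (fun y hy => (heq y hy).symm) μ hy
    rw [multiDeriv_add hU ((smoothOn_normalCoord _).mul (hu.partialDeriv hU _))
      (contDiffOn_const.mul hu) μ hy] at e
    beta_reduce at e
    rw [multiDeriv_weighted_normal hu μ hy, multiDeriv_const_mul hU hu _ μ hy] at e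
    have := abs_le_of_supNorm hK0 hKe.le hy
    rw [e] at this
    convert! this using 2
    ring
  obtain ⟨M, hM⟩ := hb μ
  have hlam : 0 < γ + n := by linarith
  have h1 : ∀ y ∈ halfBall d, |multiDeriv μ u y| ≤ K / (γ + n) := fun y hy =>
    normal_fuchsian_abs_bound hs hlam hode hM hy
  have h2 : ∀ y ∈ halfBall d,
      |normalCoord y * partialDeriv (Fin.last d) (multiDeriv μ u) y| ≤ 2 * K := fun y hy => by
    have a1 := hode y hy
    have a2 : |(γ + n) * multiDeriv μ u y| ≤ K := by
      rw [abs_mul, abs_of_pos hlam, mul_comm]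
      exact (le_div_iff₀ hlam).1 (h1 y hy)
    rw [abs_le] at a1 a2 ⊢
    constructor <;> linarith
  -- Uses (μ_n + 1) / (γ + μ_n) ≤ 1, that is γ ≥ 1. Together with 2K for the weighted normal
  -- derivative this makes the constant 3.
  have h3 : ((μ (Fin.last d) : ℝ≥0∞) + 1) * supNorm (multiDeriv μ u) ≤ ENNReal.ofReal K := by
    have e : ((μ (Fin.last d) : ℝ≥0∞) + 1) = ENNReal.ofReal (n + 1) := by
      rw [ENNReal.ofReal_add hn0 zero_le_one, ENNReal.ofReal_one, hn, ENNReal.ofReal_natCast]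
    rw [e]
    refine (mul_le_mul_right (supNorm_le_ofReal h1) _).trans ?_
    rw [← ENNReal.ofReal_mul (by linarith)]
    refine ENNReal.ofReal_le_ofReal ?_
    rw [mul_div_assoc', div_le_iff₀ hlam]
    nlinarith
  rw [weightedTerm, hKe]
  refine (add_le_add (supNorm_le_ofReal h2) h3).trans (le_of_eq ?_)
  rw [ENNReal.ofReal_mul (by norm_num), ENNReal.ofReal_ofNat]
  ring

end WeightedMajorant

end DegenerateSystem

/-! ### The a priori estimate for the system -/

namespace DegenerateSystem
open Set Filter Topology

variable {d m : ℕ}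

/-- The truncated majorant of `(v, ∇v)`. -/
noncomputable def jetMajorant (s : ℕ) (R r : ℝ≥0∞) (V : Fin m → Space d → ℝ) : ℝ≥0∞ :=
  ∑ a, majorant s R r (comps V a)

/-- The truncated weighted majorant of `∇v`. -/
noncomputable def gradMajorant (s : ℕ) (R r : ℝ≥0∞) (V : Fin m → Space d → ℝ) : ℝ≥0∞ :=
  ∑ j, ∑ i, weightedMajorant s R r (partialDeriv i (V j))

/-- Composition of `B` with `(v, ∇v)` is controlled to first and second order. -/
def MajorantComp (B : State d m → ℝ) (K : ℝ≥0∞) : Prop :=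
  ∀ V : Fin m → Space d → ℝ, (∀ j, SmoothOn (V j) (halfBall d)) → ∀ (s : ℕ) (R r : ℝ≥0∞),
    R ≠ 0 → r ≠ 0 → R ≠ ∞ → r ≠ ∞ → K * jetMajorant s R r V < 1 →
    majorant s R r (fun y => B (jet V y) - B 0) ≤ K * jetMajorant s R r V ∧
    majorant s R r (fun y => B (jet V y) - B 0 - fderiv ℝ B 0 (jet V y))
      ≤ K * jetMajorant s R r V ^ 2

theorem MajorantComp.mono {B : State d m → ℝ} {K K' : ℝ≥0∞} (h : MajorantComp B K) (hK : K ≤ K') :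
    MajorantComp B K' := fun V hV s R r h1 h2 h3 h4 h5 => by
  obtain ⟨a, b⟩ := h V hV s R r h1 h2 h3 h4 ((mul_le_mul_left hK _).trans_lt h5)
  exact ⟨a.trans (mul_le_mul_left hK _), b.trans (mul_le_mul_left hK _)⟩

/-- All bounds on the coefficients of the system, collected in one constant. -/
structure CoeffBounds (γ : Fin m → ℝ) (A : Fin m → Fin (d + 1) → Fin (d + 1) → Grad d m → ℝ)
    (g : Fin m → State d m → ℝ) (ρ : ℝ) (K : ℝ≥0∞) : Prop extends CoeffSmooth A g ρ where
  one_le : 1 ≤ K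
  one_lt_exponent : ∀ j, 1 < γ j
  exponent_le : ∀ j, ‖γ j‖ₑ ≤ K
  A_zero_le : ∀ j k l, ‖A j k l 0‖ₑ ≤ K
  A_normal : ∀ j, A j (Fin.last d) (Fin.last d) 0 = 0
  A_comp : ∀ j k l, MajorantComp (fun x : State d m => A j k l x.2) K
  g_comp : ∀ j, MajorantComp (g j) K
  g_deriv_le : ∀ j a, ‖fderiv ℝ (g j) 0 (stateBasis a)‖ₑ ≤ K
  g_deriv_normal : ∀ j i, fderiv ℝ (g j) 0 (stateBasis (Sum.inr (i, Fin.last d))) = 0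

/-- A smooth solution with small values and small tangential derivatives. -/
structure ControlledSolution (γ : Fin m → ℝ)
    (A : Fin m → Fin (d + 1) → Fin (d + 1) → Grad d m → ℝ)
    (g : Fin m → State d m → ℝ) (ρ : ℝ) (R₁ ε T : ℝ≥0∞) (V : Fin m → Space d → ℝ) : Prop where
  smooth : ∀ j, SmoothOn (V j) (halfBall d)
  solution : ClassicalSolution γ A g V
  jet_mem : ∀ y ∈ halfBall d, jet V y ∈ Metric.ball (0 : State d m) ρ
  bounded : ∀ j i (μ : MultiIndex d), BoundedOn (multiDeriv μ (partialDeriv i (V j)))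
  value_le : ∀ j, supNorm (V j) ≤ ε
  tangential_le : ∀ j i s, tangentialMajorant s R₁ (partialDeriv i (V j)) ≤ T

section Estimate

variable {γ : Fin m → ℝ} {A : Fin m → Fin (d + 1) → Fin (d + 1) → Grad d m → ℝ}
  {g : Fin m → State d m → ℝ} {ρ : ℝ} {K R₁ ε T R r : ℝ≥0∞} {V : Fin m → Space d → ℝ} {s : ℕ}

theorem le_gradMajorant (j : Fin m) (i : Fin (d + 1)) :
    weightedMajorant s R r (partialDeriv i (V j)) ≤ gradMajorant s R r V :=
  (Finset.single_le_sum (f := fun i => weightedMajorant s R r (partialDeriv i (V j)))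
    (fun _ _ => zero_le) (Finset.mem_univ i)).trans
  (Finset.single_le_sum (f := fun j => ∑ i, weightedMajorant s R r (partialDeriv i (V j)))
    (fun _ _ => zero_le) (Finset.mem_univ j))

namespace ControlledSolution

variable (h : ControlledSolution γ A g ρ R₁ ε T V)
include h

theorem sum_majorant_le (hr : r ≤ 1) :
    ∑ j, majorant s R r (V j) ≤ m * ε + R * gradMajorant s R r V := by
  refine (Finset.sum_le_sum fun j _ => (majorant_le_supNorm_add (h.smooth j) hr).trans
    (add_le_add_left (h.value_le j) _)).trans (le_of_eq ?_)
  rw [Finset.sum_add_distrib, ← Finset.mul_sum]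
  simp [gradMajorant]

theorem jetMajorant_le (hr : r ≤ 1) (hR : R ≤ 1) :
    jetMajorant s R r V ≤ m * ε + 2 * gradMajorant s R r V := by
  have h1 : jetMajorant s R r V = ∑ j, majorant s R r (V j)
      + ∑ j, ∑ i, majorant s R r (partialDeriv i (V j)) := by
    rw [jetMajorant, Fintype.sum_sum_type, Fintype.sum_prod_type]; rfl
  rw [h1, two_mul, ← add_assoc]
  refine add_le_add ((h.sum_majorant_le hr).trans ?_) (Finset.sum_le_sum fun j _ =>
    Finset.sum_le_sum fun i _ => majorant_le_weightedMajorant)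
  exact add_le_add_right (mul_le_of_le_one_left zero_le hR) _

theorem weightedMajorant_tangential_le (hR : R ≤ R₁) (j : Fin m) {l : Fin (d + 1)}
    (hl : l ≠ Fin.last d) :
    weightedMajorant s R r (partialDeriv l (V j)) ≤ T + 2 * r * gradMajorant s R r V :=
  (DegenerateSystem.weightedMajorant_tangential_le hR (h.smooth j) hl).trans
    (add_le_add (h.tangential_le j l s) (mul_le_mul_right (le_gradMajorant j _) _))

/-- One of the two derivatives is tangential. After commuting it to the outside, it gains r up to
the tangential data T. -/
theorem majorant_second_le (hR : 2 * R ≤ R₁) (h0 : R₁ ≠ 0) (ht : R₁ ≠ ∞) (hK : R₁⁻¹ ≤ K) (j : Fin m)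
    {k l : Fin (d + 1)} (hkl : ¬(k = Fin.last d ∧ l = Fin.last d)) :
    majorant s R r (fun y => normalCoord y * partialDeriv k (partialDeriv l (V j)) y)
      ≤ r * gradMajorant s R r V + K * T := by
  have hU := isOpen_halfBall d
  have key : ∀ {k l}, k ≠ Fin.last d →
      majorant s R r (fun y => normalCoord y * partialDeriv k (partialDeriv l (V j)) y)
      ≤ r * gradMajorant s R r V + K * T := fun {k l} hk =>
    (majorant_weighted_tangential_le hR h0 ht ((h.smooth j).partialDeriv hU l) hk).trans
      (add_le_add (mul_le_mul_right (le_gradMajorant j l) _)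
        (mul_le_mul' hK (h.tangential_le j l (s + 1))))
  by_cases hk : k = Fin.last d
  · have hl : l ≠ Fin.last d := fun hl => hkl ⟨hk, hl⟩
    rw [majorant_congr (g := fun y => normalCoord y * partialDeriv l (partialDeriv k (V j)) y)
      fun y hy => by simp only [partialDeriv_comm hU (h.smooth j) k l hy]]
    exact key hl
  · exact key hk

theorem smoothOn_comp_jet {B : State d m → ℝ}
    (hB : ContDiffOn ℝ (⊤ : ℕ∞) B (Metric.ball 0 ρ)) :
    SmoothOn (fun y => B (jet V y)) (halfBall d) :=
  smoothOn_comp hB (smoothOn_comps h.smooth) h.jet_mem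

theorem smoothOn_second (j : Fin m) (k l : Fin (d + 1)) :
    SmoothOn (fun y => normalCoord y * partialDeriv k (partialDeriv l (V j)) y) (halfBall d) :=
  (smoothOn_normalCoord _).mul
    (((h.smooth j).partialDeriv (isOpen_halfBall d) l).partialDeriv (isOpen_halfBall d) k)

variable (hc : CoeffBounds γ A g ρ K) (hR0 : R ≠ 0) (hr0 : r ≠ 0) (hr1 : r ≤ 1) (hR1 : R ≤ 1)
  (hR : 2 * R ≤ R₁) (ht : R₁ ≠ ∞) (hK : R₁⁻¹ ≤ K) (hN : K * jetMajorant s R r V < 1)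
include hc hR0 hr0 hr1 hR1 hR ht hK hN

/-- The (n, n) term is quadratic, because A_nn vanishes at 0 and its majorant is therefore at most K
N. In the other terms A is merely bounded, by 2K, and the weighted second derivative is the small
factor. -/
theorem majorant_principal_le (j : Fin m) :
    majorant s R r (fun y => ∑ k, ∑ l, A j k l (jet V y).2 *
        (normalCoord y * partialDeriv k (partialDeriv l (V j)) y))
      ≤ (d + 1) ^ 2 * (2 * K * (r * gradMajorant s R r V + K * T)
        + K * jetMajorant s R r V * gradMajorant s R r V) := by
  have hRt : R ≠ ∞ := ne_top_of_le_ne_top ENNReal.one_ne_top hR1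
  have hrt : r ≠ ∞ := ne_top_of_le_ne_top ENNReal.one_ne_top hr1
  have h0 : R₁ ≠ 0 := fun h0 => hR0 (by
    rw [h0, nonpos_iff_eq_zero, mul_eq_zero] at hR
    exact hR.resolve_left two_ne_zero)
  have hAs := fun k l => h.smoothOn_comp_jet (hc.A_smooth j k l)
  have hZs := h.smoothOn_second j
  have hdiff := fun k l => (hc.A_comp j k l V h.smooth s R r hR0 hr0 hRt hrt hN).1
  have hterm : ∀ k l, majorant s R r (fun y => A j k l (jet V y).2 *
        (normalCoord y * partialDeriv k (partialDeriv l (V j)) y))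
      ≤ 2 * K * (r * gradMajorant s R r V + K * T)
        + K * jetMajorant s R r V * gradMajorant s R r V := by
    intro k l
    refine (majorant_mul_le (hAs k l) (hZs k l)).trans ?_
    by_cases hkl : k = Fin.last d ∧ l = Fin.last d
    · obtain ⟨rfl, rfl⟩ := hkl
      refine le_trans (mul_le_mul' ?_ ?_) le_add_self
      · have h1 := hdiff (Fin.last d) (Fin.last d)
        simp only [Prod.snd_zero, hc.A_normal, sub_zero] at h1
        exact h1
      · exact (majorant_weighted_normal_le
          ((h.smooth j).partialDeriv (isOpen_halfBall d) _)).trans (le_gradMajorant j _)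
    · refine le_trans (mul_le_mul' ?_ (h.majorant_second_le hR h0 ht hK j hkl)) le_self_add
      have h1 := majorant_add_le (s := s) (R := R) (r := r)
        ((hAs k l).sub (contDiffOn_const (c := A j k l 0))) (contDiffOn_const (c := A j k l 0))
      simp only [sub_add_cancel] at h1
      refine h1.trans ?_
      rw [two_mul]
      refine add_le_add ((hdiff k l).trans (hN.le.trans hc.one_le))
        ((majorant_const_le _).trans (hc.A_zero_le j k l))
  refine (majorant_sum_le _ fun k _ => ContDiffOn.sum fun l _ => (hAs k l).mul (hZs k l)).trans ?_
  refine (Finset.sum_le_sum fun k _ => (majorant_sum_le _ fun l _ => (hAs k l).mul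
    (hZs k l)).trans (Finset.sum_le_sum fun l _ => hterm k l)).trans (le_of_eq ?_)
  simp only [Finset.sum_const, Finset.card_univ, Fintype.card_fin, nsmul_eq_mul]
  push_cast
  ring

omit ht hK in
-- Write g as g(0), its linear part and a quadratic remainder. The linear part does not contain ∂_n
-- v, so it consists of v, which gains R, and of tangential derivatives, which gain r.
theorem majorant_source_le (j : Fin m) :
    majorant s R r (fun y => g j (jet V y))
      ≤ K * jetMajorant s R r V ^ 2 + ‖g j 0‖ₑ
        + K * (m * ε + R * gradMajorant s R r V
          + m * (d * (T + 2 * r * gradMajorant s R r V))) := by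
  have hRt : R ≠ ∞ := ne_top_of_le_ne_top ENNReal.one_ne_top hR1
  have hrt : r ≠ ∞ := ne_top_of_le_ne_top ENNReal.one_ne_top hr1
  have hgs := h.smoothOn_comp_jet (hc.g_smooth j)
  have hcomps := smoothOn_comps h.smooth
  have hlin : ∀ y, fderiv ℝ (g j) 0 (jet V y)
      = ∑ a, fderiv ℝ (g j) 0 (stateBasis a) * comps V a y := fun y => by
    rw [jet, ofComps, map_sum]
    exact Finset.sum_congr rfl fun a _ => by rw [map_smul, smul_eq_mul, mul_comm]
  have hls : SmoothOn (fun y => fderiv ℝ (g j) 0 (jet V y)) (halfBall d) := by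
    simp only [hlin]
    exact ContDiffOn.sum fun a _ => contDiffOn_const.mul (hcomps a)
  have hRR : R ≤ R₁ := le_trans (by rw [two_mul]; exact le_self_add) hR
  have h1 : majorant s R r (fun y => fderiv ℝ (g j) 0 (jet V y))
      ≤ K * (m * ε + R * gradMajorant s R r V
          + m * (d * (T + 2 * r * gradMajorant s R r V))) := by
    simp only [hlin]
    refine (majorant_sum_le _ fun a _ => contDiffOn_const.mul (hcomps a)).trans ?_
    refine (Finset.sum_le_sum fun a _ => majorant_const_mul_le _ (hcomps a)).trans ?_
    simp only [Fintype.sum_sum_type, Fintype.sum_prod_type, Fin.sum_univ_castSucc,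
      hc.g_deriv_normal, enorm_zero, zero_mul, add_zero]
    rw [mul_add]
    refine add_le_add ?_ ?_
    · refine (Finset.sum_le_sum fun i _ => mul_le_mul_left (hc.g_deriv_le j _) _).trans ?_
      rw [← Finset.mul_sum]
      exact mul_le_mul_right (h.sum_majorant_le hr1) _
    · refine (Finset.sum_le_sum fun i _ => Finset.sum_le_sum fun l _ =>
        mul_le_mul' (hc.g_deriv_le j _) (majorant_le_weightedMajorant.trans
          (h.weightedMajorant_tangential_le hRR i (Fin.castSucc_lt_last l).ne))).trans
        (le_of_eq ?_)
      simp only [Finset.sum_const, Finset.card_univ, Fintype.card_fin, nsmul_eq_mul]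
      ring
  have h2 := (hc.g_comp j V h.smooth s R r hR0 hr0 hRt hrt hN).2
  have h3 := majorant_add_le (s := s) (R := R) (r := r)
    (((hgs.sub (contDiffOn_const (c := g j 0))).sub hls).add (contDiffOn_const (c := g j 0))) hls
  have h4 := majorant_add_le (s := s) (R := R) (r := r)
    ((hgs.sub (contDiffOn_const (c := g j 0))).sub hls) (contDiffOn_const (c := g j 0))
  have e : (fun y => g j (jet V y)) = fun y => g j (jet V y) - g j 0
      - fderiv ℝ (g j) 0 (jet V y) + g j 0 + fderiv ℝ (g j) 0 (jet V y) := by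
    ext y; ring
  rw [e]
  exact h3.trans (add_le_add (h4.trans (add_le_add h2 (majorant_const_le _))) h1)

omit hc hR0 hr0 hr1 hR1 hR ht hK hN in
theorem equation (j : Fin m) {y : Space d} (hy : y ∈ halfBall d) :
    normalCoord y * partialDeriv (Fin.last d) (partialDeriv (Fin.last d) (V j)) y
        + γ j * partialDeriv (Fin.last d) (V j) y
      = ∑ k, ∑ l, A j k l (jet V y).2 * (normalCoord y * partialDeriv k (partialDeriv l (V j)) y)
        + g j (jet V y) := by
  rw [h.solution j y hy]
  simp only [Finset.mul_sum]
  congr 1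
  exact Finset.sum_congr rfl fun k _ => Finset.sum_congr rfl fun l _ => by ring

/-- The quantitative estimate for all derivatives up to order `s`. -/
theorem gradMajorant_le {G : ℝ≥0∞} (hG : ∀ j, ‖g j 0‖ₑ ≤ G) :
    gradMajorant s R r V ≤ m * (d * (T + 2 * r * gradMajorant s R r V)
      + 3 * ((d + 1) ^ 2 * (2 * K * (r * gradMajorant s R r V + K * T)
        + K * jetMajorant s R r V * gradMajorant s R r V)
        + (K * jetMajorant s R r V ^ 2 + G + K * (m * ε + R * gradMajorant s R r V
          + m * (d * (T + 2 * r * gradMajorant s R r V)))))) := by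
  have hU := isOpen_halfBall d
  have hRR : R ≤ R₁ := le_trans (by rw [two_mul]; exact le_self_add) hR
  set X := gradMajorant s R r V with hX
  have key : ∀ j, ∑ i, weightedMajorant s R r (partialDeriv i (V j))
      ≤ d * (T + 2 * r * X) + 3 * ((d + 1) ^ 2 * (2 * K * (r * X + K * T)
        + K * jetMajorant s R r V * X)
        + (K * jetMajorant s R r V ^ 2 + G + K * (m * ε + R * X
          + m * (d * (T + 2 * r * X))))) := by
    intro j
    rw [Fin.sum_univ_castSucc]
    refine add_le_add ?_ ?_
    · refine (Finset.sum_le_sum fun l _ =>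
        h.weightedMajorant_tangential_le hRR j (Fin.castSucc_lt_last l).ne).trans (le_of_eq ?_)
      simp only [Finset.sum_const, Finset.card_univ, Fintype.card_fin, nsmul_eq_mul, hX]
    · refine (weightedMajorant_le_of_fuchsian (hc.one_lt_exponent j).le
        ((h.smooth j).partialDeriv hU _) (h.bounded j _) fun y hy => h.equation j hy).trans ?_
      refine mul_le_mul_right ?_ _
      refine (majorant_add_le (ContDiffOn.sum fun k _ => ContDiffOn.sum fun l _ =>
        (h.smoothOn_comp_jet (hc.A_smooth j k l)).mul (h.smoothOn_second j k l))
        (h.smoothOn_comp_jet (hc.g_smooth j))).trans (add_le_add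
          (h.majorant_principal_le hc hR0 hr0 hr1 hR1 hR ht hK hN j)
          ((h.majorant_source_le hc hR0 hr0 hr1 hR1 hR hN j).trans ?_))
      gcongr
      exact hG j
  refine (Finset.sum_le_sum fun j _ => key j).trans (le_of_eq ?_)
  simp only [Finset.sum_const, Finset.card_univ, Fintype.card_fin, nsmul_eq_mul]

/-- The inhomogeneity at the origin is controlled by the solution. -/
theorem source_zero_le (j : Fin m) :
    ‖g j 0‖ₑ ≤ K * jetMajorant s R r V + (1 + K) * gradMajorant s R r V
      + (d + 1) ^ 2 * (2 * K * (r * gradMajorant s R r V + K * T)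
        + K * jetMajorant s R r V * gradMajorant s R r V) := by
  have hRt : R ≠ ∞ := ne_top_of_le_ne_top ENNReal.one_ne_top hR1
  have hrt : r ≠ ∞ := ne_top_of_le_ne_top ENNReal.one_ne_top hr1
  have hu := (h.smooth j).partialDeriv (isOpen_halfBall d) (Fin.last d)
  obtain ⟨y, hy⟩ : (halfBall d).Nonempty := by
    refine ⟨(1 / 2 : ℝ) • dir (Fin.last d), ?_, ?_⟩
    · rw [norm_smul]; simp [dir]; norm_num
    · simp [normalCoord, dir]
  -- The equation at one interior point, solved for g(0). All other terms are bounded by majorants.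
  have e : g j 0 = -(g j (jet V y) - g j 0)
      + (normalCoord y * partialDeriv (Fin.last d) (partialDeriv (Fin.last d) (V j)) y
        + γ j * partialDeriv (Fin.last d) (V j) y)
      + -(∑ k, ∑ l, A j k l (jet V y).2 *
        (normalCoord y * partialDeriv k (partialDeriv l (V j)) y)) := by
    rw [h.equation j hy]; ring
  have hsup : ∀ {f : Space d → ℝ}, ‖f y‖ₑ ≤ majorant s R r f := fun {f} =>
    (le_supNorm hy).trans supNorm_le_majorant
  rw [e]
  refine (enorm_add_le _ _).trans (add_le_add ((enorm_add_le _ _).trans (add_le_add ?_ ?_)) ?_)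
  · rw [enorm_neg]
    exact (hsup (f := fun y => g j (jet V y) - g j 0)).trans
      (hc.g_comp j V h.smooth s R r hR0 hr0 hRt hrt hN).1
  · rw [add_mul, one_mul]
    refine (enorm_add_le _ _).trans (add_le_add ?_ ?_)
    · exact (hsup (f := fun y => normalCoord y *
        partialDeriv (Fin.last d) (partialDeriv (Fin.last d) (V j)) y)).trans
          ((majorant_weighted_normal_le hu).trans (le_gradMajorant j _))
    · rw [enorm_mul]
      exact mul_le_mul' (hc.exponent_le j)
        (hsup.trans (majorant_le_weightedMajorant.trans (le_gradMajorant j _)))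
  · rw [enorm_neg]
    exact (hsup (f := fun y => ∑ k, ∑ l, A j k l (jet V y).2 *
        (normalCoord y * partialDeriv k (partialDeriv l (V j)) y))).trans
      (h.majorant_principal_le hc hR0 hr0 hr1 hR1 hR ht hK hN j)

end ControlledSolution

end Estimate

end DegenerateSystem

namespace DegenerateSystem
open Set Filter Topology

variable {d m : ℕ}

/-! ### Finiteness of the majorants and their values at radius zero -/

section Finiteness

theorem finite_order_le (k : ℕ) : {μ : MultiIndex d | order μ ≤ k}.Finite :=
  (Set.finite_Icc (0 : MultiIndex d) fun _ => k).subset fun μ hμ =>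
    ⟨fun _ => Nat.zero_le _, fun i => (le_order μ i).trans hμ⟩

variable {f : Space d → ℝ} {s k : ℕ} {R r : ℝ≥0∞}

theorem weightedTerm_ne_top (hf : SmoothOn f (halfBall d))
    (hb : ∀ μ : MultiIndex d, BoundedOn (multiDeriv μ f)) (μ : MultiIndex d) :
    weightedTerm μ f ≠ ∞ := by
  refine ENNReal.add_ne_top.2 ⟨?_, ENNReal.mul_ne_top ?_ (hb μ).supNorm_lt_top.ne⟩
  · refine ne_top_of_le_ne_top ?_ supNorm_normalCoord_mul_le
    exact ((hb (μ + unitIndex (Fin.last d))).congr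
      (multiDeriv_add_unit (isOpen_halfBall d) hf μ _)).supNorm_lt_top.ne
  · exact_mod_cast ENNReal.natCast_ne_top (μ (Fin.last d) + 1)

/-- There are finitely many multi-indices of a given order. This is where the qualitative
boundedness of all derivatives enters the continuity argument. -/
theorem weightedSup_ne_top (hf : SmoothOn f (halfBall d))
    (hb : ∀ μ : MultiIndex d, BoundedOn (multiDeriv μ f)) (hr : r ≠ ∞) :
    weightedSup r k f ≠ ∞ := by
  have hfin : {μ : MultiIndex d | order μ = k}.Finite :=
    (finite_order_le k).subset fun μ hμ => le_of_eq hμ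
  refine ne_top_of_le_ne_top (b := ∑ μ ∈ hfin.toFinset, r ^ μ (Fin.last d) * weightedTerm μ f) ?_
    (weightedSup_le_iff.2 fun μ hμ => ?_)
  · exact ENNReal.sum_ne_top.2 fun μ _ => ENNReal.mul_ne_top (ENNReal.pow_ne_top hr)
      (weightedTerm_ne_top hf hb μ)
  · exact Finset.single_le_sum (f := fun μ => r ^ μ (Fin.last d) * weightedTerm μ f)
      (fun _ _ => zero_le) (hfin.mem_toFinset.2 hμ)

theorem weightedMajorant_at_zero_le :
    weightedMajorant 0 R r f ≤ tangentialMajorant 0 R f := by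
  simp only [weightedMajorant, tangentialMajorant, zero_add, Finset.sum_range_one]
  refine mul_le_mul_right (weightedSup_le_iff.2 fun μ hμ => ?_) _
  rw [eq_zero_of_order hμ]
  have := le_tangentialSup (f := f) (μ := (0 : MultiIndex d)) rfl
  rw [order_zero] at this
  simpa using this

theorem weightedMajorant_zero_radius (R : ℝ≥0∞) :
    weightedMajorant s 0 r f = weightedMajorant 0 R r f := by
  rw [weightedMajorant, weightedMajorant, zero_add, Finset.sum_range_one,
    Finset.sum_eq_single 0 (fun k _ hk => by rw [zero_pow hk, ENNReal.zero_div, zero_mul])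
      (fun h => absurd (Finset.mem_range.2 (Nat.succ_pos s)) h)]
  simp

end Finiteness

/-! ### Absorption and continuity in the radius -/

section Continuity

/-- Absorption in [0, ∞], where cancelling X is legitimate only because X is finite. -/
theorem le_two_mul_of_le_add {X a c : ℝ≥0∞} (hX : X ≠ ∞) (hc : c ≤ 2⁻¹) (h : X ≤ a + c * X) :
    X ≤ 2 * a := by
  have h1 : 2 * X ≤ 2 * a + X := by
    calc 2 * X ≤ 2 * (a + 2⁻¹ * X) := by gcongr; exact h.trans (by gcongr)
      _ = 2 * a + X := by
        rw [mul_add, ← mul_assoc, ENNReal.mul_inv_cancel (by norm_num) (by norm_num), one_mul]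
  rw [two_mul X] at h1
  exact ENNReal.le_of_add_le_add_right hX h1

variable {γ : Fin m → ℝ} {A : Fin m → Fin (d + 1) → Fin (d + 1) → Grad d m → ℝ}
  {g : Fin m → State d m → ℝ} {ρ : ℝ} {K R₁ ε C R r : ℝ≥0∞} {V : Fin m → Space d → ℝ} {s : ℕ}

theorem gradMajorant_at_zero_le (h : ControlledSolution γ A g ρ R₁ ε (C * ε) V) :
    gradMajorant 0 R r V ≤ m * (d + 1) * C * ε := by
  have h1 : ∀ j i, weightedMajorant 0 R r (partialDeriv i (V j)) ≤ C * ε := fun j i => by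
    refine le_trans ?_ (h.tangential_le j i 0)
    refine weightedMajorant_at_zero_le.trans (le_of_eq ?_)
    simp [tangentialMajorant]
  refine (Finset.sum_le_sum fun j _ => Finset.sum_le_sum fun i _ => h1 j i).trans (le_of_eq ?_)
  simp only [Finset.sum_const, Finset.card_univ, Fintype.card_fin, nsmul_eq_mul]
  push_cast
  ring

/-- The constant in front of the data in the a priori estimate. -/
noncomputable def dataConst (d m : ℕ) (K C : ℝ≥0∞) : ℝ≥0∞ :=
  m * (d * C + 3 * ((d + 1) ^ 2 * (2 * K * (K * C)) + (m + (K * (m + 2 * (m * (d + 1) * C))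
    + (1 + K) * (m * (d + 1) * C) + (d + 1) ^ 2 * (2 * K * (m * (d + 1) * C + K * C)
    + m * (d + 1) * C)) + K * (m + m * (d * C)))))

/-- The constant in front of the terms to be absorbed in the a priori estimate. -/
noncomputable def absorbConst (d m : ℕ) (K : ℝ≥0∞) : ℝ≥0∞ :=
  m * (d * 2 + 3 * ((d + 1) ^ 2 * (2 * K) + K * (m * (d * 2)))) + m * (3 * K)
    + m * (3 * ((d + 1) ^ 2 * K + 2 * K))

theorem dataConst_ne_top (hK : K ≠ ∞) (hC : C ≠ ∞) : dataConst d m K C ≠ ∞ := by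
  lift K to NNReal using hK
  lift C to NNReal using hC
  rw [dataConst]
  exact_mod_cast ENNReal.coe_ne_top

theorem absorbConst_ne_top (hK : K ≠ ∞) : absorbConst d m K ≠ ∞ := by
  lift K to NNReal using hK
  rw [absorbConst]
  exact_mod_cast ENNReal.coe_ne_top

/-- Sorts the terms of the a priori estimate into multiples of ε and multiples of X with a factor r,
R or N. The inhomogeneity g(0) is estimated at truncation s = 0, where the majorant of ∇v is O(ε) by
hypothesis, so that it does not feed back into X. -/
theorem gradMajorant_absorbed_le (hc : CoeffBounds γ A g ρ K)
    (h : ControlledSolution γ A g ρ R₁ ε (C * ε) V) (hR0 : R ≠ 0) (hr0 : r ≠ 0) (hr1 : r ≤ 1)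
    (hR1 : R ≤ 1) (hR : 2 * R ≤ R₁) (ht : R₁ ≠ ∞) (hK : R₁⁻¹ ≤ K)
    (hN : K * jetMajorant s R r V < 1) (hN0 : K * jetMajorant 0 R r V < 1) :
    gradMajorant s R r V ≤ dataConst d m K C * ε
      + absorbConst d m K * (r + R + jetMajorant s R r V) * gradMajorant s R r V := by
  set Γ := K * (m + 2 * (m * (d + 1) * C)) + (1 + K) * (m * (d + 1) * C)
      + (d + 1) ^ 2 * (2 * K * (m * (d + 1) * C + K * C) + m * (d + 1) * C) with hΓ
  have hG : ∀ j, ‖g j 0‖ₑ ≤ Γ * ε := by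
    intro j
    have hX0 := gradMajorant_at_zero_le (R := R) (r := r) h
    have hJ0 := h.jetMajorant_le (s := 0) hr1 hR1
    have h1 := h.source_zero_le hc hR0 hr0 hr1 hR1 hR ht hK hN0 j
    set X₀ := gradMajorant 0 R r V
    set N₀ := jetMajorant 0 R r V
    calc ‖g j 0‖ₑ ≤ _ := h1
      _ ≤ K * (m * ε + 2 * X₀) + (1 + K) * X₀
          + (d + 1) ^ 2 * (2 * K * (1 * X₀ + K * (C * ε)) + 1 * X₀) := by
        gcongr
      _ ≤ K * (m * ε + 2 * (m * (d + 1) * C * ε)) + (1 + K) * (m * (d + 1) * C * ε)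
          + (d + 1) ^ 2 * (2 * K * (1 * (m * (d + 1) * C * ε) + K * (C * ε))
            + 1 * (m * (d + 1) * C * ε)) := by
        gcongr
      _ = Γ * ε := by rw [hΓ]; ring
  have hJ := h.jetMajorant_le (s := s) hr1 hR1
  have h2 := h.gradMajorant_le hc hR0 hr0 hr1 hR1 hR ht hK hN hG
  set X := gradMajorant s R r V
  set N := jetMajorant s R r V
  -- In N² one factor is replaced by m ε + 2 X. The other stays small through K N < 1 in front of ε,
  -- and is kept as N in front of X.
  have h3 : K * N ^ 2 ≤ m * ε + 2 * K * N * X := by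
    calc K * N ^ 2 = K * N * N := by ring
      _ ≤ K * N * (m * ε + 2 * X) := by gcongr
      _ = K * N * (m * ε) + 2 * K * N * X := by ring
      _ ≤ 1 * (m * ε) + 2 * K * N * X := by gcongr
      _ = _ := by rw [one_mul]
  refine h2.trans ?_
  calc _ ≤ (m : ℝ≥0∞) * (d * (C * ε + 2 * r * X)
      + 3 * ((d + 1) ^ 2 * (2 * K * (r * X + K * (C * ε)) + K * N * X)
        + ((m * ε + 2 * K * N * X) + Γ * ε + K * (m * ε + R * X
          + m * (d * (C * ε + 2 * r * X)))))) := by gcongr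
    _ = dataConst d m K C * ε
        + (m * (d * 2 + 3 * ((d + 1) ^ 2 * (2 * K) + K * (m * (d * 2)))) * r + m * (3 * K) * R
          + m * (3 * ((d + 1) ^ 2 * K + 2 * K)) * N) * X := by
      rw [dataConst, hΓ]; ring
    _ ≤ dataConst d m K C * ε
        + (absorbConst d m K * r + absorbConst d m K * R + absorbConst d m K * N) * X := by
      have h4 : (m : ℝ≥0∞) * (d * 2 + 3 * ((d + 1) ^ 2 * (2 * K) + K * (m * (d * 2))))
          ≤ absorbConst d m K := le_self_add.trans le_self_add
      have h5 : (m : ℝ≥0∞) * (3 * K) ≤ absorbConst d m K := le_add_self.trans le_self_add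
      have h6 : (m : ℝ≥0∞) * (3 * ((d + 1) ^ 2 * K + 2 * K)) ≤ absorbConst d m K := le_add_self
      exact add_le_add_right (mul_le_mul_left (add_le_add (add_le_add (mul_le_mul_left h4 _)
        (mul_le_mul_left h5 _)) (mul_le_mul_left h6 _)) _) _
    _ = _ := by ring

/-- All derivatives of the gradient are controlled by the data, in a fixed radius. -/
theorem exists_gradMajorant_le (hc : CoeffBounds γ A g ρ K) (hKt : K ≠ ∞) (hC : C ≠ ∞)
    (hR₁ : R₁ ≠ 0) (ht : R₁ ≠ ∞) (hK : R₁⁻¹ ≤ K) :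
    ∃ R₀ : ℝ, 0 < R₀ ∧ R₀ < 1 ∧ ∃ C₂ ε₁ : ℝ, 0 ≤ C₂ ∧ 0 < ε₁ ∧ ∀ ε : ℝ, 0 < ε → ε ≤ ε₁ →
      ∀ V : Fin m → Space d → ℝ,
      ControlledSolution γ A g ρ R₁ (ENNReal.ofReal ε) (C * ENNReal.ofReal ε) V →
      ∀ s, gradMajorant s (ENNReal.ofReal R₀) (ENNReal.ofReal R₀) V ≤ ENNReal.ofReal (C₂ * ε) := by
  set a := (dataConst d m K C).toReal with ha
  set b := (absorbConst d m K).toReal with hb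
  set c := ((m : ℝ≥0∞) * (d + 1) * C).toReal with hcdef
  have ha0 : 0 ≤ a := ENNReal.toReal_nonneg
  have hb0 : 0 ≤ b := ENNReal.toReal_nonneg
  have hc0 : 0 ≤ c := ENNReal.toReal_nonneg
  have hae : dataConst d m K C = ENNReal.ofReal a :=
    (ENNReal.ofReal_toReal (dataConst_ne_top hKt hC)).symm
  have hbe : absorbConst d m K = ENNReal.ofReal b :=
    (ENNReal.ofReal_toReal (absorbConst_ne_top hKt)).symm
  have hce : (m : ℝ≥0∞) * (d + 1) * C = ENNReal.ofReal c := by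
    refine (ENNReal.ofReal_toReal (ENNReal.mul_ne_top (ENNReal.mul_ne_top ?_ ?_) hC)).symm
    · exact ENNReal.natCast_ne_top m
    · exact_mod_cast ENNReal.natCast_ne_top (d + 1)
  set K' := K.toReal with hK'
  have hK'0 : 0 ≤ K' := ENNReal.toReal_nonneg
  have hKe : K = ENNReal.ofReal K' := (ENNReal.ofReal_toReal hKt).symm
  set ρ₁ := R₁.toReal with hρ₁
  have hρ₁0 : 0 < ρ₁ := ENNReal.toReal_pos hR₁ ht
  have hR₁e : R₁ = ENNReal.ofReal ρ₁ := (ENNReal.ofReal_toReal ht).symm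
  -- If X ≤ δ then N ≤ 3δ. The choice gives (1 + K' + 4b) · 3δ = 3/4, hence both K N < 1 and b · 3δ
  -- ≤ 3/16.
  set δ : ℝ := 1 / (4 * (1 + K' + 4 * b)) with hδ
  have hδ0 : 0 < δ := by positivity
  -- The three bounds give R₀ < 1, 2 R₀ ≤ R₁ and b R₀ ≤ 1/8. With r = R₀ and R ≤ R₀ the absorbed
  -- factor is at most 1/8 + 1/8 + 3/16 < 1/2.
  set R₀ : ℝ := min (min (1 / 2) (ρ₁ / 2)) (1 / (8 * (b + 1))) with hR₀
  have hR₀0 : 0 < R₀ := by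
    refine lt_min (lt_min (by norm_num) (by positivity)) (by positivity)
  have hR₀1 : R₀ ≤ 1 / 2 := (min_le_left _ _).trans (min_le_left _ _)
  have hR₀2 : R₀ ≤ ρ₁ / 2 := (min_le_left _ _).trans (min_le_right _ _)
  have hR₀3 : b * R₀ ≤ 1 / 8 := by
    have h1 : R₀ ≤ 1 / (8 * (b + 1)) := min_le_right _ _
    rw [le_div_iff₀ (by positivity)] at h1
    nlinarith
  -- The three bounds on ε ensure m ε ≤ δ (values of v), c ε < δ (start at R = 0) and 2aε < δ (the
  -- improved bound lies strictly below the threshold).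
  refine ⟨R₀, hR₀0, by linarith, 2 * a, min (δ / (m + 1)) (min (δ / (2 * c + 1)) (δ / (4 * a + 1))),
    by positivity, ?_, ?_⟩
  · refine lt_min ?_ (lt_min ?_ ?_) <;> positivity
  intro ε hε hεle V h s
  have hε1 : m * ε ≤ δ := by
    have h1 := hεle.trans (min_le_left _ _)
    rw [le_div_iff₀ (by positivity)] at h1
    linarith
  have hε2 : c * ε < δ := by
    have h1 := hεle.trans ((min_le_right _ _).trans (min_le_left _ _))
    rw [le_div_iff₀ (by positivity)] at h1
    nlinarith
  have hε3 : 2 * a * ε < δ := by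
    have h1 := hεle.trans ((min_le_right _ _).trans (min_le_right _ _))
    rw [le_div_iff₀ (by positivity)] at h1
    nlinarith
  set r := ENNReal.ofReal R₀ with hr
  have hr0 : r ≠ 0 := (ENNReal.ofReal_pos.2 hR₀0).ne'
  have hr1 : r ≤ 1 := ENNReal.ofReal_le_one.2 (by linarith)
  -- smallness of the jet
  have hjet : ∀ {s R}, R ≤ 1 → gradMajorant s R r V ≤ ENNReal.ofReal δ →
      jetMajorant s R r V ≤ ENNReal.ofReal (3 * δ) := fun {s R} hR1 hX => by
    refine (h.jetMajorant_le hr1 hR1).trans ?_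
    have e : ENNReal.ofReal (3 * δ) = ENNReal.ofReal δ + 2 * ENNReal.ofReal δ := by
      rw [← ENNReal.ofReal_ofNat, ← ENNReal.ofReal_mul (by norm_num),
        ← ENNReal.ofReal_add hδ0.le (by positivity)]
      congr 1; ring
    rw [e]
    refine add_le_add ?_ (mul_le_mul_right hX _)
    rw [← ENNReal.ofReal_natCast, ← ENNReal.ofReal_mul (Nat.cast_nonneg _)]
    exact ENNReal.ofReal_le_ofReal hε1
  have hq : (1 + K' + 4 * b) * (3 * δ) = 3 / 4 := by
    rw [hδ]; field_simp
  have hKN : ∀ {s R}, R ≤ 1 → gradMajorant s R r V ≤ ENNReal.ofReal δ →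
      K * jetMajorant s R r V < 1 := fun {s R} hR1 hX => by
    refine (mul_le_mul_right (hjet hR1 hX) K).trans_lt ?_
    rw [hKe, ← ENNReal.ofReal_mul hK'0, ENNReal.ofReal_lt_one]
    nlinarith
  have hzero : ∀ R, gradMajorant 0 R r V ≤ ENNReal.ofReal (c * ε) := fun R => by
    refine (gradMajorant_at_zero_le h).trans (le_of_eq ?_)
    rw [hce, ENNReal.ofReal_mul hc0]
  -- the absorption argument
  have hstep : ∀ R : ℝ, 0 < R → R ≤ R₀ → gradMajorant s (ENNReal.ofReal R) r V ≤ ENNReal.ofReal δ →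
      gradMajorant s (ENNReal.ofReal R) r V ≤ ENNReal.ofReal (2 * a * ε) := by
    intro R hRpos hRle hX
    have hR1 : ENNReal.ofReal R ≤ 1 := ENNReal.ofReal_le_one.2 (by linarith)
    have hR2 : 2 * ENNReal.ofReal R ≤ R₁ := by
      rw [hR₁e, ← ENNReal.ofReal_ofNat, ← ENNReal.ofReal_mul (by norm_num)]
      exact ENNReal.ofReal_le_ofReal (by linarith)
    have h1 := gradMajorant_absorbed_le hc h (ENNReal.ofReal_pos.2 hRpos).ne' hr0 hr1 hR1 hR2 ht hK
      (hKN hR1 hX) (hKN hR1 ((hzero _).trans (ENNReal.ofReal_le_ofReal hε2.le)))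
    have h2 := le_two_mul_of_le_add (ne_top_of_le_ne_top ENNReal.ofReal_ne_top hX) ?_ h1
    · refine h2.trans (le_of_eq ?_)
      rw [hae, mul_assoc, ENNReal.ofReal_mul (by norm_num), ENNReal.ofReal_mul ha0,
        ENNReal.ofReal_ofNat]
    · have h3 : r + ENNReal.ofReal R + jetMajorant s (ENNReal.ofReal R) r V
          ≤ ENNReal.ofReal (R₀ + R + 3 * δ) := by
        rw [ENNReal.ofReal_add (by positivity) (by positivity), ENNReal.ofReal_add hR₀0.le hRpos.le]
        exact add_le_add le_rfl (hjet hR1 hX)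
      refine (mul_le_mul_right h3 _).trans ?_
      rw [hbe, ← ENNReal.ofReal_mul hb0]
      have e : (2 : ℝ≥0∞)⁻¹ = ENNReal.ofReal (1 / 2) := by
        rw [one_div, ENNReal.ofReal_inv_of_pos (by norm_num), ENNReal.ofReal_ofNat]
      rw [e]
      refine ENNReal.ofReal_le_ofReal ?_
      nlinarith
  -- continuity in the radius
  set w : ℕ → ℝ := fun k => (∑ j, ∑ i, weightedSup r k (partialDeriv i (V j))).toReal with hw
  have hwe : ∀ k, ∑ j, ∑ i, weightedSup r k (partialDeriv i (V j)) = ENNReal.ofReal (w k) :=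
    fun k => (ENNReal.ofReal_toReal (ENNReal.sum_ne_top.2 fun j _ => ENNReal.sum_ne_top.2 fun i _ =>
      weightedSup_ne_top ((h.smooth j).partialDeriv (isOpen_halfBall d) i) (h.bounded j i)
        ENNReal.ofReal_ne_top)).symm
  have hw0 : ∀ k, 0 ≤ w k := fun k => ENNReal.toReal_nonneg
  -- By truncation at s and finiteness of the coefficients, X is a polynomial in R, hence
  -- continuous.
  set φ : ℝ → ℝ := fun R => ∑ k ∈ Finset.range (s + 1), R ^ k / (k.factorial : ℝ) * w k with hφ
  have hφc : Continuous φ := by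
    refine continuous_finsetSum _ fun k _ => ?_
    exact ((continuous_pow k).div_const _).mul continuous_const
  have hφe : ∀ R : ℝ, 0 ≤ R → gradMajorant s (ENNReal.ofReal R) r V = ENNReal.ofReal (φ R) := by
    intro R hR
    have h1 : gradMajorant s (ENNReal.ofReal R) r V = ∑ k ∈ Finset.range (s + 1),
        ENNReal.ofReal R ^ k / (k.factorial : ℝ≥0∞)
          * ∑ j, ∑ i, weightedSup r k (partialDeriv i (V j)) := by
      simp only [gradMajorant, weightedMajorant, Finset.mul_sum]
      exact (Finset.sum_congr rfl fun j _ => Finset.sum_comm).trans Finset.sum_comm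
    rw [h1, hφ, ENNReal.ofReal_sum_of_nonneg fun k _ => mul_nonneg (by positivity) (hw0 k)]
    refine Finset.sum_congr rfl fun k _ => ?_
    rw [hwe, ENNReal.ofReal_mul (by positivity), ENNReal.ofReal_div_of_pos (by positivity),
      ENNReal.ofReal_pow hR, ENNReal.ofReal_natCast]
  have hφ0 : φ 0 < δ := by
    have h1 : gradMajorant s (ENNReal.ofReal 0) r V ≤ ENNReal.ofReal (c * ε) := by
      refine le_trans (le_of_eq ?_) (hzero 0)
      simp only [gradMajorant, ENNReal.ofReal_zero]
      exact Finset.sum_congr rfl fun j _ => Finset.sum_congr rfl fun i _ =>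
        weightedMajorant_zero_radius 0
    rw [hφe 0 le_rfl, ENNReal.ofReal_le_ofReal_iff (by positivity)] at h1
    exact h1.trans_lt hε2
  -- Otherwise φ takes the value δ at some R in (0, R₀], where the improved bound gives φ(R) ≤ 2aε <
  -- δ.
  have hφR : φ R₀ ≤ δ := by
    by_contra! hlt
    obtain ⟨R, hR, hRe⟩ := intermediate_value_Icc hR₀0.le hφc.continuousOn ⟨hφ0.le, hlt.le⟩
    have hRpos : 0 < R := by
      refine lt_of_le_of_ne hR.1 fun h0 => ?_
      rw [← h0] at hRe
      exact hφ0.ne hRe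
    have h1 := hstep R hRpos hR.2 (by rw [hφe R hR.1, hRe])
    rw [hφe R hR.1, hRe, ENNReal.ofReal_le_ofReal_iff (by positivity)] at h1
    linarith
  exact hstep R₀ hR₀0 le_rfl (by rw [hφe R₀ hR₀0.le]; exact ENNReal.ofReal_le_ofReal hφR)

end Continuity

end DegenerateSystem

namespace DegenerateSystem
open Set Filter Topology

variable {d m : ℕ}

/-! ### Taylor series and analytic extension to the closure -/

section Taylor

/-- A one-dimensional Taylor expansion under factorial bounds on the derivatives. -/
theorem hasSum_taylor {Φ : ℕ → ℝ → ℝ} {C q : ℝ} (hq0 : 0 ≤ q) (hq : q < 1)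
    (hder : ∀ n, ∀ t ∈ Icc (0 : ℝ) 1, HasDerivAt (Φ n) (Φ (n + 1) t) t)
    (hbound : ∀ n, ∀ t ∈ Icc (0 : ℝ) 1, |Φ n t| ≤ C * n.factorial * q ^ n) :
    HasSum (fun n => Φ n 0 / n.factorial) (Φ 0 1) := by
  have hf : ∀ n : ℕ, (0 : ℝ) < n.factorial := fun n => by exact_mod_cast n.factorial_pos
  have hsum : Summable fun n => ‖Φ n 0 / n.factorial‖ := by
    refine Summable.of_nonneg_of_le (fun _ => norm_nonneg _) (fun n => ?_)
      ((summable_geometric_of_lt_one hq0 hq).mul_left C)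
    rw [norm_div, Real.norm_eq_abs, Real.norm_of_nonneg (hf n).le, div_le_iff₀ (hf n)]
    calc _ ≤ _ := hbound n 0 (by simp)
      _ = _ := by ring
  refine (hasSum_iff_tendsto_nat_of_summable_norm hsum).2 ?_
  rw [← tendsto_add_atTop_iff_nat 1]
  -- The Taylor polynomial at t evaluated at 1. Its derivative in t telescopes to one term; at t = 1
  -- it equals Φ 0 1, and at t = 0 it is the partial sum.
  set S : ℕ → ℝ → ℝ := fun N t => ∑ n ∈ Finset.range N, Φ n t * (1 - t) ^ n / n.factorial with hS
  have hSd : ∀ N, ∀ t ∈ Icc (0 : ℝ) 1,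
      HasDerivAt (S (N + 1)) (Φ (N + 1) t * (1 - t) ^ N / N.factorial) t := by
    intro N t ht
    induction N with
    | zero => simpa [hS] using hder 0 t ht
    | succ N ih =>
      have h1 : S (N + 1 + 1) = fun t => S (N + 1) t + Φ (N + 1) t * (1 - t) ^ (N + 1)
          / (N + 1).factorial := by
        ext t; simp only [hS]; rw [Finset.sum_range_succ]
      have h2 : HasDerivAt (fun t : ℝ => (1 - t) ^ (N + 1)) (-((N + 1 : ℕ) * (1 - t) ^ N)) t := by
        simpa using ((hasDerivAt_id t).const_sub 1).fun_pow (N + 1)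
      rw [h1]
      convert! ih.add (((hder (N + 1) t ht).mul h2).div_const _) using 1
      rw [Nat.factorial_succ]
      have := (hf N).ne'
      push_cast
      field_simp
      ring
  have hrem : ∀ N, ‖(∑ n ∈ Finset.range (N + 1), Φ n 0 / n.factorial) - Φ 0 1‖
      ≤ C * ((N + 1 : ℕ) * q ^ (N + 1)) := by
    intro N
    have h1 := norm_image_sub_le_of_norm_deriv_le_segment_01' (f := S (N + 1))
      (C := C * ((N + 1 : ℕ) * q ^ (N + 1)))
      (fun t ht => (hSd N t ht).hasDerivWithinAt) (fun t ht => ?_)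
    · have e1 : S (N + 1) 1 = Φ 0 1 := by
        simp only [hS, sub_self]
        rw [Finset.sum_eq_single 0 (fun n _ hn => by simp [hn])
          (fun h => absurd (Finset.mem_range.2 (Nat.succ_pos N)) h)]
        simp
      have e0 : S (N + 1) 0 = ∑ n ∈ Finset.range (N + 1), Φ n 0 / n.factorial := by
        simp [hS]
      rw [e1, e0, norm_sub_rev] at h1
      exact h1
    · have ht' : t ∈ Icc (0 : ℝ) 1 := ⟨ht.1, ht.2.le⟩
      have h2 : |1 - t| ≤ 1 := by rw [abs_le]; constructor <;> linarith [ht.1, ht.2]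
      rw [norm_div, norm_mul, norm_pow, Real.norm_eq_abs, Real.norm_eq_abs,
        Real.norm_of_nonneg (hf N).le, div_le_iff₀ (hf N)]
      calc _ ≤ |Φ (N + 1) t| * 1 := by
            gcongr
            exact pow_le_one₀ (abs_nonneg _) h2
        _ ≤ C * (N + 1).factorial * q ^ (N + 1) := by rw [mul_one]; exact hbound _ t ht'
        _ = _ := by rw [Nat.factorial_succ]; push_cast; ring
  have hlim : Tendsto (fun N : ℕ => C * ((N + 1 : ℕ) * q ^ (N + 1))) atTop (𝓝 0) := by
    have h1 := (tendsto_self_mul_const_pow_of_lt_one hq0 hq).const_mul C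
    rw [mul_zero] at h1
    exact (tendsto_add_atTop_iff_nat 1).2 h1
  exact tendsto_iff_norm_sub_tendsto_zero.2
    (squeeze_zero (fun _ => norm_nonneg _) hrem hlim)

/-- The multi-index of the iterated derivative along a word. -/
def wordIndex {n : ℕ} (σ : Fin n → Fin (d + 1)) : MultiIndex d := ∑ i, unitIndex (σ i)

theorem order_wordIndex {n : ℕ} (σ : Fin n → Fin (d + 1)) : order (wordIndex σ) = n := by
  induction n with
  | zero => simp [wordIndex, order]
  | succ n ih =>
    rw [wordIndex, Fin.sum_univ_succ, order_add, order_unitIndex]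
    have := ih fun i => σ i.succ
    rw [wordIndex] at this
    rw [this, add_comm]

variable {f : Space d → ℝ}

theorem fderiv_apply_eq_sum (y h : Space d) :
    fderiv ℝ f y h = ∑ i, h i * partialDeriv i f y := by
  have e : h = ∑ i, h i • dir i := by
    ext j
    simp [dir, Pi.single_apply]
  conv_lhs => rw [e]
  rw [map_sum]
  exact Finset.sum_congr rfl fun i _ => by rw [map_smul, smul_eq_mul]; rfl

/-- The `n`-th derivative along a line. -/
noncomputable def lineTaylor (f : Space d → ℝ) (h : Space d) (n : ℕ) (y : Space d) : ℝ :=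
  ∑ σ : Fin n → Fin (d + 1), (∏ i, h (σ i)) * multiDeriv (wordIndex σ) f y

/-- Summing over words instead of multi-indices avoids multinomial coefficients: differentiating
prepends a letter. -/
theorem hasDerivAt_lineTaylor (hf : SmoothOn f (halfBall d)) {b h : Space d} (n : ℕ) {t : ℝ}
    (ht : b + t • h ∈ halfBall d) :
    HasDerivAt (fun t : ℝ => lineTaylor f h n (b + t • h)) (lineTaylor f h (n + 1) (b + t • h)) t := by
  have hU := isOpen_halfBall d
  have hl : HasDerivAt (fun t : ℝ => b + t • h) h t := by
    simpa using ((hasDerivAt_id t).smul_const h).const_add b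
  have h1 : ∀ σ : Fin n → Fin (d + 1), HasDerivAt
      (fun t : ℝ => multiDeriv (wordIndex σ) f (b + t • h))
      (∑ i, h i * multiDeriv (wordIndex σ + unitIndex i) f (b + t • h)) t := by
    intro σ
    have h2 := ((multiDeriv_smooth hU hf (wordIndex σ)).differentiableAt hU
      ht).hasFDerivAt.comp_hasDerivAt t hl
    rw [fderiv_apply_eq_sum] at h2
    simp only [multiDeriv_add_unit hU hf _ _ ht]
    exact h2
  have h3 := HasDerivAt.fun_sum fun σ (_ : σ ∈ Finset.univ) => (h1 σ).const_mul (∏ i, h (σ i))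
  refine h3.congr_deriv ?_
  rw [lineTaylor, ← (Fin.consEquiv fun _ => Fin (d + 1)).sum_comp, Fintype.sum_prod_type,
    Finset.sum_comm]
  refine Finset.sum_congr rfl fun σ _ => ?_
  rw [Finset.mul_sum]
  refine Finset.sum_congr rfl fun i _ => ?_
  simp only [Fin.consEquiv_apply, wordIndex, Fin.prod_univ_succ, Fin.sum_univ_succ, Fin.cons_zero,
    Fin.cons_succ]
  rw [add_comm (unitIndex i)]
  ring

/-- The Taylor series at a point, as a formal power series. -/
noncomputable def taylorSeries (f : Space d → ℝ) (b : Space d) :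
    FormalMultilinearSeries ℝ (Space d) ℝ := fun n =>
  ∑ σ : Fin n → Fin (d + 1), (multiDeriv (wordIndex σ) f b / n.factorial) •
    (ContinuousMultilinearMap.mkPiAlgebra ℝ (Fin n) ℝ).compContinuousLinearMap
      fun i => (EuclideanSpace.proj (σ i) : Space d →L[ℝ] ℝ)

theorem taylorSeries_apply (b h : Space d) (n : ℕ) :
    taylorSeries f b n (fun _ => h) = lineTaylor f h n b / n.factorial := by
  rw [taylorSeries, sum_apply, lineTaylor, Finset.sum_div]
  refine Finset.sum_congr rfl fun σ _ => ?_
  simp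
  ring

variable {C ρ : ℝ}

/-- The factor (d + 1)^n counts the words of length n, each of which contributes at most C ρ^{-n}.
-/
theorem norm_taylorSeries_le (hC : 0 ≤ C) (hρ : 0 < ρ) {b : Space d}
    (hb : ∀ μ : MultiIndex d, |multiDeriv μ f b| ≤ C * (order μ).factorial * (ρ⁻¹) ^ order μ)
    (n : ℕ) : ‖taylorSeries f b n‖ ≤ C * ((d + 1) / ρ) ^ n := by
  have hf : (0 : ℝ) < n.factorial := by exact_mod_cast n.factorial_pos
  refine ContinuousMultilinearMap.opNorm_le_bound (by positivity) fun x => ?_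
  rw [taylorSeries, sum_apply]
  have h1 : ∀ σ : Fin n → Fin (d + 1), ‖(multiDeriv (wordIndex σ) f b / n.factorial) •
      ∏ i, x i (σ i)‖ ≤ C * (ρ⁻¹) ^ n * ∏ i, ‖x i‖ := by
    intro σ
    rw [norm_smul, norm_div, Real.norm_eq_abs, Real.norm_of_nonneg hf.le, norm_prod]
    refine mul_le_mul ?_ (Finset.prod_le_prod (fun _ _ => norm_nonneg _) fun i _ =>
      PiLp.norm_apply_le _ _) (Finset.prod_nonneg fun _ _ => norm_nonneg _) (by positivity)
    rw [div_le_iff₀ hf]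
    have := hb (wordIndex σ)
    rw [order_wordIndex] at this
    linarith
  refine (norm_sum_le _ _).trans ((Finset.sum_le_sum (g := fun _ => C * (ρ⁻¹) ^ n * ∏ i, ‖x i‖)
    fun σ _ => ?_).trans_eq ?_)
  · simpa using h1 σ
  · rw [Finset.sum_const, Finset.card_univ, Fintype.card_fun, Fintype.card_fin, Fintype.card_fin,
      nsmul_eq_mul, div_pow, inv_pow]
    push_cast
    field_simp

theorem abs_lineTaylor_le {y h : Space d}
    (hb : ∀ μ : MultiIndex d, |multiDeriv μ f y| ≤ C * (order μ).factorial * (ρ⁻¹) ^ order μ)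
    (n : ℕ) : |lineTaylor f h n y| ≤ C * n.factorial * ((d + 1) * ‖h‖ / ρ) ^ n := by
  have h1 : ∀ σ : Fin n → Fin (d + 1), |(∏ i, h (σ i)) * multiDeriv (wordIndex σ) f y|
      ≤ ‖h‖ ^ n * (C * n.factorial * (ρ⁻¹) ^ n) := by
    intro σ
    rw [abs_mul, Finset.abs_prod]
    have h2 := hb (wordIndex σ)
    rw [order_wordIndex] at h2
    refine mul_le_mul ?_ h2 (abs_nonneg _) (by positivity)
    refine (Finset.prod_le_prod (fun _ _ => abs_nonneg _) fun i _ =>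
      PiLp.norm_apply_le h (σ i)).trans_eq ?_
    simp
  refine (Finset.abs_sum_le_sum_abs _ _).trans ((Finset.sum_le_sum fun σ _ => h1 σ).trans_eq ?_)
  rw [Finset.sum_const, Finset.card_univ, Fintype.card_fun, Fintype.card_fin, Fintype.card_fin,
    nsmul_eq_mul, div_pow, mul_pow, inv_pow]
  push_cast
  field_simp

/-- A smooth function whose derivatives are bounded by `C k! ρ^{-k}` on the half ball extends
analytically to its closure. -/
theorem exists_analyticOn_closure (hC : 0 ≤ C) (hρ : 0 < ρ) (hf : SmoothOn f (halfBall d))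
    (hb : ∀ (μ : MultiIndex d), ∀ y ∈ halfBall d,
      |multiDeriv μ f y| ≤ C * (order μ).factorial * (ρ⁻¹) ^ order μ) :
    ∃ F : Space d → ℝ, AnalyticOn ℝ F (closure (halfBall d)) ∧ EqOn f F (halfBall d) := by
  have hd0 : (0 : ℝ) < d + 1 := by positivity
  -- A lower bound for the radius of convergence that does not depend on the centre b. This
  -- uniformity is what reaches the boundary.
  set η : NNReal := ⟨ρ / (d + 1), by positivity⟩ with hη
  have hηc : (η : ℝ) = ρ / (d + 1) := rfl
  have hη0 : 0 < η := by
    rw [← NNReal.coe_pos, hηc]; positivity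
  have hrad : ∀ b ∈ halfBall d, (η : ℝ≥0∞) ≤ (taylorSeries f b).radius := fun b hbU => by
    refine FormalMultilinearSeries.le_radius_of_bound _ C fun n => ?_
    refine (mul_le_mul_of_nonneg_right (norm_taylorSeries_le hC hρ (fun μ => hb μ b hbU) n)
      (by positivity)).trans (le_of_eq ?_)
    rw [hηc, mul_assoc, ← mul_pow]
    field_simp
    simp
  have hps : ∀ b ∈ halfBall d, HasFPowerSeriesOnBall (fun z => (taylorSeries f b).sum (z - b))
      (taylorSeries f b) b η := fun b hbU => by
    have h1 := (((taylorSeries f b).hasFPowerSeriesOnBall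
      (lt_of_lt_of_le (by exact_mod_cast hη0) (hrad b hbU))).mono (by exact_mod_cast hη0)
        (hrad b hbU)).comp_sub b
    rwa [zero_add] at h1
  have hmem : ∀ {b z : Space d}, z ∈ Metric.eball b η ↔ ‖z - b‖ < ρ / (d + 1) := fun {b z} => by
    rw [Metric.mem_eball, edist_nndist, ENNReal.coe_lt_coe, ← NNReal.coe_lt_coe, coe_nndist,
      dist_eq_norm, hηc]
  have heq : ∀ b ∈ halfBall d, ∀ z ∈ halfBall d, z ∈ Metric.eball b η →
      (taylorSeries f b).sum (z - b) = f z := by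
    intro b hbU z hz hzb
    rw [hmem] at hzb
    -- By convexity the derivative bounds hold along the whole segment from b to z, so the Taylor
    -- series at b represents f at z.
    have hseg : ∀ t ∈ Icc (0 : ℝ) 1, b + t • (z - b) ∈ halfBall d := fun t ht =>
      (convex_halfBall d).add_smul_sub_mem hbU hz ht
    have hq : (d + 1) * ‖z - b‖ / ρ < 1 := by
      rw [lt_div_iff₀ hd0] at hzb
      rw [div_lt_one hρ]
      linarith
    have h1 := hasSum_taylor (Φ := fun n t => lineTaylor f (z - b) n (b + t • (z - b)))
      (by positivity) hq (fun n t ht => hasDerivAt_lineTaylor hf n (hseg t ht))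
      (fun n t ht => abs_lineTaylor_le (fun μ => hb μ _ (hseg t ht)) n)
    have e : lineTaylor f (z - b) 0 (b + (1 : ℝ) • (z - b)) = f z := by
      simp [lineTaylor, wordIndex, multiDeriv_zero]
    rw [e] at h1
    simp only [zero_smul, add_zero, ← taylorSeries_apply] at h1
    exact h1.tsum_eq
  have hUn : ∀ {z : Space d}, z ∈ closure (halfBall d) → (𝓝[halfBall d] z).NeBot := fun hz =>
    mem_closure_iff_nhdsWithin_neBot.1 hz
  -- Every point of the closure has an interior point b within distance η. The power series at b is
  -- continuous there, so the limit of f exists and equals its sum.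
  have hlim : ∀ b ∈ halfBall d, ∀ z ∈ closure (halfBall d), z ∈ Metric.eball b η →
      extendFrom (halfBall d) f z = (taylorSeries f b).sum (z - b) := by
    intro b hbU z hz hzb
    refine extendFrom_eq hz ?_
    have h1 := ((hps b hbU).analyticAt_of_mem hzb).continuousAt.tendsto.mono_left
      (nhdsWithin_le_nhds (s := halfBall d))
    refine h1.congr' ?_
    filter_upwards [self_mem_nhdsWithin,
      nhdsWithin_le_nhds (Metric.isOpen_eball.mem_nhds hzb)] with x hx hxb
    exact heq b hbU x hx hxb
  refine ⟨extendFrom (halfBall d) f, fun a ha => ?_, fun y hy => ?_⟩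
  · obtain ⟨b, hbU, hab⟩ := EMetric.mem_closure_iff.1 ha η (by exact_mod_cast hη0)
    have hab' : a ∈ Metric.eball b η := hab
    refine ((hps b hbU).analyticAt_of_mem hab').analyticWithinAt.congr_of_eventuallyEq_insert ?_
    rw [insert_eq_of_mem ha]
    filter_upwards [self_mem_nhdsWithin,
      nhdsWithin_le_nhds (Metric.isOpen_eball.mem_nhds hab')] with x hx hxb
    exact hlim b hbU x hx hxb
  · have hyb : y ∈ Metric.eball y (η : ℝ≥0∞) := Metric.mem_eball_self (by exact_mod_cast hη0)
    rw [hlim y hy y (subset_closure hy) hyb, heq y hy y hy hyb]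

end Taylor

end DegenerateSystem

namespace DegenerateSystem
open Set Filter Topology

variable {d m : ℕ}

/-! ### Comparison of the weak norms with the majorants -/

section Norms

variable {u f : Space d → ℝ}

theorem eLpNorm_top_eq_supNorm (hf : ContinuousOn f (halfBall d)) :
    eLpNorm f ∞ (volume.restrict (halfBall d)) = supNorm f := by
  rw [eLpNorm_exponent_top]
  refine le_antisymm ?_ ?_
  · refine essSup_le_of_ae_le _ ?_
    filter_upwards [ae_restrict_mem (measurableSet_halfBall d)] with y hy using le_supNorm hy
  · by_cases h : eLpNormEssSup f (volume.restrict (halfBall d)) = ∞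
    · rw [h]; exact le_top
    have hM := (ENNReal.ofReal_toReal h).symm
    rw [hM]
    refine supNorm_le_ofReal fun y hy => abs_le_of_ae hf ?_ hy
    filter_upwards [ae_le_eLpNormEssSup (f := f) (μ := volume.restrict (halfBall d))] with y hy
    rw [hM, ← ofReal_norm] at hy
    exact (ENNReal.ofReal_le_ofReal_iff ENNReal.toReal_nonneg).1 hy

theorem derivNorm_top_eq (hf : SmoothOn f (halfBall d))
    (hu : u =ᵐ[volume.restrict (halfBall d)] f) (μ : MultiIndex d) :
    derivNorm ∞ μ u = supNorm (multiDeriv μ f) := by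
  rw [derivNorm_eq (isWeakDeriv_congr hu.symm EventuallyEq.rfl (isWeakDeriv_multiDeriv hf μ)),
    eLpNorm_top_eq_supNorm (multiDeriv_smooth (isOpen_halfBall d) hf μ).continuousOn]

theorem weightedDerivNorm_top_eq (hf : SmoothOn f (halfBall d))
    (hu : u =ᵐ[volume.restrict (halfBall d)] f) (μ : MultiIndex d) :
    weightedDerivNorm ∞ μ u = supNorm fun y => normalCoord y * multiDeriv μ f y := by
  rw [weightedDerivNorm_eq
    (isWeakDeriv_congr hu.symm EventuallyEq.rfl (isWeakDeriv_multiDeriv hf μ)),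
    eLpNorm_top_eq_supNorm]
  exact (smoothOn_normalCoord _).continuousOn.mul
    (multiDeriv_smooth (isOpen_halfBall d) hf μ).continuousOn

theorem weightedTerm_eq (hf : SmoothOn f (halfBall d))
    (hu : u =ᵐ[volume.restrict (halfBall d)] f) (μ : MultiIndex d) (i : Fin (d + 1)) :
    weightedDerivNorm ∞ (μ + unitIndex i + unitIndex (Fin.last d)) u
      + ((μ (Fin.last d) + 1 : ℕ) : ℝ≥0∞) * derivNorm ∞ (μ + unitIndex i) u
      = weightedTerm μ (partialDeriv i f) := by
  have hU := isOpen_halfBall d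
  have e := multiDeriv_partialDeriv hU hf μ i
  rw [derivNorm_top_eq hf hu, weightedDerivNorm_top_eq hf hu, weightedTerm, supNorm_congr e]
  push_cast
  congr 1
  refine supNorm_congr fun y hy => ?_
  simp only [multiDeriv_add_unit hU hf _ _ hy, partialDeriv_congr hU e _ hy]

theorem tangentialMajorant_le {R : ℝ} (hR : 0 ≤ R) {f : Space d → ℝ} (s : ℕ) :
    tangentialMajorant s (ENNReal.ofReal R) f
      ≤ ∑' μ : {μ : MultiIndex d // μ (Fin.last d) = 0},
        ENNReal.ofReal (R ^ order μ.1 / ((order μ.1).factorial : ℝ)) * weightedTerm μ.1 f := by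
  set G : {μ : MultiIndex d // μ (Fin.last d) = 0} → ℝ≥0∞ := fun μ =>
    ENNReal.ofReal (R ^ order μ.1 / ((order μ.1).factorial : ℝ)) * weightedTerm μ.1 f with hG
  rw [← ENNReal.tsum_fiberwise G fun μ => order μ.1]
  refine le_trans (Finset.sum_le_sum fun k _ => ?_) (ENNReal.sum_le_tsum (Finset.range (s + 1)))
  rw [tangentialSup]
  simp only [ENNReal.mul_iSup]
  refine iSup₂_le fun μ hμ => ?_
  obtain ⟨rfl, hμ0⟩ := hμ
  refine le_trans (le_of_eq ?_) (ENNReal.le_tsum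
    (⟨⟨μ, hμ0⟩, rfl⟩ : (fun ν : {μ : MultiIndex d // μ (Fin.last d) = 0} => order ν.1) ⁻¹'
      {order μ}))
  simp only [hG]
  rw [ENNReal.ofReal_div_of_pos (by positivity), ENNReal.ofReal_pow hR, ENNReal.ofReal_natCast]

theorem tangentialMajorant_le_of_tangentialNorm {R : ℝ} (hR : 0 ≤ R) {v : Space d → Fin m → ℝ}
    {V : Fin m → Space d → ℝ} (hV : ∀ j, SmoothOn (V j) (halfBall d))
    (hv : ∀ j, (fun y => v y j) =ᵐ[volume.restrict (halfBall d)] V j) {T : ℝ≥0∞}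
    (ht : tangentialNorm R v ≤ T) (j : Fin m) (i : Fin (d + 1)) (s : ℕ) :
    tangentialMajorant s (ENNReal.ofReal R) (partialDeriv i (V j)) ≤ T := by
  refine (tangentialMajorant_le hR s).trans (le_trans ?_ ht)
  refine le_trans ?_ (Finset.single_le_sum (fun _ _ => zero_le) (Finset.mem_univ j))
  refine le_trans ?_ (Finset.single_le_sum (fun _ _ => zero_le) (Finset.mem_univ i))
  refine ENNReal.tsum_le_tsum fun μ => mul_le_mul_right ?_ _
  rw [← weightedTerm_eq (hV j) (hv j), μ.2]
  simp

/-- The sum over a box factors into d + 1 geometric sums, each at most 2. -/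
theorem sum_half_pow_order_le (s : Finset (MultiIndex d)) :
    ∑ μ ∈ s, (2⁻¹ : ℝ≥0∞) ^ order μ ≤ 2 ^ (d + 1) := by
  classical
  set N := s.sup fun μ => order μ with hN
  have hsub : s ⊆ Fintype.piFinset fun _ : Fin (d + 1) => Finset.range (N + 1) := fun μ hμ => by
    rw [Fintype.mem_piFinset]
    intro i
    rw [Finset.mem_range, Nat.lt_succ_iff]
    exact (le_order μ i).trans (Finset.le_sup (f := fun μ => order μ) hμ)
  refine (Finset.sum_le_sum_of_subset hsub).trans ?_
  have e : ∀ μ : MultiIndex d, (2⁻¹ : ℝ≥0∞) ^ order μ = ∏ i, (2⁻¹ : ℝ≥0∞) ^ μ i := fun μ =>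
    (Finset.prod_pow_eq_pow_sum _ _ _).symm
  simp only [e]
  rw [← Finset.prod_univ_sum]
  refine (Finset.prod_le_prod' (g := fun _ => (2 : ℝ≥0∞)) fun i _ => ?_).trans_eq (by simp)
  refine (ENNReal.sum_le_tsum _).trans ?_
  simpa only [pow_add, pow_zero, mul_one] using tsum_pow_add_le (le_refl (2⁻¹ : ℝ≥0∞)) 0

theorem le_weightedMajorant {s : ℕ} {R r : ℝ≥0∞} {μ : MultiIndex d} (hμ : order μ ≤ s) :
    R ^ order μ / ((order μ).factorial : ℝ≥0∞) * (r ^ μ (Fin.last d) * weightedTerm μ f)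
      ≤ weightedMajorant s R r f :=
  (mul_le_mul_right (le_weightedSup μ) _).trans
    (Finset.single_le_sum
      (f := fun k => R ^ k / (k.factorial : ℝ≥0∞) * weightedSup r k f)
      (fun _ _ => zero_le) (Finset.mem_range.2 (Nat.lt_succ_of_le hμ)))

/-- `gradNorm` sums over multi-indices where the majorant takes a supremum. Halving R supplies the
summable factor 2^{-|μ|}, and |μ| + μ_n ≤ s implies |μ| ≤ s. -/
theorem gradNorm_le {s : ℕ} {R r : ℝ} (hR : 0 ≤ R) (hr : 0 ≤ r) {v : Space d → Fin m → ℝ}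
    {V : Fin m → Space d → ℝ} (hV : ∀ j, SmoothOn (V j) (halfBall d))
    (hv : ∀ j, (fun y => v y j) =ᵐ[volume.restrict (halfBall d)] V j) :
    gradNorm s (R / 2) r v
      ≤ 2 ^ (d + 1) * gradMajorant s (ENNReal.ofReal R) (ENNReal.ofReal r) V := by
  rw [gradNorm, gradMajorant, Finset.mul_sum]
  refine Finset.sum_le_sum fun j _ => ?_
  rw [Finset.mul_sum]
  refine Finset.sum_le_sum fun i _ => ?_
  set X := weightedMajorant s (ENNReal.ofReal R) (ENNReal.ofReal r) (partialDeriv i (V j))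
  calc _ ≤ ∑' μ : {μ : MultiIndex d // order μ + μ (Fin.last d) ≤ s}, (2⁻¹ : ℝ≥0∞) ^ order μ.1 * X :=
        ENNReal.tsum_le_tsum fun μ => by
          rw [weightedTerm_eq (hV j) (hv j)]
          have hμ : order μ.1 ≤ s := le_self_add.trans μ.2
          have e : (R / 2) ^ order μ.1 * r ^ μ.1 (Fin.last d) / ((order μ.1).factorial : ℝ)
              = (2⁻¹) ^ order μ.1 *
                (R ^ order μ.1 / ((order μ.1).factorial : ℝ) * r ^ μ.1 (Fin.last d)) := by
            rw [div_pow, inv_pow]; ring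
          rw [e, ENNReal.ofReal_mul (by positivity), ENNReal.ofReal_mul (by positivity),
            ENNReal.ofReal_pow (by norm_num), ENNReal.ofReal_inv_of_pos (by norm_num),
            ENNReal.ofReal_ofNat, ENNReal.ofReal_div_of_pos (by positivity),
            ENNReal.ofReal_pow hR, ENNReal.ofReal_natCast, ENNReal.ofReal_pow hr,
            mul_assoc, mul_assoc]
          exact mul_le_mul_right (le_weightedMajorant hμ) _
    _ = (∑' μ : {μ : MultiIndex d // order μ + μ (Fin.last d) ≤ s}, (2⁻¹ : ℝ≥0∞) ^ order μ.1) * X :=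
        ENNReal.tsum_mul_right
    _ ≤ _ := by
      refine mul_le_mul_left ?_ X
      refine le_trans (ENNReal.tsum_comp_le_tsum_of_injective Subtype.val_injective
        fun μ : MultiIndex d => (2⁻¹ : ℝ≥0∞) ^ order μ) ?_
      rw [ENNReal.tsum_eq_iSup_sum]
      exact iSup_le fun t => sum_half_pow_order_le t

theorem sum_supNorm_le {s : ℕ} {R r a : ℝ} (hR : 0 < R) (hr : 0 < r)
    {V : Fin m → Space d → ℝ} (hX : gradMajorant s (ENNReal.ofReal R) (ENNReal.ofReal r) V
      ≤ ENNReal.ofReal a) {ν : MultiIndex d} (hν : order ν ≤ s) (i : Fin (d + 1)) :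
    ∑ j, supNorm (multiDeriv ν (partialDeriv i (V j)))
      ≤ ENNReal.ofReal (a * ((order ν).factorial / (R ^ order ν * r ^ ν (Fin.last d)))) := by
  set q : ℝ := R ^ order ν / (order ν).factorial * r ^ ν (Fin.last d) with hq
  have hq0 : 0 < q := by positivity
  have hqe : ENNReal.ofReal q = ENNReal.ofReal R ^ order ν / ((order ν).factorial : ℝ≥0∞)
      * ENNReal.ofReal r ^ ν (Fin.last d) := by
    rw [hq, ENNReal.ofReal_mul (by positivity), ENNReal.ofReal_div_of_pos (by positivity),
      ENNReal.ofReal_pow hR.le, ENNReal.ofReal_natCast, ENNReal.ofReal_pow hr.le]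
  have h1 : ENNReal.ofReal q * ∑ j, supNorm (multiDeriv ν (partialDeriv i (V j)))
      ≤ ENNReal.ofReal a := by
    refine le_trans ?_ hX
    rw [Finset.mul_sum]
    refine Finset.sum_le_sum fun j _ => ?_
    refine le_trans ?_ (Finset.single_le_sum (f := fun i => weightedMajorant s (ENNReal.ofReal R)
      (ENNReal.ofReal r) (partialDeriv i (V j))) (fun _ _ => zero_le) (Finset.mem_univ i))
    refine le_trans ?_ (le_weightedMajorant hν)
    rw [hqe, mul_assoc]
    gcongr
    exact supNorm_le_weightedTerm ν
  have h2 : a * ((order ν).factorial / (R ^ order ν * r ^ ν (Fin.last d))) = a / q := by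
    rw [hq]; field_simp
  rw [h2, ENNReal.ofReal_div_of_pos hq0]
  refine (ENNReal.le_div_iff_mul_le (Or.inl (ENNReal.ofReal_pos.2 hq0).ne')
    (Or.inl ENNReal.ofReal_ne_top)).2 ?_
  rwa [mul_comm]

end Norms

/-! ### Constants for the coefficients -/

section Coefficients

/-- One constant K = 1/ρ + L plays both roles: K N < 1 forces N below the admissible radius ρ, and K
dominates the constant L of the estimates. -/
theorem exists_majorantComp {B : State d m → ℝ} (hB : AnalyticAt ℝ B 0) :
    ∃ K : ℝ≥0∞, K ≠ ∞ ∧ MajorantComp B K := by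
  obtain ⟨ρ, hρ, L, hL, -, h⟩ := exists_majorant_comp_le (ι := StateIndex d m) (d := d) hB
  have hρ' := ENNReal.ofReal_pos.2 hρ
  refine ⟨(ENNReal.ofReal ρ)⁻¹ + L, ENNReal.add_ne_top.2 ⟨ENNReal.inv_ne_top.2 hρ'.ne', hL⟩,
    fun V hV s R r h1 h2 h3 h4 hN => ?_⟩
  have hN' : jetMajorant s R r V < ENNReal.ofReal ρ := by
    have h5 := (mul_le_mul_left (le_self_add (a := (ENNReal.ofReal ρ)⁻¹) (b := L))
      (jetMajorant s R r V)).trans_lt hN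
    calc jetMajorant s R r V
        = ENNReal.ofReal ρ * ((ENNReal.ofReal ρ)⁻¹ * jetMajorant s R r V) := by
          rw [← mul_assoc, ENNReal.mul_inv_cancel hρ'.ne' ENNReal.ofReal_ne_top, one_mul]
      _ < ENNReal.ofReal ρ * 1 := ENNReal.mul_lt_mul_right hρ'.ne' ENNReal.ofReal_ne_top h5
      _ = _ := mul_one _
  obtain ⟨a, b⟩ := h stateBasis norm_stateBasis_le (comps V) (smoothOn_comps hV) s R r h1 h2 h3 h4
    hN'
  exact ⟨a.trans (mul_le_mul_left le_add_self _), b.trans (mul_le_mul_left le_add_self _)⟩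

variable {γ : Fin m → ℝ} {A : Fin m → Fin (d + 1) → Fin (d + 1) → Grad d m → ℝ}
  {g : Fin m → State d m → ℝ}

theorem analyticAt_comp_snd {B : Grad d m → ℝ} (hB : AnalyticAt ℝ B 0) :
    AnalyticAt ℝ (fun x : State d m => B x.2) 0 :=
  AnalyticAt.comp (f := fun x : State d m => x.2) (x := 0) (by simpa using hB) analyticAt_snd

theorem exists_coeffBounds (hγ : ∀ j, 1 < γ j) (hA : ∀ j k l, AnalyticAt ℝ (A j k l) 0)
    (hg : ∀ j, AnalyticAt ℝ (g j) 0) (hA_nn : ∀ j, A j (Fin.last d) (Fin.last d) 0 = 0)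
    (hg_n : ∀ j i, fderiv ℝ (g j) 0 (stateBasis (Sum.inr (i, Fin.last d))) = 0)
    {ρ : ℝ} (hc : CoeffSmooth A g ρ) {K₀ : ℝ≥0∞} (hK₀ : K₀ ≠ ∞) :
    ∃ K : ℝ≥0∞, K ≠ ∞ ∧ K₀ ≤ K ∧ CoeffBounds γ A g ρ K := by
  choose KA hKA hA' using fun j k l => exists_majorantComp (analyticAt_comp_snd (hA j k l))
  choose Kg hKg hg' using fun j => exists_majorantComp (hg j)
  set K₁ := ∑ j, ∑ k, ∑ l, KA j k l with h1
  set K₂ := ∑ j, Kg j with h2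
  set K₃ := ∑ j, ‖γ j‖ₑ with h3
  set K₄ := ∑ j, ∑ k, ∑ l, ‖A j k l 0‖ₑ with h4
  set K₅ := ∑ j, ∑ a, ‖fderiv ℝ (g j) 0 (stateBasis a)‖ₑ with h5
  have le1 : ∀ {ι : Type} [Fintype ι] (f : ι → ℝ≥0∞) (i : ι), f i ≤ ∑ i, f i := fun f i =>
    Finset.single_le_sum (fun _ _ => zero_le) (Finset.mem_univ i)
  have a1 : K₁ ≤ K₀ + 1 + K₁ + K₂ + K₃ + K₄ + K₅ := by
    refine le_trans ?_ le_self_add; refine le_trans ?_ le_self_add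
    refine le_trans ?_ le_self_add; refine le_trans ?_ le_self_add
    exact le_add_self
  have a2 : K₂ ≤ K₀ + 1 + K₁ + K₂ + K₃ + K₄ + K₅ := by
    refine le_trans ?_ le_self_add; refine le_trans ?_ le_self_add
    refine le_trans ?_ le_self_add
    exact le_add_self
  have a3 : K₃ ≤ K₀ + 1 + K₁ + K₂ + K₃ + K₄ + K₅ := by
    refine le_trans ?_ le_self_add; refine le_trans ?_ le_self_add
    exact le_add_self
  have a4 : K₄ ≤ K₀ + 1 + K₁ + K₂ + K₃ + K₄ + K₅ := le_trans le_add_self le_self_add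
  have a0 : K₀ + 1 ≤ K₀ + 1 + K₁ + K₂ + K₃ + K₄ + K₅ := by
    refine le_trans ?_ le_self_add; refine le_trans ?_ le_self_add
    refine le_trans ?_ le_self_add; exact le_trans le_self_add le_self_add
  refine ⟨K₀ + 1 + K₁ + K₂ + K₃ + K₄ + K₅, ?_, le_self_add.trans a0, { hc with
    one_le := le_add_self.trans a0
    one_lt_exponent := hγ
    exponent_le := fun j => (le1 _ j).trans a3
    A_zero_le := fun j k l => ((le1 _ l).trans ((le1 (fun k => ∑ l, ‖A j k l 0‖ₑ) k).trans
      (le1 (fun j => ∑ k, ∑ l, ‖A j k l 0‖ₑ) j))).trans a4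
    A_normal := hA_nn
    A_comp := fun j k l => (hA' j k l).mono (((le1 _ l).trans ((le1 (fun k => ∑ l, KA j k l) k).trans
      (le1 (fun j => ∑ k, ∑ l, KA j k l) j))).trans a1)
    g_comp := fun j => (hg' j).mono ((le1 _ j).trans a2)
    g_deriv_le := fun j a => ((le1 _ a).trans
      (le1 (fun j => ∑ a, ‖fderiv ℝ (g j) 0 (stateBasis a)‖ₑ) j)).trans le_add_self
    g_deriv_normal := hg_n }⟩
  have f1 : K₁ ≠ ∞ := ENNReal.sum_ne_top.2 fun j _ => ENNReal.sum_ne_top.2 fun k _ =>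
    ENNReal.sum_ne_top.2 fun l _ => hKA j k l
  have f2 : K₂ ≠ ∞ := ENNReal.sum_ne_top.2 fun j _ => hKg j
  have f3 : K₃ ≠ ∞ := ENNReal.sum_ne_top.2 fun j _ => enorm_ne_top
  have f4 : K₄ ≠ ∞ := ENNReal.sum_ne_top.2 fun j _ => ENNReal.sum_ne_top.2 fun k _ =>
    ENNReal.sum_ne_top.2 fun l _ => enorm_ne_top
  have f5 : K₅ ≠ ∞ := ENNReal.sum_ne_top.2 fun j _ => ENNReal.sum_ne_top.2 fun a _ => enorm_ne_top
  simp [f1, f2, f3, f4, f5, hK₀]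

/-- A ball on which the coefficients are smooth and their relevant derivatives are under control. -/
theorem exists_coeffSmooth (hA : ∀ j k l, AnalyticAt ℝ (A j k l) 0)
    (hg : ∀ j, AnalyticAt ℝ (g j) 0) (hA_nn : ∀ j, A j (Fin.last d) (Fin.last d) 0 = 0)
    (hg_n : ∀ j i, fderiv ℝ (g j) 0 (stateBasis (Sum.inr (i, Fin.last d))) = 0) :
    ∃ ρ M : ℝ, 0 < ρ ∧ 0 ≤ M ∧ CoeffSmooth A g ρ ∧ ∀ x ∈ Metric.ball (0 : State d m) ρ,
      (∀ j, |A j (Fin.last d) (Fin.last d) x.2| ≤ 1 / 2) ∧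
      (∀ j k l i, |fderiv ℝ (fun x : State d m => A j k l x.2) x
        (stateBasis (Sum.inr (i, Fin.last d)))| ≤ M) ∧
      (∀ j i, |fderiv ℝ (g j) x (stateBasis (Sum.inr (i, Fin.last d)))| * (24 * m) ≤ 1 / 2) := by
  have hA' := fun j k l => analyticAt_comp_snd (m := m) (hA j k l)
  have hAd : ∀ j k l i, ContinuousAt (fun x => fderiv ℝ (fun x : State d m => A j k l x.2) x
      (stateBasis (Sum.inr (i, Fin.last d)))) 0 := fun j k l i =>
    (hA' j k l).fderiv.continuousAt.clm_apply continuousAt_const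
  have hgd : ∀ j i, ContinuousAt (fun x => fderiv ℝ (g j) x
      (stateBasis (Sum.inr (i, Fin.last d)))) 0 := fun j i =>
    (hg j).fderiv.continuousAt.clm_apply continuousAt_const
  -- The summand 1 makes the bound strict at the origin, so that it persists in a neighbourhood.
  set M : ℝ := 1 + ∑ j, ∑ k, ∑ l, ∑ i, |fderiv ℝ (fun x : State d m => A j k l x.2) 0
        (stateBasis (Sum.inr (i, Fin.last d)))| with hM
  have hM0 : ∀ j k l i, |fderiv ℝ (fun x : State d m => A j k l x.2) 0
        (stateBasis (Sum.inr (i, Fin.last d)))| < M := fun j k l i => by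
    have le1 : ∀ {ι : Type} [Fintype ι] (f : ι → ℝ) (i : ι), (∀ i, 0 ≤ f i) → f i ≤ ∑ i, f i :=
      fun f i hf => Finset.single_le_sum (f := f) (fun i _ => hf i) (Finset.mem_univ i)
    have s1 := le1 (fun i => |fderiv ℝ (fun x : State d m => A j k l x.2) 0
        (stateBasis (Sum.inr (i, Fin.last d)))|) i fun _ => abs_nonneg _
    have s2 := le1 (fun l => ∑ i, |fderiv ℝ (fun x : State d m => A j k l x.2) 0
        (stateBasis (Sum.inr (i, Fin.last d)))|) l fun _ => by positivity
    have s3 := le1 (fun k => ∑ l, ∑ i, |fderiv ℝ (fun x : State d m => A j k l x.2) 0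
        (stateBasis (Sum.inr (i, Fin.last d)))|) k fun _ => by positivity
    have s4 := le1 (fun j => ∑ k, ∑ l, ∑ i, |fderiv ℝ (fun x : State d m => A j k l x.2) 0
        (stateBasis (Sum.inr (i, Fin.last d)))|) j fun _ => by positivity
    linarith
  have ev : ∀ᶠ x in 𝓝 (0 : State d m),
      (∀ j k l, AnalyticAt ℝ (fun x : State d m => A j k l x.2) x) ∧ (∀ j, AnalyticAt ℝ (g j) x) ∧
      (∀ j, |A j (Fin.last d) (Fin.last d) x.2| ≤ 1 / 2) ∧
      (∀ j k l i, |fderiv ℝ (fun x : State d m => A j k l x.2) x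
        (stateBasis (Sum.inr (i, Fin.last d)))| ≤ M) ∧
      (∀ j i, |fderiv ℝ (g j) x (stateBasis (Sum.inr (i, Fin.last d)))| * (24 * m) ≤ 1 / 2) := by
    refine .and ?_ (.and ?_ (.and ?_ (.and ?_ ?_)))
    · exact eventually_all.2 fun j => eventually_all.2 fun k => eventually_all.2 fun l =>
        (hA' j k l).eventually_analyticAt
    · exact eventually_all.2 fun j => (hg j).eventually_analyticAt
    · refine eventually_all.2 fun j => ?_
      have h := (hA' j (Fin.last d) (Fin.last d)).continuousAt.abs
      refine (h.eventually_lt continuousAt_const ?_).mono fun x hx => hx.le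
      simp [hA_nn]
    · refine eventually_all.2 fun j => eventually_all.2 fun k => eventually_all.2 fun l =>
        eventually_all.2 fun i => ?_
      exact ((hAd j k l i).abs.eventually_lt continuousAt_const (hM0 j k l i)).mono fun x hx => hx.le
    · refine eventually_all.2 fun j => eventually_all.2 fun i => ?_
      refine (((hgd j i).abs.mul (continuousAt_const (y := (24 * m : ℝ)))).eventually_lt
        continuousAt_const ?_).mono fun x hx => hx.le
      simp [hg_n]
  obtain ⟨ρ, hρ, hball⟩ := Metric.eventually_nhds_iff_ball.1 ev
  refine ⟨ρ, M, hρ, by positivity, ⟨fun j k l => ?_, fun j => ?_, fun j x hx => ?_⟩,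
    fun x hx => (hball x hx).2.2⟩
  · exact AnalyticOnNhd.contDiffOn (fun x hx => (hball x hx).1 j k l)
      Metric.isOpen_ball.uniqueDiffOn
  · exact AnalyticOnNhd.contDiffOn (fun x hx => (hball x hx).2.1 j)
      Metric.isOpen_ball.uniqueDiffOn
  · have := (abs_le.1 ((hball x hx).2.2.1 j)).2
    linarith

end Coefficients

end DegenerateSystem

namespace DegenerateSystem
open Set Filter Topology

variable {d m : ℕ}

/-! ### Bounds from the tangential norm -/

section TangentialBounds

variable {f u : Space d → ℝ} {R T : ℝ}

theorem weightedTerm_le_of_tangentialMajorant (hR : 0 < R)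
    (h : ∀ s, tangentialMajorant s (ENNReal.ofReal R) f ≤ ENNReal.ofReal T) {μ : MultiIndex d}
    (hμ : μ (Fin.last d) = 0) :
    weightedTerm μ f ≤ ENNReal.ofReal (T * ((order μ).factorial / R ^ order μ)) := by
  have hq : 0 < R ^ order μ / (order μ).factorial := by positivity
  have h1 : ENNReal.ofReal (R ^ order μ / (order μ).factorial) * weightedTerm μ f
      ≤ ENNReal.ofReal T := by
    refine le_trans ?_ (h (order μ))
    rw [ENNReal.ofReal_div_of_pos (by positivity), ENNReal.ofReal_pow hR.le,
      ENNReal.ofReal_natCast]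
    exact (mul_le_mul_right (le_tangentialSup hμ) _).trans (Finset.single_le_sum
      (f := fun k => ENNReal.ofReal R ^ k / (k.factorial : ℝ≥0∞) * tangentialSup k f)
      (fun _ _ => zero_le) (Finset.self_mem_range_succ _))
  have h2 : T * ((order μ).factorial / R ^ order μ) = T / (R ^ order μ / (order μ).factorial) := by
    field_simp
  rw [h2, ENNReal.ofReal_div_of_pos hq]
  refine (ENNReal.le_div_iff_mul_le (Or.inl (ENNReal.ofReal_pos.2 hq).ne')
    (Or.inl ENNReal.ofReal_ne_top)).2 ?_
  rwa [mul_comm]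

theorem weightedBounded_of_weightedTerm_lt_top {μ : MultiIndex d} (h : weightedTerm μ f < ∞) :
    WeightedBounded μ f :=
  ⟨boundedOn_of_supNorm_lt_top ((supNorm_le_weightedTerm μ).trans_lt h),
    boundedOn_of_supNorm_lt_top (le_self_add.trans_lt h)⟩

/-- An outer normal derivative is covered by the weighted part of the order-zero term, an outer
tangential one by the order-one term, which costs 1/R. This makes the coupling coefficients small
with ε. -/
theorem abs_weighted_second_le (hR : 0 < R) (hT : 0 ≤ T) (hu : SmoothOn u (halfBall d))
    (h : ∀ i s, tangentialMajorant s (ENNReal.ofReal R) (partialDeriv i u) ≤ ENNReal.ofReal T)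
    (k l : Fin (d + 1)) {y : Space d} (hy : y ∈ halfBall d) :
    |normalCoord y * partialDeriv k (partialDeriv l u) y| ≤ T * (1 + R⁻¹) := by
  have hU := isOpen_halfBall d
  have hn : ∀ i, |normalCoord y * partialDeriv (Fin.last d) (partialDeriv i u) y| ≤ T := fun i => by
    have h1 := weightedTerm_le_of_tangentialMajorant hR (h i) (μ := 0) rfl
    rw [order_zero, pow_zero, Nat.factorial_zero, Nat.cast_one, div_one, mul_one] at h1
    have h2 := abs_le_of_supNorm hT (le_self_add.trans h1) hy
    rwa [multiDeriv_zero] at h2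
  have hT' : T ≤ T * (1 + R⁻¹) := le_mul_of_one_le_right hT (by simp [hR.le])
  by_cases hk : k = Fin.last d
  · subst hk; exact (hn l).trans hT'
  · have h0 : (unitIndex k : MultiIndex d) (Fin.last d) = 0 := unitIndex_ne (Ne.symm hk)
    have h1 := weightedTerm_le_of_tangentialMajorant hR (h l) h0
    rw [order_unitIndex, pow_one, Nat.factorial_one, Nat.cast_one, one_div] at h1
    have h2 := abs_le_of_supNorm (by positivity) ((supNorm_le_weightedTerm _).trans h1) hy
    rw [multiDeriv_unit hU (hu.partialDeriv hU l) k hy] at h2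
    rw [abs_mul, abs_of_pos (normalCoord_pos hy)]
    calc _ ≤ 1 * (T * R⁻¹) := mul_le_mul (normalCoord_lt_one hy).le h2 (abs_nonneg _) zero_le_one
      _ ≤ _ := by rw [one_mul, mul_add, mul_one]; exact le_add_of_nonneg_left hT

end TangentialBounds

/-! ### Assembly of the proof -/

section Main

variable {γ : Fin m → ℝ} {A : Fin m → Fin (d + 1) → Fin (d + 1) → Grad d m → ℝ}
  {g : Fin m → State d m → ℝ}

theorem CoeffSmooth.mono {ρ ρ' : ℝ} (hc : CoeffSmooth A g ρ) (h : ρ' ≤ ρ) :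
    CoeffSmooth A g ρ' :=
  have hs := Metric.ball_subset_ball (x := (0 : State d m)) h
  ⟨fun j k l => (hc.A_smooth j k l).mono hs, fun j => (hc.g_smooth j).mono hs,
    fun j x hx => hc.A_small j x (hs hx)⟩

theorem abs_nonlinearCoeff_le {V : Fin m → Space d → ℝ} {y : Space d} {M N δ : ℝ} (hM : 0 ≤ M)
    (hA : ∀ j k l i, |fderiv ℝ (fun x : State d m => A j k l x.2) (jet V y)
      (stateBasis (Sum.inr (i, Fin.last d)))| ≤ M)
    (hg : ∀ j i, |fderiv ℝ (g j) (jet V y) (stateBasis (Sum.inr (i, Fin.last d)))| ≤ δ)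
    (hV : ∀ j k l, |normalCoord y * partialDeriv k (partialDeriv l (V j)) y| ≤ N) (j i : Fin m) :
    |nonlinearCoeff A g V j i y| ≤ (d + 1) ^ 2 * (M * N) + δ := by
  refine (abs_add_le _ _).trans (add_le_add ?_ (hg j i))
  calc _ ≤ ∑ _k : Fin (d + 1), ∑ _l : Fin (d + 1), M * N := by
        refine (Finset.abs_sum_le_sum_abs _ _).trans (Finset.sum_le_sum fun k _ => ?_)
        refine (Finset.abs_sum_le_sum_abs _ _).trans (Finset.sum_le_sum fun l _ => ?_)
        rw [abs_mul]
        exact mul_le_mul (hA j k l i) (hV j k l) (abs_nonneg _) hM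
    _ = _ := by simp; ring

/-- Solutions with small tangentially analytic gradient have smooth representatives whose
derivatives are all bounded. -/
theorem exists_controlledSolution (hγ : ∀ j, 1 < γ j) (hA : ∀ j k l, AnalyticAt ℝ (A j k l) 0)
    (hg : ∀ j, AnalyticAt ℝ (g j) 0) (hA_nn : ∀ j, A j (Fin.last d) (Fin.last d) 0 = 0)
    (hg_n : ∀ j i, fderiv ℝ (g j) 0 (stateBasis (Sum.inr (i, Fin.last d))) = 0)
    {C₁ R₁ : ℝ} (hC₁ : 0 < C₁) (hR₁ : 0 < R₁) :
    ∃ ρ ε₁ : ℝ, CoeffSmooth A g ρ ∧ 0 < ε₁ ∧ ∀ ε : ℝ, 0 < ε → ε ≤ ε₁ →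
      ∀ v : Space d → Fin m → ℝ, IsSolution γ A g v →
        (∀ j, ∀ᵐ y ∂(volume.restrict (halfBall d)), |v y j| ≤ ε) →
        tangentialNorm R₁ v ≤ ENNReal.ofReal (C₁ * ε) →
        ∃ V : Fin m → Space d → ℝ,
          (∀ j, (fun y => v y j) =ᵐ[volume.restrict (halfBall d)] V j) ∧
          ControlledSolution γ A g ρ (ENNReal.ofReal R₁) (ENNReal.ofReal ε)
            (ENNReal.ofReal C₁ * ENNReal.ofReal ε) V := by
  obtain ⟨ρ, M, hρ, hM, hc, hb⟩ := exists_coeffSmooth hA hg hA_nn hg_n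
  -- Q ε is the share of the weighted second derivatives in 24 m |b|. It is made at most 1/2; the
  -- other half is reserved for the derivative of g.
  set Q : ℝ := (d + 1) ^ 2 * (M * (C₁ * (1 + R₁⁻¹))) * (24 * m) with hQ
  have hQ0 : 0 ≤ Q := by positivity
  refine ⟨ρ, min (ρ / 4) (min (ρ / (4 * C₁)) (1 / (2 * (Q + 1)))), hc, by positivity,
    fun ε hε hle v hv hvε ht => ?_⟩
  have e1 : ε ≤ ρ / 4 := hle.trans (min_le_left _ _)
  have e2 : ε ≤ ρ / (4 * C₁) := hle.trans ((min_le_right _ _).trans (min_le_left _ _))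
  have e3 : ε ≤ 1 / (2 * (Q + 1)) := hle.trans ((min_le_right _ _).trans (min_le_right _ _))
  have e2' : C₁ * ε ≤ ρ / 4 := by
    rw [le_div_iff₀ (by positivity)] at e2 ⊢; linarith
  have e3' : Q * ε ≤ 1 / 2 := by
    rw [le_div_iff₀ (by positivity)] at e3; linarith
  have hT : 0 ≤ C₁ * ε := by positivity
  -- With the radius ρ/2 the values of (v, ∇v) lie in a compact ball inside the ball of radius ρ,
  -- where all derivatives of the coefficients are bounded.
  obtain ⟨V, hV, hvV, hsol, hjet⟩ := exists_smooth_solution (hc.mono (half_le_self hρ.le))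
    (half_pos hρ) hv hR₁ hvε (by linarith) (by linarith) hT ht
  have hjet' : ∀ y ∈ halfBall d, jet V y ∈ Metric.ball (0 : State d m) ρ := fun y hy =>
    Metric.ball_subset_ball (half_le_self hρ.le) (hjet y hy)
  have htan := tangentialMajorant_le_of_tangentialNorm hR₁.le hV hvV ht
  have hV0 : ∀ j, ∀ y ∈ halfBall d, |V j y| ≤ ε := fun j y hy =>
    abs_le_of_ae (hV j).continuousOn
      (by filter_upwards [hvε j, hvV j] with y h1 h2; rwa [← h2]) hy
  have hnl : ∀ j i, ∀ y ∈ halfBall d, |nonlinearCoeff A g V j i y| * (24 * m) ≤ 1 :=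
    fun j i y hy => by
    have hm : 0 < 24 * (m : ℝ) := by
      have : 0 < (m : ℝ) := Nat.cast_pos.2 (Fin.pos j)
      positivity
    obtain ⟨-, h2, h3⟩ := hb _ (hjet' y hy)
    have h4 := abs_nonlinearCoeff_le hM h2 (fun j i => (le_div_iff₀ hm).2 (h3 j i))
      (fun j k l => abs_weighted_second_le hR₁ hT (hV j) (htan j) k l hy) j i
    calc _ ≤ ((d + 1) ^ 2 * (M * (C₁ * ε * (1 + R₁⁻¹))) + 1 / 2 / (24 * m)) * (24 * m) :=
          mul_le_mul_of_nonneg_right h4 hm.le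
      _ = Q * ε + 1 / 2 := by rw [add_mul, div_mul_cancel₀ _ hm.ne', hQ]; ring
      _ ≤ 1 := by linarith
  have hbd := weightedBounded_of_solution hγ hc (half_lt_self hρ) hV hsol
    (fun y hy => Metric.ball_subset_closedBall (hjet y hy)) (fun j => ⟨ε, hV0 j⟩)
    (fun j ν hν i => weightedBounded_of_weightedTerm_lt_top
      ((weightedTerm_le_of_tangentialMajorant hR₁ (htan j i) hν).trans_lt ENNReal.ofReal_lt_top))
    (fun j y hy => (hb _ (hjet' y hy)).1 j) hnl
  refine ⟨V, hvV, hV, hsol, hjet', fun j i μ => (hbd μ j i).1,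
    fun j => supNorm_le_ofReal (hV0 j), fun j i s => ?_⟩
  rw [← ENNReal.ofReal_mul hC₁.le]
  exact htan j i s

/-- Sup bounds for all derivatives of a function from majorant bounds for its gradient. -/
theorem sum_derivNorm_le {V : Fin m → Space d → ℝ} (hV : ∀ j, SmoothOn (V j) (halfBall d))
    {R a b : ℝ} (hR : 0 < R) (hR1 : R < 1) (ha : 0 ≤ a)
    (hX : ∀ s, gradMajorant s (ENNReal.ofReal R) (ENNReal.ofReal R) V ≤ ENNReal.ofReal a)
    (hb : 0 ≤ b) (hV0 : ∀ j, supNorm (V j) ≤ ENNReal.ofReal b) (μ : MultiIndex d) :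
    ∑ j, supNorm (multiDeriv μ (V j))
      ≤ ENNReal.ofReal ((m * b + a) * ((R * (R / 2))⁻¹) ^ order μ * (order μ).factorial) := by
  have hU := isOpen_halfBall d
  rcases hk : order μ with _ | k
  · obtain rfl := eq_zero_of_order hk
    simp only [multiDeriv_zero]
    calc _ ≤ ∑ _j : Fin m, ENNReal.ofReal b := Finset.sum_le_sum fun j _ => hV0 j
      _ = ENNReal.ofReal (m * b) := by
        rw [Finset.sum_const, Finset.card_univ, Fintype.card_fin, nsmul_eq_mul,
          ENNReal.ofReal_mul (Nat.cast_nonneg _), ENNReal.ofReal_natCast]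
      _ ≤ _ := ENNReal.ofReal_le_ofReal (by simpa using ha)
  · obtain ⟨ν, i, rfl, hν⟩ := exists_unit_of_order_succ hk
    have h1 := sum_supNorm_le hR hR (hX k) hν.le i
    simp only [supNorm_congr (multiDeriv_partialDeriv hU (hV _) ν i)] at h1
    refine h1.trans (ENNReal.ofReal_le_ofReal ?_)
    rw [hν]
    have hνl : ν (Fin.last d) ≤ k := hν ▸ le_order ν _
    -- Since ν_n ≤ k and R < 1, a single power of the product of the radii absorbs both the order
    -- weight and the normal weight.
    have h2 : (R * (R / 2)) ^ (k + 1) ≤ R ^ k * R ^ ν (Fin.last d) :=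
      calc (R * (R / 2)) ^ (k + 1) ≤ (R * (R / 2)) ^ k :=
            pow_le_pow_of_le_one (by positivity) (by nlinarith) (Nat.le_succ k)
        _ ≤ (R * R) ^ k := by gcongr; linarith
        _ = R ^ k * R ^ k := mul_pow _ _ _
        _ ≤ _ := mul_le_mul_of_nonneg_left (pow_le_pow_of_le_one hR.le hR1.le hνl) (by positivity)
    calc a * (k.factorial / (R ^ k * R ^ ν (Fin.last d)))
        ≤ (m * b + a) * ((k + 1).factorial / (R * (R / 2)) ^ (k + 1)) := by
          gcongr
          · exact le_add_of_nonneg_left (by positivity)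
          · exact Nat.le_succ k
      _ = _ := by rw [inv_pow]; ring

end Main

end DegenerateSystem

theorem mainTheorem7 (d m : ℕ) (hd : 1 ≤ d) (hm : 1 ≤ m)
    (p : ℝ≥0∞) (hp : ((d + 1 : ℕ) : ℝ≥0∞) < p) (hp_top : p ≠ ∞)
    (γ : Fin m → ℝ) (hγ : ∀ j, 1 < γ j)
    (A : Fin m → Fin (d + 1) → Fin (d + 1) → DegenerateSystem.Grad d m → ℝ)
    (hA : ∀ j k l, AnalyticAt ℝ (A j k l) 0)
    (g : Fin m → (Fin m → ℝ) × DegenerateSystem.Grad d m → ℝ)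
    (hg : ∀ j, AnalyticAt ℝ (g j) 0)
    (hA_nn : ∀ j, A j (Fin.last d) (Fin.last d) 0 = 0)
    (hg_n : ∀ j i, fderiv ℝ (g j) 0 (0, Pi.single i (Pi.single (Fin.last d) 1)) = 0)
    (C C₁ R₁ : ℝ) (hC : 0 < C) (hC₁ : 0 < C₁) (hR₁ : 0 < R₁) :
    ∃ C₀ r R εbar : ℝ, 0 < C₀ ∧ 0 < r ∧ r < 1 ∧ 0 < R ∧ R < 1 ∧ 0 < εbar ∧
      ∀ ε₀ : ℝ, 0 < ε₀ → ε₀ ≤ εbar →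
      ∀ v : DegenerateSystem.Space d → Fin m → ℝ,
        DegenerateSystem.IsSolution γ A g v →
        (∀ j, ∀ᵐ y ∂(volume.restrict (DegenerateSystem.halfBall d)), |v y j| ≤ ε₀) →
        (∑ j, DegenerateSystem.wStarNorm 3 p (fun y => v y j) ≤ ENNReal.ofReal (C * ε₀)) →
        DegenerateSystem.tangentialNorm R₁ v ≤ ENNReal.ofReal (C₁ * ε₀) →
        (∀ s : ℕ, DegenerateSystem.gradNorm s R r v ≤ ENNReal.ofReal (C₀ * ε₀)) ∧
        (∀ μ : DegenerateSystem.MultiIndex d,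
          ∑ j, DegenerateSystem.derivNorm ∞ μ (fun y => v y j)
            ≤ ENNReal.ofReal
                (C₀ * ((r * R)⁻¹) ^ DegenerateSystem.order μ
                  * ((DegenerateSystem.order μ).factorial : ℝ))) ∧
        ∃ V : DegenerateSystem.Space d → Fin m → ℝ,
          AnalyticOn ℝ V (closure (DegenerateSystem.halfBall d)) ∧
          v =ᵐ[volume.restrict (DegenerateSystem.halfBall d)] V := by
  have hg_n' : ∀ j i, fderiv ℝ (g j) 0 (DegenerateSystem.stateBasis (Sum.inr (i, Fin.last d))) = 0 := hg_n
  obtain ⟨ρ, ε₁, hc, hε₁, hsol⟩ :=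
    DegenerateSystem.exists_controlledSolution hγ hA hg hA_nn hg_n' hC₁ hR₁
  have hR₁' : ENNReal.ofReal R₁ ≠ 0 := (ENNReal.ofReal_pos.2 hR₁).ne'
  obtain ⟨K, hKt, hK, hb⟩ :=
    DegenerateSystem.exists_coeffBounds hγ hA hg hA_nn hg_n' hc (ENNReal.inv_ne_top.2 hR₁')
  obtain ⟨R, hR, hR1, C₂, ε₂, hC₂, hε₂, hmaj⟩ := DegenerateSystem.exists_gradMajorant_le hb hKt
    (ENNReal.ofReal_ne_top (r := C₁)) hR₁' ENNReal.ofReal_ne_top hK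
  -- The normal weight is the radius R just obtained, and the order radius is its half, which pays
  -- for summing over multi-indices with the factor 2^{d+1}. The summand m covers the values of v,
  -- by ε ≤ 1, and the summand 1 makes the constant positive.
  refine ⟨2 ^ (d + 1) * C₂ + m + 1, R, R / 2, min 1 (min ε₁ ε₂), by positivity, hR, hR1,
    half_pos hR, by linarith, by positivity, fun ε hε hle v hv hvε _ ht => ?_⟩
  obtain ⟨V, hvV, hV⟩ :=
    hsol ε hε (hle.trans ((min_le_right _ _).trans (min_le_left _ _))) v hv hvε ht
  have hX := hmaj ε hε (hle.trans ((min_le_right _ _).trans (min_le_right _ _))) V hV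
  have hε1 : ε ≤ 1 := hle.trans (min_le_left _ _)
  have hder : ∀ μ : DegenerateSystem.MultiIndex d,
      ∑ j, DegenerateSystem.derivNorm ∞ μ (fun y => v y j)
        ≤ ENNReal.ofReal ((2 ^ (d + 1) * C₂ + m + 1) * ((R * (R / 2))⁻¹)
          ^ DegenerateSystem.order μ * ((DegenerateSystem.order μ).factorial : ℝ)) := fun μ => by
    simp only [fun j => DegenerateSystem.derivNorm_top_eq (hV.smooth j) (hvV j) μ]
    refine (DegenerateSystem.sum_derivNorm_le hV.smooth hR hR1 (by positivity) hX hε.le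
      hV.value_le μ).trans (ENNReal.ofReal_le_ofReal ?_)
    refine mul_le_mul_of_nonneg_right (mul_le_mul_of_nonneg_right ?_ (by positivity))
      (by positivity)
    have h1 : (1 : ℝ) ≤ 2 ^ (d + 1) := one_le_pow₀ one_le_two
    have h2 : C₂ * ε ≤ 2 ^ (d + 1) * C₂ := by
      rw [mul_comm]; exact mul_le_mul_of_nonneg_right (hε1.trans h1) hC₂
    have h3 : (m : ℝ) * ε ≤ m := mul_le_of_le_one_right (Nat.cast_nonneg m) hε1
    linarith
  refine ⟨fun s => ?_, hder, ?_⟩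
  · refine (DegenerateSystem.gradNorm_le hR.le hR.le hV.smooth hvV).trans
      ((mul_le_mul_right (hX s) _).trans ?_)
    have h2 : (2 : ℝ≥0∞) ^ (d + 1) = ENNReal.ofReal (2 ^ (d + 1)) := by
      rw [ENNReal.ofReal_pow zero_le_two, ENNReal.ofReal_ofNat]
    rw [h2, ← ENNReal.ofReal_mul (by positivity), ← mul_assoc]
    refine ENNReal.ofReal_le_ofReal (mul_le_mul_of_nonneg_right ?_ hε.le)
    linarith [Nat.cast_nonneg (α := ℝ) m]
  · choose F hF hVF using fun j => DegenerateSystem.exists_analyticOn_closure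
      (C := 2 ^ (d + 1) * C₂ + m + 1) (ρ := R * (R / 2)) (by positivity) (by positivity)
      (hV.smooth j) fun μ y hy => DegenerateSystem.abs_le_of_supNorm (by positivity)
        (by
          have h := hder μ
          simp only [fun j => DegenerateSystem.derivNorm_top_eq (hV.smooth j) (hvV j) μ] at h
          rw [mul_right_comm]
          exact (Finset.single_le_sum (fun _ _ => zero_le) (Finset.mem_univ j)).trans h) hy
    refine ⟨fun y j => F j y, AnalyticOn.pi hF, ?_⟩
    filter_upwards [Filter.eventually_all.2 hvV,
      ae_restrict_mem (DegenerateSystem.measurableSet_halfBall d)] with y h1 h2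
    exact funext fun j => (h1 j).trans (hVF j h2)
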